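/- **Setting.** Let $X$ be a projective, smooth, geometrically connected curve over the finite field $\mathbb F_q$, $\infty\in X(\mathbb F_q)$, $A=\mathcal O(X\setminus\{\infty\})$, let $\mathfrak p\subset A$ be a maximal ideal, $\hat q=|A/\mathfrak p|$ and $t\in\mathfrak p\setminus\mathfrak p^2$. Let $R$ be an $A$-algebra which is a complete discrete valuation ring whose maximal ideal is generated by the image $\pi$ of $t$ and in which $\mathfrak pR\subseteq\pi R$, and let $\phi:R\to R$ be an $A$-algebra endomorphism with $\phi(x)\equiv x^{\hat q}\bmod\pi$. Formal schemes over $\mathrm{Spf}\,R$ are regarded as functors on the $R$-algebras $B$ in which $\pi$ is nilpotent, and $\hat{\mathbb G}_a(B)=B$. The ring $W_n(B)$ of $\pi$-typical function-field Witt vectors is the set $B^{n+1}$ with the functorial ring structure for which the ghost maps $(x_0,\dots,x_n)\mapsto\sum_{j\le s}\pi^jx_j^{\hat q^{\,s-j}}$, $0\le s\le n$, are ring homomorphisms; it is an $R$-algebra through $R\to W(R)\to W_n(B)$, where the first map has ghost components $r\mapsto\phi^s(r)$. Let $F:W_n(B)\to W_{n-1}(B^\phi)$ be the Frobenius (the left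 shift on ghost components), where $B^\phi$ is the ring $B$ with structure map $R\xrightarrow{\phi}R\to B$. Let $E$ be a Drinfeld module of rank $r$ over $\mathrm{Spf}\,R$ with a coordinate: the $\mathbb F_q$-module formal scheme $\hat{\mathbb G}_a$ with an action of $A$ that extends that of $\mathbb F_q$, induces on the tangent space the structure map $A\to R$, and is such that for every $0\ne a\in A$ the kernel of $a$ is finite (free) of degree $q^{-r\,\mathrm{ord}_\infty(a)}$. Put * $J^nE(B)=E(W_n(B))$ and $N^n=\ker(J^nE\to E)$, with inclusion $i:N^n\to J^nE$, $(x_1,\dots,x_n)\mapsto(0,x_1,\dots,x_n)$, projections $u$ (truncation), the Frobenius $J^nE\to J^{n-1}E$ induced by $F$, and the Teichmüller section $v:E\to J^nE$, $v(x)=(x,0,\dots,0)$; * $\mathbf X_n(E)=\mathrm{Hom}_A(J^nE,\hat{\mathbb G}_a)$; $\phi^*$ is the $\phi$-semilinear pullback along the Frobenius, from functions on $J^{n-1}E$ to functions on $J^nE$, given on $B$-points by $(\phi^*\Theta)_B=\Theta_{B^\phi}\circ F$; * $\mathfrak f:N^{n+1}\to N^n$, the lateral Frobenius: in the coordinates $(x_1,\dots,x_{n+1})$,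 regarded as a Witt vector, it is $F$; $\mathfrak f^*$ is the $\phi$-semilinear pullback $(\mathfrak f^*\Psi)_B=\Psi_{B^\phi}\circ F$; * $\mathbf H_n(E)=\mathrm{Hom}_A(N^n,\hat{\mathbb G}_a)\big/\bigl(R\text{-span of }i^*\phi^*\mathbf X_{n-1}(E)\bigr)$ (with $\mathbf H_0(E)=0$) and $\mathbf H(E)=\varinjlim_{u^*}\mathbf H_n(E)$; * $\mathrm{Ext}(E,\hat{\mathbb G}_a)$, the $R$-module of isomorphism classes of extensions of $E$ by $\hat{\mathbb G}_a$ as strict $A$-module formal schemes (those on which $A$ acts on the Lie algebra through $A\to R$) that split as extensions of $\mathbb F_q$-module formal schemes; $\mathbf H_{\mathrm{dR}}(E)$, the $R$-module of isomorphism classes of such extensions together with a splitting of the extension of Lie algebras; * $\partial:\mathrm{Hom}_A(N^n,\hat{\mathbb G}_a)\to\mathrm{Ext}(E,\hat{\mathbb G}_a)$, sending $\Psi$ to the push-out $E_\Psi^*$ along $\Psi$ of the extension $0\to N^n\to J^nE\to E\to0$; $\mathbf I_n(E)$, the image of $\partial$, and $\mathbf I(E)=\varinjlim_n\mathbf I_n(E)$;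 * $s_\Psi$, the splitting of the Lie algebra extension of $E_\Psi^*$ induced by the retraction $(x_0,\dots,x_n)\mapsto(x_1,\dots,x_n)$ of $J^nE$ onto $N^n$. Suppose $E$ splits at $m$, that is, $\mathbf X_m(E)\ne0$ and $\mathbf X_i(E)=0$ for $0\le i<m$. **Theorem.** The $R$-module $\mathbf H(E)$ is free of rank $m$. The operators $\mathfrak f^*:\mathrm{Hom}_A(N^n,\hat{\mathbb G}_a)\to\mathrm{Hom}_A(N^{n+1},\hat{\mathbb G}_a)$ are well defined and induce a $\phi$-semilinear endomorphism $\mathfrak f^*$ of $\mathbf H(E)$. The assignments $\Psi\mapsto\partial\Psi$ and $\Psi\mapsto(E_\Psi^*,s_\Psi)$ induce $R$-linear maps $\mathbf H(E)\to\mathbf I(E)$ and $\Phi:\mathbf H(E)\to\mathbf H_{\mathrm{dR}}(E)$, and there is an $R$-linear map $\Upsilon$ such that, with the map $\mathbf X_m(E)\to\mathbf H(E)$ induced by $i^*$ and the canonical maps elsewhere, $$\begin{array}{ccccccccc}0&\to&\mathbf X_m(E)&\to&\mathbf H(E)&\to&\mathbf I(E)&\to&0\\&&\downarrow{\scriptstyle\Upsilon}&&\downarrow{\scriptstyle\Phi}&&\downarrow&&\\0&\to&\mathrm{Lie}(E)^*&\to&\mathbf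 H_{\mathrm{dR}}(E)&\to&\mathrm{Ext}(E,\hat{\mathbb G}_a)&\to&0\end{array}$$ is a commutative diagram with exact rows. The map $\mathbf I(E)\to\mathrm{Ext}(E,\hat{\mathbb G}_a)$ is injective. The operator $\mathfrak f^*$ descends to the image of $\Phi$: there is a $\phi$-semilinear endomorphism $\bar{\mathfrak f}$ of $\Phi(\mathbf H(E))$ with $\bar{\mathfrak f}(\Phi(h))=\Phi(\mathfrak f^*h)$ for all $h$. Finally, let $\vartheta\in\mathrm{Hom}_A(N^1,\hat{\mathbb G}_a)$ have derivative $1$ at $0$, let $\Psi_i=\vartheta\circ\mathfrak f^{\,i-1}$ (regarded as a function on $N^m$ through $u$) for $1\le i\le m$, let $\Theta_m\in\mathbf X_m(E)$ satisfy $i^*\Theta_m=\Psi_m-\lambda_{m-1}\Psi_{m-1}-\dots-\lambda_1\Psi_1$ with $\lambda_i\in R$, and put $g=v^*\Theta_m$, $\gamma=\pi g'(0)$. Such $\vartheta$, $\Theta_m$ exist, $\gamma\in R$ depends only on $E$ and its coordinate, and $\Phi$ is injective if and only if $\gamma\ne0$. -/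

import Mathlib

set_option linter.style.haveILetI false
set_option linter.unusedSectionVars false

universe u v

noncomputable section

section
open AlgebraicGeometry CategoryTheory

/-- A projective, smooth, geometrically connected curve `X` over `Fq` with a rational point `∞`,
and an identification of `A` with the coordinate ring of `U = X ∖ {∞}`. (For curves, proper and
projective mean the same.) -/
structure PuncturedCurve (Fq A : Type v) [Field Fq] [CommRing A] [Algebra Fq A] where
  X : Scheme.{v}
  toSpec : X ⟶ Spec (CommRingCat.of Fq)
  [isIntegral : IsIntegral X]
  [isProper : IsProper toSpec]
  [smooth : SmoothOfRelativeDimension 1 toSpec]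
  [geomConn : GeometricallyConnected toSpec]
  infty : Spec (CommRingCat.of Fq) ⟶ X
  infty_toSpec : infty ≫ toSpec = 𝟙 _
  U : X.Opens
  U_eq : (U : Set X) = (Set.range infty)ᶜ
  coord : A ≃+* Γ(X, U)
  coord_algebraMap : ∀ c : Fq, coord (algebraMap Fq A c) =
    (toSpec.appLE ⊤ U le_top).hom ((Scheme.ΓSpecIso (CommRingCat.of Fq)).inv.hom c)

attribute [instance] PuncturedCurve.isIntegral

variable {Fq A : Type v} [Field Fq] [CommRing A] [Algebra Fq A]

/-- The point `∞` of the underlying space of `X`. -/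
def PuncturedCurve.inftyPoint (C : PuncturedCurve Fq A) : C.X :=
  C.infty (IsLocalRing.closedPoint Fq)

/-- `ord_∞(a) = -d`: in the function field of `X`, `ϖ ^ d * a` is a unit of the local ring
at `∞`, where `ϖ` is a uniformiser there. -/
def PuncturedCurve.HasPoleOrder (C : PuncturedCurve Fq A) (a : A) (d : ℕ) : Prop :=
  ∃ (h : genericPoint C.X ∈ C.U) (ϖ w : C.X.presheaf.stalk C.inftyPoint),
    Irreducible ϖ ∧ IsUnit w ∧
    algebraMap _ C.X.functionField ϖ ^ d * C.X.presheaf.germ C.U (genericPoint C.X) h (C.coord a)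
      = algebraMap _ C.X.functionField w
end

/-- The base data: a maximal ideal `𝔭` of `A`, an element `t` of `𝔭` outside `𝔭 ^ 2` with image `π`
in `R`, such that `R` is a complete discrete valuation ring with maximal ideal `π R` in which
`𝔭 R ⊆ π R` (so that `A → R` extends to the `𝔭`-adic completion of `A`), and an `A`-algebra
endomorphism `φ` of `R` lifting the Frobenius `x ↦ x ^ |A / 𝔭|` modulo `π`. -/
structure FrobBase (Fq A : Type v) (R : Type u) [Field Fq] [CommRing A] [Algebra Fq A]
    [CommRing R] [IsDomain R] [IsDiscreteValuationRing R] [Algebra A R] where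
  𝔭 : Ideal A
  isMaximal : 𝔭.IsMaximal
  t : A
  t_mem : t ∈ 𝔭
  t_notMem : t ∉ 𝔭 ^ 2
  map_le : 𝔭.map (algebraMap A R) ≤ Ideal.span {algebraMap A R t}
  span_eq : Ideal.span {algebraMap A R t} = IsLocalRing.maximalIdeal R
  complete : IsAdicComplete (IsLocalRing.maximalIdeal R) R
  φ : R →ₐ[A] R
  φ_lift : ∀ x : R, φ x - x ^ Nat.card (A ⧸ 𝔭) ∈ Ideal.span {algebraMap A R t}

namespace FrobBase

section Witt

variable {Fq A : Type v} {R : Type u} [Field Fq] [CommRing A] [Algebra Fq A]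
  [CommRing R] [IsDomain R] [IsDiscreteValuationRing R] [Algebra A R] (D : FrobBase Fq A R)

/-- The image `π` of `t` in `R`. -/
def π : R := algebraMap A R D.t

/-- The cardinality of the residue field `A / 𝔭`. -/
def Q : ℕ := Nat.card (A ⧸ D.𝔭)

lemma dvd_φ (x : R) : D.π ∣ D.φ x - x ^ D.Q := Ideal.mem_span_singleton.1 (D.φ_lift x)

lemma φ_π : D.φ D.π = D.π := D.φ.commutes D.t

lemma π_not_unit : ¬ IsUnit D.π := by
  intro h
  have h1 := D.span_eq
  have h2 : Ideal.span {algebraMap A R D.t} = ⊤ := Ideal.span_singleton_eq_top.2 h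
  exact (IsLocalRing.maximalIdeal.isMaximal R).ne_top (h1.symm.trans h2)

lemma π_ne_zero : D.π ≠ 0 := by
  intro h
  have h1 := D.span_eq
  have h2 : algebraMap A R D.t = 0 := h
  rw [h2, Ideal.span_singleton_zero] at h1
  exact IsDiscreteValuationRing.not_a_field R h1.symm

lemma exists_expChar : ∃ p k : ℕ, p.Prime ∧ CharP R p ∧ k ≠ 0 ∧ D.Q = p ^ k := by
  have hQ0 : D.Q ≠ 0 := by
    intro h0
    have h1 := D.dvd_φ 0
    rw [h0] at h1
    simp only [map_zero, pow_zero, zero_sub, dvd_neg] at h1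
    exact D.π_not_unit (isUnit_of_dvd_one h1)
  haveI := D.isMaximal
  letI : Field (A ⧸ D.𝔭) := Ideal.Quotient.field D.𝔭
  haveI : Finite (A ⧸ D.𝔭) := Nat.finite_of_card_ne_zero hQ0
  letI : Fintype (A ⧸ D.𝔭) := Fintype.ofFinite _
  obtain ⟨p, hp⟩ := CharP.exists Fq
  haveI : CharP (A ⧸ D.𝔭) p := charP_of_injective_algebraMap (algebraMap Fq (A ⧸ D.𝔭)).injective p
  obtain ⟨n, hn, hc⟩ := FiniteField.card (A ⧸ D.𝔭) p
  refine ⟨p, n, hn, ?_, n.ne_zero, ?_⟩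
  · exact charP_of_injective_ringHom (((algebraMap A R).comp (algebraMap Fq A)).injective) p
  · rw [Q, Nat.card_eq_fintype_card, hc]

lemma two_le_Q : 2 ≤ D.Q := by
  obtain ⟨p, k, hp, -, hk, h⟩ := D.exists_expChar
  rw [h]
  exact hp.two_le.trans (Nat.le_self_pow hk p)

lemma Q_ne_zero : D.Q ≠ 0 := by have := D.two_le_Q; omega

lemma lt_Q_pow (k : ℕ) : k < D.Q ^ k := Nat.lt_pow_self D.two_le_Q

lemma Q_pow_ne_zero (k : ℕ) : D.Q ^ k ≠ 0 := pow_ne_zero _ D.Q_ne_zero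

lemma scalar_pow (c : Fq) :
    (algebraMap A R (algebraMap Fq A c)) ^ D.Q = algebraMap A R (algebraMap Fq A c) := by
  haveI := D.isMaximal
  letI : Field (A ⧸ D.𝔭) := Ideal.Quotient.field D.𝔭
  haveI : Finite (A ⧸ D.𝔭) := Nat.finite_of_card_ne_zero D.Q_ne_zero
  letI : Fintype (A ⧸ D.𝔭) := Fintype.ofFinite _
  have h : c ^ D.Q = c := by
    apply (algebraMap Fq (A ⧸ D.𝔭)).injective
    rw [map_pow, Q, Nat.card_eq_fintype_card, FiniteField.pow_card]
  rw [← map_pow, ← map_pow, h]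

section Alg
variable {B : Type*} [CommRing B] [Algebra R B]

lemma add_pow_Q (x y : B) (k : ℕ) : (x + y) ^ D.Q ^ k = x ^ D.Q ^ k + y ^ D.Q ^ k := by
  obtain ⟨p, j, hp, hc, -, h⟩ := D.exists_expChar
  cases subsingleton_or_nontrivial B
  · exact Subsingleton.elim _ _
  haveI : CharP Fq p := (((algebraMap A R).comp (algebraMap Fq A)).charP_iff
    ((algebraMap A R).comp (algebraMap Fq A)).injective p).2 hc
  haveI : CharP B p := charP_of_injective_ringHom
    (((algebraMap R B).comp ((algebraMap A R).comp (algebraMap Fq A))).injective) p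
  haveI : Fact p.Prime := ⟨hp⟩
  rw [h, ← pow_mul]
  exact add_pow_expChar_pow x y p _

lemma sub_pow_Q (x y : B) (k : ℕ) : (x - y) ^ D.Q ^ k = x ^ D.Q ^ k - y ^ D.Q ^ k := by
  have h := D.add_pow_Q (x - y) y k
  rw [sub_add_cancel] at h
  rw [h, add_sub_cancel_right]

lemma sum_pow_Q {ι : Type*} (s : Finset ι) (f : ι → B) (k : ℕ) :
    (∑ i ∈ s, f i) ^ D.Q ^ k = ∑ i ∈ s, f i ^ D.Q ^ k := by
  classical
  induction s using Finset.induction_on with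
  | empty => rw [Finset.sum_empty, Finset.sum_empty, zero_pow (D.Q_pow_ne_zero k)]
  | insert a s ha ih => rw [Finset.sum_insert ha, Finset.sum_insert ha, D.add_pow_Q, ih]

/-- The `s`-th Witt polynomial (ghost component) of a sequence. -/
def ghost (x : ℕ → B) (s : ℕ) : B :=
  ∑ j ∈ Finset.range (s + 1), algebraMap R B D.π ^ j * x j ^ D.Q ^ (s - j)

end Alg

open Classical in
/-- The Witt components of the image of `r` under the canonical map `R → W(R)`; they are
characterised by `ghost_wc`. -/
def wc (r : R) (s : ℕ) : R :=
  if h : ∃ y, D.π ^ s * y =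
      D.φ^[s] r - ∑ j : Fin s, D.π ^ (j : ℕ) * wc r j ^ D.Q ^ (s - j) then h.choose else 0
termination_by s
decreasing_by exact j.2

lemma wc_spec {r : R} {s : ℕ}
    (h : D.π ^ s ∣ D.φ^[s] r - ∑ j ∈ Finset.range s, D.π ^ j * D.wc r j ^ D.Q ^ (s - j)) :
    D.ghost (D.wc r) s = D.φ^[s] r := by
  rw [← Fin.sum_univ_eq_sum_range (fun j => D.π ^ j * D.wc r j ^ D.Q ^ (s - j))] at h
  have h' : ∃ y, D.π ^ s * y =
      D.φ^[s] r - ∑ j : Fin s, D.π ^ (j : ℕ) * D.wc r j ^ D.Q ^ (s - j) := by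
    obtain ⟨y, hy⟩ := h
    exact ⟨y, hy.symm⟩
  have e : D.wc r s = h'.choose := by
    rw [wc, dif_pos h']
  have e2 := h'.choose_spec
  rw [← e, Fin.sum_univ_eq_sum_range (fun j => D.π ^ j * D.wc r j ^ D.Q ^ (s - j))] at e2
  rw [ghost, Finset.sum_range_succ]
  simp only [Algebra.algebraMap_self, RingHom.id_apply, Nat.sub_self, pow_zero, pow_one]
  rw [e2]
  ring

lemma ghost_wc (r : R) (s : ℕ) : D.ghost (D.wc r) s = D.φ^[s] r := by
  cases s with
  | zero => exact D.wc_spec (by simp)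
  | succ s =>
    have ih := ghost_wc r s
    apply D.wc_spec
    rw [Function.iterate_succ_apply', ← ih, ghost, map_sum, ← Finset.sum_sub_distrib]
    apply Finset.dvd_sum
    intro j hj
    have hj' : j ≤ s := by simpa [Nat.lt_succ_iff] using hj
    have e : s + 1 - j = (s - j) + 1 := by omega
    simp only [Algebra.algebraMap_self, RingHom.id_apply, map_mul, map_pow, D.φ_π]
    rw [← mul_sub, e, pow_succ' D.Q, pow_mul, ← D.sub_pow_Q]
    have h1 : D.π ^ (s - j + 1) ∣ (D.φ (D.wc r j) - D.wc r j ^ D.Q) ^ D.Q ^ (s - j) :=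
      (pow_dvd_pow _ (D.lt_Q_pow (s - j))).trans (pow_dvd_pow_of_dvd (D.dvd_φ _) _)
    have h2 := mul_dvd_mul (dvd_refl (D.π ^ j)) h1
    rw [← pow_add] at h2
    have e3 : j + (s - j + 1) = s + 1 := by omega
    rwa [e3] at h2

/-- The ghost map is injective on sequences in a `π`-torsion-free algebra. -/
lemma ghost_injective {B : Type*} [CommRing B] [Algebra R B]
    (hB : ∀ b : B, algebraMap R B D.π * b = 0 → b = 0) {x y : ℕ → B}
    (h : ∀ s, D.ghost x s = D.ghost y s) : x = y := by
  have hB' : ∀ (s : ℕ) (b : B), algebraMap R B D.π ^ s * b = 0 → b = 0 := by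
    intro s
    induction s with
    | zero => intro b hb; simpa using hb
    | succ s ih => intro b hb; exact hB _ (ih _ (by rw [← hb]; ring))
  funext s
  induction s using Nat.strong_induction_on with
  | _ s ih =>
    have hs := h s
    rw [ghost, ghost, Finset.sum_range_succ, Finset.sum_range_succ,
      Finset.sum_congr rfl (g := fun j => algebraMap R B D.π ^ j * y j ^ D.Q ^ (s - j))
        (fun j hj => by rw [ih j (Finset.mem_range.1 hj)])] at hs
    have h2 := add_left_cancel hs
    simp only [Nat.sub_self, pow_zero, pow_one] at h2
    exact sub_eq_zero.1 (hB' s _ (by rw [mul_sub, h2, sub_self]))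

lemma φ_iterate_π_pow (s i : ℕ) : D.φ^[s] (D.π ^ i) = D.π ^ i := by
  induction s with
  | zero => rfl
  | succ s ih => rw [Function.iterate_succ_apply', ih, map_pow, D.φ_π]

section Mul
variable {B : Type*} [CommRing B] [Algebra R B]

/-- Multiplication of infinite Witt vectors, in components. -/
def mulSeq (x y : ℕ → B) (s : ℕ) : B :=
  ∑ j ∈ Finset.range (s + 1), ∑ l ∈ Finset.range (s + 1),
    algebraMap R B (D.wc (D.π ^ min j l) (s - max j l)) *
      (x j ^ D.Q ^ (s - j) * y l ^ D.Q ^ (s - l))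

/-- The Witt components of `1`. -/
def oneSeq (s : ℕ) : B := if s = 0 then 1 else 0

/-- The Frobenius of infinite Witt vectors, in components. -/
def frobSeq (x : ℕ → B) (s : ℕ) : B :=
  (if s = 0 then x 0 ^ D.Q else 0) +
    ∑ j ∈ Finset.range (s + 1), algebraMap R B (D.wc D.π (s - j)) * x (j + 1) ^ D.Q ^ (s - j)

lemma ghost_aux (r : R) (hr : ∀ s, D.φ^[s] r = r) (M s : ℕ) (h : M ≤ s) :
    ∑ k ∈ Finset.range (s + 1), (if M ≤ k then
      algebraMap R B D.π ^ k * algebraMap R B (D.wc r (k - M)) ^ D.Q ^ (s - k) else 0)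
      = algebraMap R B (D.π ^ M * r) := by
  have h1 := D.ghost_wc r (s - M)
  rw [hr, ghost] at h1
  conv_rhs => rw [← h1]
  rw [← Finset.sum_filter]
  have e : (Finset.range (s + 1)).filter (fun k => M ≤ k) =
      (Finset.range (s - M + 1)).image (fun k => k + M) := by
    ext k
    simp only [Finset.mem_filter, Finset.mem_range, Finset.mem_image]
    constructor
    · rintro ⟨h1, h2⟩; exact ⟨k - M, by omega, by omega⟩
    · rintro ⟨k', h1, rfl⟩; omega
  rw [e, Finset.sum_image (by intro a _ b _ hab; simpa using hab), map_mul, map_sum, map_pow,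
    Finset.mul_sum]
  apply Finset.sum_congr rfl
  intro k hk
  have e2 : s - (k + M) = s - M - k := by omega
  simp only [Algebra.algebraMap_self, RingHom.id_apply, map_mul, map_pow, Nat.add_sub_cancel, e2]
  ring

lemma ghost_mulSeq (x y : ℕ → B) (s : ℕ) :
    D.ghost (D.mulSeq x y) s = D.ghost x s * D.ghost y s := by
  have key : ∀ j ∈ Finset.range (s + 1), ∀ l ∈ Finset.range (s + 1),
      ∑ k ∈ Finset.range (s + 1), (if max j l ≤ k then algebraMap R B D.π ^ k *
        (algebraMap R B (D.wc (D.π ^ min j l) (k - max j l)) *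
          (x j ^ D.Q ^ (k - j) * y l ^ D.Q ^ (k - l))) ^ D.Q ^ (s - k) else 0)
      = (algebraMap R B D.π ^ j * x j ^ D.Q ^ (s - j)) *
        (algebraMap R B D.π ^ l * y l ^ D.Q ^ (s - l)) := by
    intro j hj l hl
    have hj' := Finset.mem_range.1 hj
    have hl' := Finset.mem_range.1 hl
    have h1 := D.ghost_aux (B := B) (D.π ^ min j l) (fun s => D.φ_iterate_π_pow s _)
      (max j l) s (by omega)
    have e : D.π ^ max j l * D.π ^ min j l = D.π ^ j * D.π ^ l := by
      rw [← pow_add, ← pow_add, max_add_min]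
    rw [e] at h1
    have h2 : (algebraMap R B D.π ^ j * x j ^ D.Q ^ (s - j)) *
        (algebraMap R B D.π ^ l * y l ^ D.Q ^ (s - l)) =
        algebraMap R B (D.π ^ j * D.π ^ l) * (x j ^ D.Q ^ (s - j) * y l ^ D.Q ^ (s - l)) := by
      simp only [map_mul, map_pow]; ring
    rw [h2, ← h1, Finset.sum_mul]
    apply Finset.sum_congr rfl
    intro k hk
    have hk' := Finset.mem_range.1 hk
    split_ifs with hm
    · have e1 : s - j = (k - j) + (s - k) := by omega
      have e2 : s - l = (k - l) + (s - k) := by omega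
      rw [e1, e2, pow_add D.Q, pow_add D.Q, pow_mul, pow_mul, mul_pow, mul_pow]
      ring
    · simp
  rw [ghost, ghost, ghost, Finset.sum_mul_sum,
    Finset.sum_congr rfl (fun j hj => Finset.sum_congr rfl (fun l hl => (key j hj l hl).symm))]
  have swap : ∀ f : ℕ → ℕ → ℕ → B,
      ∑ j ∈ Finset.range (s + 1), ∑ l ∈ Finset.range (s + 1), ∑ k ∈ Finset.range (s + 1), f j l k
      = ∑ k ∈ Finset.range (s + 1), ∑ j ∈ Finset.range (s + 1), ∑ l ∈ Finset.range (s + 1),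
        f j l k := by
    intro f
    exact (Finset.sum_congr rfl fun j _ => Finset.sum_comm).trans Finset.sum_comm
  rw [swap]
  apply Finset.sum_congr rfl
  intro k hk
  have hk' := Finset.mem_range.1 hk
  rw [mulSeq, D.sum_pow_Q, Finset.mul_sum]
  have sub : Finset.range (k + 1) ⊆ Finset.range (s + 1) := by
    intro i hi; simp only [Finset.mem_range] at *; omega
  rw [← Finset.sum_subset sub]
  · apply Finset.sum_congr rfl
    intro j hj
    have hj' := Finset.mem_range.1 hj
    rw [D.sum_pow_Q, Finset.mul_sum, ← Finset.sum_subset sub]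
    · apply Finset.sum_congr rfl
      intro l hl
      have hl' := Finset.mem_range.1 hl
      rw [if_pos (by omega)]
    · intro l _ hl
      rw [if_neg]
      simp only [Finset.mem_range] at hl; omega
  · intro j _ hj
    apply Finset.sum_eq_zero
    intro l _
    rw [if_neg]
    simp only [Finset.mem_range] at hj; omega

lemma ghost_oneSeq (s : ℕ) : D.ghost (oneSeq : ℕ → B) s = 1 := by
  rw [ghost, Finset.sum_range_succ', Finset.sum_eq_zero]
  · simp [oneSeq]
  · intro j _
    rw [oneSeq, if_neg (Nat.succ_ne_zero j), zero_pow (D.Q_pow_ne_zero _), mul_zero]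

lemma ghost_add (x y : ℕ → B) (s : ℕ) : D.ghost (x + y) s = D.ghost x s + D.ghost y s := by
  simp only [ghost, Pi.add_apply, D.add_pow_Q, mul_add, Finset.sum_add_distrib]

/-- `frobSeq` is the left shift on ghost components. -/
lemma ghost_frobSeq (x : ℕ → B) (s : ℕ) : D.ghost (D.frobSeq x) s = D.ghost x (s + 1) := by
  have key : ∀ j ∈ Finset.range (s + 1),
      ∑ k ∈ Finset.range (s + 1), (if j ≤ k then algebraMap R B D.π ^ k *
        (algebraMap R B (D.wc D.π (k - j)) * x (j + 1) ^ D.Q ^ (k - j)) ^ D.Q ^ (s - k) else 0)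
      = algebraMap R B D.π ^ (j + 1) * x (j + 1) ^ D.Q ^ (s - j) := by
    intro j hj
    have hj' := Finset.mem_range.1 hj
    have h1 := D.ghost_aux (B := B) D.π (fun s => by simpa using D.φ_iterate_π_pow s 1) j s
      (by omega)
    rw [pow_succ, ← map_pow, ← map_mul, ← h1, Finset.sum_mul]
    apply Finset.sum_congr rfl
    intro k hk
    have hk' := Finset.mem_range.1 hk
    split_ifs with hm
    · have e1 : s - j = (k - j) + (s - k) := by omega
      rw [e1, pow_add D.Q, pow_mul, mul_pow]
      ring
    · simp
  have h0 : D.ghost (fun s => if s = 0 then x 0 ^ D.Q else 0) s = x 0 ^ D.Q ^ (s + 1) := by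
    rw [ghost, Finset.sum_range_succ', Finset.sum_eq_zero]
    · simp [← pow_mul, pow_succ']
    · intro j _
      rw [if_neg (Nat.succ_ne_zero j), zero_pow (D.Q_pow_ne_zero _), mul_zero]
  have e : D.frobSeq x = (fun s => if s = 0 then x 0 ^ D.Q else 0) + fun s =>
    ∑ j ∈ Finset.range (s + 1), algebraMap R B (D.wc D.π (s - j)) * x (j + 1) ^ D.Q ^ (s - j) := rfl
  rw [e, ghost_add, h0, ghost, ghost, Finset.sum_range_succ' _ (s + 1)]
  simp only [pow_zero, one_mul, Nat.sub_zero, Nat.reduceSubDiff]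
  rw [add_comm, Finset.sum_congr rfl (fun j hj => (key j hj).symm), Finset.sum_comm]
  congr 1
  apply Finset.sum_congr rfl
  intro k hk
  have hk' := Finset.mem_range.1 hk
  rw [D.sum_pow_Q, Finset.mul_sum]
  have sub : Finset.range (k + 1) ⊆ Finset.range (s + 1) := by
    intro i hi; simp only [Finset.mem_range] at *; omega
  rw [← Finset.sum_subset sub]
  · apply Finset.sum_congr rfl
    intro j hj
    have hj' := Finset.mem_range.1 hj
    rw [if_pos (by omega)]
  · intro j _ hj
    rw [if_neg]
    simp only [Finset.mem_range] at hj; omega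


lemma mulSeq_map {B' : Type*} [CommRing B'] [Algebra R B'] (g : B →ₐ[R] B') (x y : ℕ → B) :
    D.mulSeq (fun j => g (x j)) (fun j => g (y j)) = fun s => g (D.mulSeq x y s) := by
  funext s
  simp only [mulSeq, map_sum, map_mul, map_pow, AlgHom.commutes]

lemma mulSeq_congr {x x' y y' : ℕ → B} (s : ℕ) (hx : ∀ j ≤ s, x j = x' j)
    (hy : ∀ j ≤ s, y j = y' j) : D.mulSeq x y s = D.mulSeq x' y' s := by
  unfold mulSeq
  refine Finset.sum_congr rfl fun j hj => Finset.sum_congr rfl fun l hl => ?_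
  rw [hx j (Nat.lt_succ_iff.1 (Finset.mem_range.1 hj)),
    hy l (Nat.lt_succ_iff.1 (Finset.mem_range.1 hl))]

lemma torsionFree_self (b : R) (h : algebraMap R R D.π * b = 0) : b = 0 :=
  (mul_eq_zero.1 h).resolve_left D.π_ne_zero

lemma torsionFree_mvPolynomial {σ : Type*} (b : MvPolynomial σ R)
    (h : algebraMap R (MvPolynomial σ R) D.π * b = 0) : b = 0 :=
  (mul_eq_zero.1 h).resolve_left
    ((map_ne_zero_iff _ (FaithfulSMul.algebraMap_injective R (MvPolynomial σ R))).2 D.π_ne_zero)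

lemma exists_lift (x : ℕ → B) :
    ∃ X : ℕ → MvPolynomial B R, x = fun j => MvPolynomial.aeval (R := R) (id : B → B) (X j) :=
  ⟨fun j => MvPolynomial.X (x j), by funext j; simp⟩

lemma mulSeq_comm (x y : ℕ → B) : D.mulSeq x y = D.mulSeq y x := by
  obtain ⟨X, rfl⟩ := exists_lift (R := R) x
  obtain ⟨Y, rfl⟩ := exists_lift (R := R) y
  simp only [mulSeq_map]
  rw [D.ghost_injective D.torsionFree_mvPolynomial (x := D.mulSeq X Y) (y := D.mulSeq Y X)]
  intro s
  simp only [ghost_mulSeq, mul_comm]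

lemma mulSeq_assoc (x y z : ℕ → B) :
    D.mulSeq (D.mulSeq x y) z = D.mulSeq x (D.mulSeq y z) := by
  obtain ⟨X, rfl⟩ := exists_lift (R := R) x
  obtain ⟨Y, rfl⟩ := exists_lift (R := R) y
  obtain ⟨Z, rfl⟩ := exists_lift (R := R) z
  simp only [mulSeq_map]
  rw [D.ghost_injective D.torsionFree_mvPolynomial (x := D.mulSeq (D.mulSeq X Y) Z)
    (y := D.mulSeq X (D.mulSeq Y Z))]
  intro s
  simp only [ghost_mulSeq, mul_assoc]

lemma mulSeq_add (x y z : ℕ → B) : D.mulSeq x (y + z) = D.mulSeq x y + D.mulSeq x z := by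
  funext s
  simp only [mulSeq, Pi.add_apply, D.add_pow_Q, mul_add, Finset.sum_add_distrib]

lemma oneSeq_mulSeq (x : ℕ → B) : D.mulSeq oneSeq x = x := by
  obtain ⟨X, rfl⟩ := exists_lift (R := R) x
  have h : (oneSeq : ℕ → B) = fun j => MvPolynomial.aeval (R := R) (id : B → B) (oneSeq j) := by
    funext j; unfold oneSeq; split_ifs <;> simp
  rw [h]
  simp only [mulSeq_map]
  rw [D.ghost_injective D.torsionFree_mvPolynomial (x := D.mulSeq oneSeq X) (y := X)]
  intro s
  rw [ghost_mulSeq, ghost_oneSeq, one_mul]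

/-- The Witt components, in an `R`-algebra `B`, of the image of `r` under `R → W(R) → W(B)`. -/
def wcB (B : Type*) [CommRing B] [Algebra R B] (r : R) (s : ℕ) : B := algebraMap R B (D.wc r s)

lemma wc_add (r r' : R) : D.wc (r + r') = D.wc r + D.wc r' :=
  D.ghost_injective D.torsionFree_self fun s => by
    rw [ghost_add, ghost_wc, ghost_wc, ghost_wc, iterate_map_add]

lemma wc_mul (r r' : R) : D.wc (r * r') = D.mulSeq (D.wc r) (D.wc r') :=
  D.ghost_injective D.torsionFree_self fun s => by
    rw [ghost_mulSeq, ghost_wc, ghost_wc, ghost_wc, iterate_map_mul]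

lemma wc_one : D.wc 1 = oneSeq :=
  D.ghost_injective D.torsionFree_self fun s => by
    rw [ghost_oneSeq, ghost_wc, iterate_map_one]

lemma wcB_add (r r' : R) : D.wcB B (r + r') = D.wcB B r + D.wcB B r' := by
  funext s; simp [wcB, wc_add]

lemma wcB_mul (r r' : R) : D.wcB B (r * r') = D.mulSeq (D.wcB B r) (D.wcB B r') := by
  have h := D.mulSeq_map (Algebra.ofId R B) (D.wc r) (D.wc r')
  rw [← wc_mul] at h
  exact h.symm

lemma wcB_one : D.wcB B 1 = oneSeq := by
  funext s; rw [wcB, wc_one, oneSeq, oneSeq]; split_ifs <;> simp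

lemma wcB_zero : D.wcB B 0 = 0 := by
  have h := D.wcB_add (B := B) 0 0
  rw [add_zero] at h
  exact left_eq_add.1 h

lemma wc_apply_zero (r : R) : D.wc r 0 = r := by
  simpa [ghost] using D.ghost_wc r 0

/-- On scalars from `Fq` the `R`-module structure of `W(B)` is the componentwise one. -/
lemma wcB_scalar_mulSeq (c : Fq) (x : ℕ → B) :
    D.mulSeq (D.wcB B (algebraMap A R (algebraMap Fq A c))) x =
      fun s => algebraMap A R (algebraMap Fq A c) • x s := by
  obtain ⟨X, rfl⟩ := exists_lift (R := R) x
  have hc := D.scalar_pow c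
  set r := algebraMap A R (algebraMap Fq A c) with hr
  have hφ : ∀ s, D.φ^[s] r = r := by
    intro s
    induction s with
    | zero => rfl
    | succ s ih => rw [Function.iterate_succ_apply', ih, hr, AlgHom.commutes]
  have hcQ : ∀ k, r ^ D.Q ^ k = r := by
    intro k
    induction k with
    | zero => simp
    | succ k ih => rw [pow_succ, pow_mul, ih, hc]
  have hw : D.wc r = fun s => if s = 0 then r else 0 := by
    apply D.ghost_injective D.torsionFree_self
    intro s
    rw [ghost_wc, hφ, ghost, Finset.sum_range_succ', Finset.sum_eq_zero]
    · simp [hcQ]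
    · intro j _
      rw [if_neg (Nat.succ_ne_zero j), zero_pow (D.Q_pow_ne_zero _), mul_zero]
  have h : D.wcB B r = fun j => MvPolynomial.aeval (R := R) (id : B → B)
      (D.wcB (MvPolynomial B R) r j) := by
    funext j; rw [wcB, wcB, AlgHom.commutes]
  rw [h]
  simp only [mulSeq_map, ← map_smul]
  rw [D.ghost_injective D.torsionFree_mvPolynomial (x := D.mulSeq _ X) (y := fun s => r • X s)]
  intro s
  have h1 : D.ghost (D.wcB (MvPolynomial B R) r) s = algebraMap R _ r := by
    refine Eq.trans ?_ (congrArg (algebraMap R (MvPolynomial B R))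
      ((D.ghost_wc r s).trans (hφ s)))
    simp [wcB, ghost]
  rw [ghost_mulSeq, h1, ghost, ghost, Finset.mul_sum]
  refine Finset.sum_congr rfl fun j _ => ?_
  rw [Algebra.smul_def, mul_pow, ← map_pow _ r, hcQ]
  ring

lemma dvd_wc_π_pow (M s : ℕ) : D.π ^ (M - s) ∣ D.wc (D.π ^ M) s := by
  induction s using Nat.strong_induction_on with
  | _ s ih =>
    rcases le_or_gt M s with h | h
    · rw [Nat.sub_eq_zero_of_le h, pow_zero]; exact one_dvd _
    have h1 := D.ghost_wc (D.π ^ M) s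
    rw [φ_iterate_π_pow, ghost, Finset.sum_range_succ] at h1
    simp only [Algebra.algebraMap_self, RingHom.id_apply, Nat.sub_self, pow_zero, pow_one] at h1
    have h2 : D.π ^ M ∣ D.π ^ s * D.wc (D.π ^ M) s := by
      rw [← eq_sub_iff_add_eq'] at h1
      rw [h1]
      refine dvd_sub dvd_rfl (Finset.dvd_sum fun j hj => ?_)
      have hj' := Finset.mem_range.1 hj
      have h3 : D.π ^ (M - j) ∣ D.wc (D.π ^ M) j ^ D.Q ^ (s - j) :=
        (ih j hj').trans (dvd_pow_self _ (D.Q_pow_ne_zero _))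
      have h4 := mul_dvd_mul (dvd_refl (D.π ^ j)) h3
      rwa [← pow_add, Nat.add_sub_cancel' (by omega)] at h4
    have h5 : D.π ^ M = D.π ^ s * D.π ^ (M - s) := by
      rw [← pow_add, Nat.add_sub_cancel' h.le]
    exact (mul_dvd_mul_iff_left (pow_ne_zero s D.π_ne_zero)).1 (h5.symm.dvd.trans h2)
end Mul

/-! ### Truncated Witt vectors -/

/-- Padding of a finite sequence by zeros. -/
def ext {B : Type*} [Zero B] {n : ℕ} (x : Fin n → B) (j : ℕ) : B :=
  if h : j < n then x ⟨j, h⟩ else 0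

lemma ext_apply {B : Type*} [Zero B] {n : ℕ} (x : Fin n → B) (s : Fin n) : ext x s = x s := by
  unfold ext; rw [dif_pos s.2]

lemma ext_add {B : Type*} [AddZeroClass B] {n : ℕ} (x y : Fin n → B) :
    ext (x + y) = ext x + ext y := by
  funext j; unfold ext; simp only [Pi.add_apply]; split_ifs <;> simp

/-- The set `W_n(B) = B^(n+1)` of Witt vectors `(x_0, …, x_n)`. -/
def Witt (_ : FrobBase Fq A R) (n : ℕ) (B : Type u) : Type u := Fin (n + 1) → B

section WittRing
variable {B : Type u} [CommRing B] [Algebra R B] {n : ℕ}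

instance : AddCommGroup (D.Witt n B) := inferInstanceAs (AddCommGroup (Fin (n + 1) → B))

/-- Truncation of a sequence to a Witt vector of finite length. -/
def truncSeq (n : ℕ) (x : ℕ → B) : D.Witt n B := fun s => x s

instance : Mul (D.Witt n B) := ⟨fun x y => D.truncSeq n (D.mulSeq (ext x) (ext y))⟩

lemma truncSeq_mulSeq (x y : ℕ → B) :
    D.truncSeq n (D.mulSeq x y) = D.truncSeq n x * D.truncSeq n y := by
  funext s
  have hs := s.2
  refine D.mulSeq_congr _ (fun j hj => ?_) (fun j hj => ?_) <;>
  · unfold ext; rw [dif_pos (by omega)]; rfl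

lemma truncSeq_ext (x : D.Witt n B) : D.truncSeq n (ext x) = x := by
  funext s
  exact ext_apply x s

lemma truncSeq_add (x y : ℕ → B) :
    D.truncSeq n (x + y) = D.truncSeq n x + D.truncSeq n y := rfl

instance : CommRing (D.Witt n B) :=
  { (inferInstance : AddCommGroup (D.Witt n B)), (inferInstance : Mul (D.Witt n B)) with
    one := D.truncSeq n oneSeq
    mul_comm := fun x y => by
      rw [← D.truncSeq_ext x, ← D.truncSeq_ext y, ← truncSeq_mulSeq, ← truncSeq_mulSeq,
        mulSeq_comm]
    mul_assoc := fun x y z => by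
      rw [← D.truncSeq_ext x, ← D.truncSeq_ext y, ← D.truncSeq_ext z]
      simp only [← truncSeq_mulSeq, mulSeq_assoc]
    one_mul := fun x => by
      rw [← D.truncSeq_ext x]
      exact (D.truncSeq_mulSeq _ _).symm.trans (by rw [oneSeq_mulSeq])
    mul_one := fun x => by
      rw [← D.truncSeq_ext x]
      exact (D.truncSeq_mulSeq _ _).symm.trans (by rw [mulSeq_comm, oneSeq_mulSeq])
    left_distrib := fun x y z => by
      rw [← D.truncSeq_ext x, ← D.truncSeq_ext y, ← D.truncSeq_ext z, ← truncSeq_add]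
      rw [← truncSeq_mulSeq, mulSeq_add, truncSeq_add, truncSeq_mulSeq, truncSeq_mulSeq]
    right_distrib := fun x y z => by
      rw [← D.truncSeq_ext x, ← D.truncSeq_ext y, ← D.truncSeq_ext z, ← truncSeq_add]
      rw [← truncSeq_mulSeq, mulSeq_comm, mulSeq_add, truncSeq_add, mulSeq_comm,
        D.mulSeq_comm (ext z), truncSeq_mulSeq, truncSeq_mulSeq]
    zero_mul := fun x => by
      funext s
      change D.mulSeq (ext 0) (ext x) s = 0
      have h0 : (ext (0 : Fin (n + 1) → B)) = 0 := by funext j; unfold ext; split_ifs <;> rfl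
      rw [h0]
      simp [mulSeq, zero_pow (D.Q_pow_ne_zero _)]
    mul_zero := fun x => by
      funext s
      change D.mulSeq (ext x) (ext 0) s = 0
      have h0 : (ext (0 : Fin (n + 1) → B)) = 0 := by funext j; unfold ext; split_ifs <;> rfl
      rw [h0]
      simp [mulSeq, zero_pow (D.Q_pow_ne_zero _)] }

/-- The structure map `R → W(R) → W_n(B)`. -/
def wittStructure (n : ℕ) (B : Type u) [CommRing B] [Algebra R B] : R →+* D.Witt n B where
  toFun r := D.truncSeq n (D.wcB B r)
  map_one' := by rw [wcB_one]; rfl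
  map_mul' r r' := by rw [wcB_mul, truncSeq_mulSeq]
  map_zero' := by rw [wcB_zero]; rfl
  map_add' r r' := by rw [wcB_add, truncSeq_add]

instance : Algebra R (D.Witt n B) := (D.wittStructure n B).toAlgebra

lemma witt_algebraMap (r : R) : algebraMap R (D.Witt n B) r = D.truncSeq n (D.wcB B r) := rfl

/-- Functoriality of `W_n`. -/
def wittMap (n : ℕ) {B' : Type u} [CommRing B'] [Algebra R B'] (g : B →ₐ[R] B') :
    D.Witt n B →ₐ[R] D.Witt n B' where
  toFun x := fun s => g (x s)
  map_one' := by
    funext s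
    change g (oneSeq _) = oneSeq _
    unfold oneSeq; split_ifs <;> simp
  map_mul' x y := by
    have h : ∀ z : D.Witt n B, ext (fun s => g (z s)) = fun j => g (ext z j) := by
      intro z; funext j; unfold ext; split_ifs <;> simp
    funext s
    change _ = D.mulSeq (ext fun s => g (x s)) (ext fun s => g (y s)) s
    rw [h, h, mulSeq_map]
    rfl
  map_zero' := by funext s; exact map_zero g
  map_add' x y := by funext s; exact map_add g _ _
  commutes' r := by funext s; exact g.commutes _

/-- The truncation `W_{n'}(B) → W_n(B)` for `n ≤ n'`. -/
def wittTrunc {n n' : ℕ} (h : n ≤ n') : D.Witt n' B →ₐ[R] D.Witt n B where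
  toFun x := fun s => x (Fin.castLE (Nat.succ_le_succ h) s)
  map_one' := rfl
  map_mul' x y := by
    funext s
    have hs := s.2
    change D.mulSeq (ext x) (ext y) (s : ℕ) = D.mulSeq (ext _) (ext _) (s : ℕ)
    refine D.mulSeq_congr _ (fun j hj => ?_) (fun j hj => ?_) <;>
    · unfold ext; rw [dif_pos (by omega), dif_pos (by omega)]; rfl
  map_zero' := rfl
  map_add' x y := rfl
  commutes' r := rfl

/-- The projection `W_n(B) → B`, `(x_0, …, x_n) ↦ x_0`. -/
def wittHead (n : ℕ) : D.Witt n B →ₐ[R] B where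
  toFun x := x 0
  map_one' := rfl
  map_mul' x y := by
    change D.mulSeq (ext x) (ext y) 0 = _
    simp [mulSeq, wc_one, oneSeq, ext]
  map_zero' := rfl
  map_add' x y := rfl
  commutes' r := by
    change D.wcB B r 0 = _
    rw [wcB, wc_apply_zero]

lemma witt_scalar_smul (c : Fq) (x : D.Witt n B) :
    algebraMap A R (algebraMap Fq A c) • x =
      (fun s => algebraMap A R (algebraMap Fq A c) • x s : Fin (n + 1) → B) := by
  rw [Algebra.smul_def, witt_algebraMap]
  conv_lhs => rw [← D.truncSeq_ext x, ← truncSeq_mulSeq, wcB_scalar_mulSeq]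
  funext s
  exact congrArg _ (ext_apply x s)

lemma witt_nilp (h : ∃ N, algebraMap R B D.π ^ N = 0) :
    ∃ N, algebraMap R (D.Witt n B) D.π ^ N = 0 := by
  obtain ⟨N, hN⟩ := h
  refine ⟨N + n, ?_⟩
  rw [← map_pow, witt_algebraMap]
  funext s
  change algebraMap R B (D.wc (D.π ^ (N + n)) s) = 0
  have hs := s.2
  have h1 : D.π ^ N ∣ D.wc (D.π ^ (N + n)) s :=
    (pow_dvd_pow _ (by omega)).trans (D.dvd_wc_π_pow (N + n) s)
  obtain ⟨y, hy⟩ := h1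
  rw [hy, map_mul, map_pow, hN, zero_mul]

end WittRing

/-! ### Test algebras, twists and Witt vectors of test algebras -/

/-- An `R`-algebra on which `π` is nilpotent.  A formal scheme over `Spf R`, that is, a compatible
family of schemes over `R / π ^ N`, is identified with its functor of points on such algebras. -/
structure NilpAlg where
  carrier : Type u
  [commRing : CommRing carrier]
  [algebra : Algebra R carrier]
  nilp : ∃ N : ℕ, algebraMap R carrier D.π ^ N = 0

instance : CoeSort D.NilpAlg (Type u) := ⟨NilpAlg.carrier⟩
instance (B : D.NilpAlg) : CommRing B := B.commRing
instance (B : D.NilpAlg) : Algebra R B := B.algebra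

/-- The `R`-algebra `W_n(B)`. -/
def W (n : ℕ) (B : D.NilpAlg) : D.NilpAlg where
  carrier := D.Witt n B
  nilp := D.witt_nilp B.nilp

/-- `B^φ`: the ring `B` with structure map `R → R → B`, the first map being `φ`. -/
def twist (B : D.NilpAlg) : D.NilpAlg where
  carrier := B
  algebra := ((algebraMap R B).comp (D.φ : R →+* R)).toAlgebra
  nilp := by
    obtain ⟨N, hN⟩ := B.nilp
    refine ⟨N, ?_⟩
    change algebraMap R B (D.φ D.π) ^ N = 0
    rw [φ_π, hN]

lemma twist_smul (r : R) (B : D.NilpAlg) (y : B) :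
    (HSMul.hSMul (β := D.twist B) r y : D.twist B) = (D.φ r • y : B) :=
  (@Algebra.smul_def R (D.twist B) _ _ _ r y).trans (@Algebra.smul_def R B _ _ _ (D.φ r) y).symm

/-- The image of a scalar of `Fq` in `R`. -/
def scalar (_ : FrobBase Fq A R) (c : Fq) : R := algebraMap A R (algebraMap Fq A c)

/-- The Frobenius `F : W_k(B) → W_{k-1}(B^φ)` in Witt components (for `k = 0` the target is
trivial); it is the left shift on ghost components (`ghost_frobSeq`). -/
def frob {B : Type*} [CommRing B] [Algebra R B] {k : ℕ} (x : Fin (k + 1) → B) : Fin k → B :=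
  fun s => D.frobSeq (ext x) s

lemma frob_add {B : Type*} [CommRing B] [Algebra R B] {k : ℕ} (x y : Fin (k + 1) → B) :
    D.frob (x + y) = D.frob x + D.frob y := by
  funext s
  have h0 : D.Q = D.Q ^ 1 := (pow_one _).symm
  simp only [frob, frobSeq, ext_add, Pi.add_apply, D.add_pow_Q, mul_add, Finset.sum_add_distrib]
  rw [h0, D.add_pow_Q]
  split_ifs <;> ring

lemma ext_smul {B : Type*} [CommRing B] [Algebra R B] {k : ℕ} (r : R) (x : Fin k → B) (j : ℕ) :
    ext (r • x) j = r • ext x j := by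
  unfold ext; split_ifs <;> simp

lemma scalar_pow_pow (c : Fq) (k : ℕ) : D.scalar c ^ D.Q ^ k = D.scalar c := by
  induction k with
  | zero => simp
  | succ k ih => rw [pow_succ, pow_mul, ih]; exact D.scalar_pow c

lemma φ_scalar (c : Fq) : D.φ (D.scalar c) = D.scalar c := D.φ.commutes _

lemma frob_scalar_smul {B : Type*} [CommRing B] [Algebra R B] {k : ℕ} (c : Fq)
    (x : Fin (k + 1) → B) : D.frob (D.scalar c • x) = D.scalar c • D.frob x := by
  funext s
  have h0 : D.scalar c ^ D.Q = D.scalar c := D.scalar_pow c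
  simp only [frob, frobSeq, ext_smul, smul_pow, D.scalar_pow_pow, h0, Pi.smul_apply, smul_add,
    Finset.smul_sum, mul_smul_comm]
  congr 1
  split_ifs <;> simp

lemma frob_map {B B' : Type*} [CommRing B] [Algebra R B] [CommRing B'] [Algebra R B'] {k : ℕ}
    (g : B →ₐ[R] B') (x : Fin (k + 1) → B) :
    D.frob (fun s => g (x s)) = fun s => g (D.frob x s) := by
  have h : ∀ j, ext (fun s => g (x s)) j = g (ext x j) := by
    intro j; unfold ext; split_ifs <;> simp
  funext s
  simp only [frob, frobSeq, h, map_add, map_sum, map_mul, map_pow, AlgHom.commutes, apply_ite g,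
    map_zero]

end Witt

/-! ### Admissible `A`-module schemes and their characters -/

section Modules

variable {Fq A : Type v} {R : Type u} [Field Fq] [CommRing A] [Algebra Fq A]
  [CommRing R] [IsDomain R] [IsDiscreteValuationRing R] [Algebra A R] (D : FrobBase Fq A R)

/-- Families of maps `B^k → B`, indexed by the test algebras. -/
abbrev Fun (k : ℕ) : Type (u + 1) := (B : D.NilpAlg) → (Fin k → B) → B

/-- The `R`-module of morphisms of `Fq`-module formal schemes `Ĝa^k → Ĝa` over `Spf R`: natural
families of `Fq`-linear maps `B^k → B`. -/
def LinFun (k : ℕ) : Submodule R (D.Fun k) where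
  carrier := {Ψ | (∀ (B : D.NilpAlg) (x y : Fin k → B), Ψ B (x + y) = Ψ B x + Ψ B y) ∧
    (∀ (c : Fq) (B : D.NilpAlg) (x : Fin k → B),
      Ψ B (D.scalar c • x) = D.scalar c • Ψ B x) ∧
    ∀ (B B' : D.NilpAlg) (g : B →ₐ[R] B') (x : Fin k → B),
      Ψ B' (fun s => g (x s)) = g (Ψ B x)}
  add_mem' := by
    rintro f g ⟨h1, h2, h3⟩ ⟨k1, k2, k3⟩
    refine ⟨fun B x y => ?_, fun c B x => ?_, fun B B' g x => ?_⟩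
    · simp only [Pi.add_apply, h1, k1]; abel
    · simp only [Pi.add_apply, h2, k2, smul_add]
    · simp only [Pi.add_apply, h3, k3, map_add]
  zero_mem' := by
    refine ⟨fun B _ _ => ?_, fun c B _ => ?_, fun B B' g _ => ?_⟩ <;> simp
  smul_mem' := by
    rintro r f ⟨h1, h2, h3⟩
    refine ⟨fun B x y => ?_, fun c B x => ?_, fun B B' g x => ?_⟩
    · simp only [Pi.smul_apply, h1, smul_add]
    · simp only [Pi.smul_apply, h2, smul_comm r]
    · simp only [Pi.smul_apply, h3, map_smul]

/-- `d` is the derivative at the origin of `f : Ĝa → Ĝa`: on `Spec` of a ring with an element `b`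
of square zero, `f(b) = d b`. -/
def IsTangent (f : D.Fun 1) (d : R) : Prop :=
  ∀ (B : D.NilpAlg) (b : B), b * b = 0 → f B (fun _ => b) = d • b

/-- An admissible `A`-module scheme over `Spf R` with a coordinate: an action of `A` on the
`Fq`-module formal scheme `Ĝa` by endomorphisms (a natural `A`-module structure on each test
algebra `B`, extending the `Fq`-module structure) such that the induced action on the tangent space
is through `A → R`. -/
structure AdmissibleModule where
  act : A → (B : D.NilpAlg) → B → B
  act_natural : ∀ (a : A) (B B' : D.NilpAlg) (g : B →ₐ[R] B') (x : B),
    act a B' (g x) = g (act a B x)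
  act_add : ∀ (a : A) (B : D.NilpAlg) (x y : B), act a B (x + y) = act a B x + act a B y
  add_act : ∀ (a b : A) (B : D.NilpAlg) (x : B), act (a + b) B x = act a B x + act b B x
  mul_act : ∀ (a b : A) (B : D.NilpAlg) (x : B), act (a * b) B x = act a B (act b B x)
  scalar_act : ∀ (c : Fq) (B : D.NilpAlg) (x : B),
    act (algebraMap Fq A c) B x = D.scalar c • x
  strict : ∀ (a : A) (B : D.NilpAlg) (b : B), b * b = 0 → act a B b = algebraMap A R a • b

variable {D}

/-- Pullback along the projection onto the first coordinates (`J^{n'}E → J^nE`, `N^{n'} → N^n`). -/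
def uPull {k k' : ℕ} (h : k ≤ k') : D.Fun k →ₗ[R] D.Fun k' where
  toFun Ψ := fun B x => Ψ B (fun s => x (Fin.castLE h s))
  map_add' _ _ := rfl
  map_smul' _ _ := rfl

/-- Pullback along `i : N^n → J^nE`, `(x_1, …, x_n) ↦ (0, x_1, …, x_n)`. -/
def iPull {n : ℕ} : D.Fun (n + 1) →ₗ[R] D.Fun n where
  toFun Θ := fun B y => Θ B (Fin.cons 0 y)
  map_add' _ _ := rfl
  map_smul' _ _ := rfl

/-- Pullback along the Teichmüller section `v : E → J^nE`, `x ↦ (x, 0, …, 0)`. -/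
def vPull {n : ℕ} : D.Fun (n + 1) →ₗ[R] D.Fun 1 where
  toFun Θ := fun B x => Θ B (Fin.cons (x 0) 0)
  map_add' _ _ := rfl
  map_smul' _ _ := rfl

/-- Pullback along the Frobenius: on `B`-points, `(F^*Ψ)_B = Ψ_{B^φ} ∘ F`.  For functions on `J^nE`
this is `φ^*`; for functions on `N^n`, with coordinates `(x_1, …, x_n)` regarded as a Witt vector,
it is the pullback `𝔣^*` along the lateral Frobenius. -/
def frobPull {k : ℕ} : D.Fun k →ₛₗ[(D.φ : R →+* R)] D.Fun (k + 1) where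
  toFun Ψ := fun B x => Ψ (D.twist B) (D.frob (B := B.carrier) x)
  map_add' _ _ := rfl
  map_smul' r Ψ := by
    funext B x
    exact D.twist_smul r B (Ψ (D.twist B) (D.frob (B := B.carrier) x))

namespace AdmissibleModule

variable (E : D.AdmissibleModule)

lemma act_zero (a : A) (B : D.NilpAlg) : E.act a B 0 = 0 := by
  have h := E.act_add a B 0 0
  rw [add_zero] at h
  exact left_eq_add.1 h

/-- `S` finite free of rank `N` over `R` represents the kernel of the endomorphism `a` of `E`. -/
def KernelFiniteOfDegree (a : A) (N : ℕ) : Prop :=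
  ∃ (S : Type u) (_ : CommRing S) (_ : Algebra R S)
    (e : (B : D.NilpAlg) → (S →ₐ[R] B) ≃ {x : B // E.act a B x = 0}),
    Module.Finite R S ∧ Module.Free R S ∧ Module.finrank R S = N ∧
    ∀ (B B' : D.NilpAlg) (g : B →ₐ[R] B') (h : S →ₐ[R] B),
      (e B' (g.comp h) : B') = g (e B h : B)

/-- `E` is a Drinfeld module of rank `r`: for each non-zero `a` the kernel of `a` on `E` is finite
of degree `q ^ (-r ord_∞(a))`. -/
def IsDrinfeld (C : PuncturedCurve Fq A) (r : ℕ) : Prop :=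
  ∀ a : A, a ≠ 0 → ∃ d : ℕ, C.HasPoleOrder a d ∧
    E.KernelFiniteOfDegree a ((Nat.card Fq ^ d) ^ r)

/-- The action of `A` on `J^nE(B) = E(W_n(B)) = W_n(B)`, in Witt coordinates. -/
def actJ (n : ℕ) (a : A) (B : D.NilpAlg) (x : Fin (n + 1) → B) : Fin (n + 1) → B :=
  E.act a (D.W n B) x

/-- The action of `A` on `N^n(B) = ker(J^nE(B) → E(B))`, in the coordinates `(x_1, …, x_n)`. -/
def actN (n : ℕ) (a : A) (B : D.NilpAlg) (y : Fin n → B) : Fin n → B :=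
  Fin.tail (E.actJ n a B (Fin.cons 0 y))

lemma actJ_head (n : ℕ) (a : A) (B : D.NilpAlg) (x : Fin (n + 1) → B) :
    E.actJ n a B x 0 = E.act a B (x 0) :=
  (E.act_natural a (D.W n B) B (D.wittHead n) x).symm

lemma actJ_trunc {n n' : ℕ} (h : n ≤ n') (a : A) (B : D.NilpAlg) (x : Fin (n' + 1) → B) :
    E.actJ n a B (fun s => x (Fin.castLE (Nat.succ_le_succ h) s)) =
      fun s => E.actJ n' a B x (Fin.castLE (Nat.succ_le_succ h) s) :=
  E.act_natural a (D.W n' B) (D.W n B) (D.wittTrunc h) x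

lemma actJ_map (n : ℕ) (a : A) (B B' : D.NilpAlg) (g : B →ₐ[R] B') (x : Fin (n + 1) → B) :
    E.actJ n a B' (fun s => g (x s)) = fun s => g (E.actJ n a B x s) :=
  E.act_natural a (D.W n B) (D.W n B') (D.wittMap n g) x

lemma actJ_add (n : ℕ) (a : A) (B : D.NilpAlg) (x y : Fin (n + 1) → B) :
    E.actJ n a B (x + y) = E.actJ n a B x + E.actJ n a B y :=
  E.act_add a (D.W n B) x y

lemma add_actJ (n : ℕ) (a b : A) (B : D.NilpAlg) (x : Fin (n + 1) → B) :
    E.actJ n (a + b) B x = E.actJ n a B x + E.actJ n b B x :=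
  E.add_act a b (D.W n B) x

lemma mul_actJ (n : ℕ) (a b : A) (B : D.NilpAlg) (x : Fin (n + 1) → B) :
    E.actJ n (a * b) B x = E.actJ n a B (E.actJ n b B x) :=
  E.mul_act a b (D.W n B) x

lemma scalar_actJ (n : ℕ) (c : Fq) (B : D.NilpAlg) (x : Fin (n + 1) → B) :
    E.actJ n (algebraMap Fq A c) B x = D.scalar c • x :=
  (E.scalar_act c (D.W n B) x).trans (D.witt_scalar_smul c x)

lemma actJ_scalar (n : ℕ) (a : A) (c : Fq) (B : D.NilpAlg) (x : Fin (n + 1) → B) :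
    E.actJ n a B (D.scalar c • x) = D.scalar c • E.actJ n a B x := by
  rw [← scalar_actJ, ← mul_actJ, mul_comm, mul_actJ, scalar_actJ]

lemma cons_actN (n : ℕ) (a : A) (B : D.NilpAlg) (y : Fin n → B) :
    (Fin.cons 0 (E.actN n a B y) : Fin (n + 1) → B) = E.actJ n a B (Fin.cons 0 y) := by
  have h := E.actJ_head n a B (Fin.cons 0 y)
  rw [Fin.cons_zero, act_zero] at h
  conv_rhs => rw [← Fin.cons_self_tail (E.actJ n a B (Fin.cons 0 y)), h]
  rfl

/-- The `R`-module `X_n(E)` of differential characters of order `n`: homomorphisms of `A`-module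
formal schemes `J^nE → Ĝa`. -/
def X (n : ℕ) : Submodule R (D.Fun (n + 1)) where
  carrier := {Θ | Θ ∈ D.LinFun (n + 1) ∧ ∀ (a : A) (B : D.NilpAlg) (x : Fin (n + 1) → B),
    Θ B (E.actJ n a B x) = algebraMap A R a • Θ B x}
  add_mem' := by
    rintro f g ⟨h1, h2⟩ ⟨k1, k2⟩
    exact ⟨add_mem h1 k1, fun a B x => by simp only [Pi.add_apply, h2, k2, smul_add]⟩
  zero_mem' := ⟨zero_mem _, fun a B x => by simp⟩
  smul_mem' := by
    rintro r f ⟨h1, h2⟩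
    exact ⟨Submodule.smul_mem _ r h1, fun a B x => by
      simp only [Pi.smul_apply, h2, smul_comm r]⟩

/-- The `R`-module `Hom_A(N^n, Ĝa)`. -/
def HomN (n : ℕ) : Submodule R (D.Fun n) where
  carrier := {Ψ | Ψ ∈ D.LinFun n ∧ ∀ (a : A) (B : D.NilpAlg) (y : Fin n → B),
    Ψ B (E.actN n a B y) = algebraMap A R a • Ψ B y}
  add_mem' := by
    rintro f g ⟨h1, h2⟩ ⟨k1, k2⟩
    exact ⟨add_mem h1 k1, fun a B x => by simp only [Pi.add_apply, h2, k2, smul_add]⟩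
  zero_mem' := ⟨zero_mem _, fun a B x => by simp⟩
  smul_mem' := by
    rintro r f ⟨h1, h2⟩
    exact ⟨Submodule.smul_mem _ r h1, fun a B x => by
      simp only [Pi.smul_apply, h2, smul_comm r]⟩

/-- `E` splits at order `m`. -/
def IsSplittingOrder (m : ℕ) : Prop := E.X m ≠ ⊥ ∧ ∀ i < m, E.X i = ⊥

lemma cons_add {B : Type*} [AddCommGroup B] {n : ℕ} (a b : B) (x y : Fin n → B) :
    (Fin.cons (a + b) (x + y) : Fin (n + 1) → B) = Fin.cons a x + Fin.cons b y := by
  funext s; refine Fin.cases ?_ (fun s => ?_) s <;> simp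

lemma cons_smul {B : Type*} [AddCommGroup B] [Module R B] {n : ℕ} (r : R) (a : B) (x : Fin n → B) :
    (Fin.cons (r • a) (r • x) : Fin (n + 1) → B) = r • (Fin.cons a x : Fin (n + 1) → B) := by
  funext s; refine Fin.cases ?_ (fun s => ?_) s <;> simp

lemma cons_map {B B' : Type*} {n : ℕ} (g : B → B') (a : B) (x : Fin n → B) :
    (Fin.cons (g a) (fun s => g (x s)) : Fin (n + 1) → B') =
      fun s => g ((Fin.cons a x : Fin (n + 1) → B) s) := by
  funext s; refine Fin.cases ?_ (fun s => ?_) s <;> simp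

lemma cons_castLE {B : Type*} {n n' : ℕ} (h : n ≤ n') (a : B) (y : Fin n' → B) :
    (Fin.cons a (fun s => y (Fin.castLE h s)) : Fin (n + 1) → B) =
      fun s => (Fin.cons a y : Fin (n' + 1) → B) (Fin.castLE (Nat.succ_le_succ h) s) := by
  funext s; refine Fin.cases ?_ (fun s => ?_) s <;> rfl

lemma uPull_mem_LinFun {k k' : ℕ} (h : k ≤ k') {Ψ : D.Fun k} (hΨ : Ψ ∈ D.LinFun k) :
    uPull h Ψ ∈ D.LinFun k' :=
  ⟨fun B _ _ => hΨ.1 B _ _, fun c B _ => hΨ.2.1 c B _, fun B B' g _ => hΨ.2.2 B B' g _⟩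

lemma iPull_mem_LinFun {n : ℕ} {Θ : D.Fun (n + 1)} (hΘ : Θ ∈ D.LinFun (n + 1)) :
    iPull Θ ∈ D.LinFun n := by
  refine ⟨fun B x y => ?_, fun c B x => ?_, fun B B' g x => ?_⟩
  · have h := cons_add (0 : B) 0 x y
    rw [add_zero] at h
    exact (congrArg (Θ B) h).trans (hΘ.1 B _ _)
  · have h := cons_smul (D.scalar c) (0 : B) x
    rw [smul_zero] at h
    exact (congrArg (Θ B) h).trans (hΘ.2.1 c B _)
  · have h := cons_map g (0 : B) x
    rw [map_zero] at h
    exact (congrArg (Θ B') h).trans (hΘ.2.2 B B' g _)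

lemma iPull_mem {n : ℕ} {Θ : D.Fun (n + 1)} (hΘ : Θ ∈ E.X n) : iPull Θ ∈ E.HomN n :=
  ⟨iPull_mem_LinFun hΘ.1, fun a B y =>
    (congrArg (Θ B) (E.cons_actN n a B y)).trans (hΘ.2 a B _)⟩

lemma uPull_mem_X {n n' : ℕ} (h : n ≤ n') {Θ : D.Fun (n + 1)} (hΘ : Θ ∈ E.X n) :
    uPull (Nat.succ_le_succ h) Θ ∈ E.X n' :=
  ⟨uPull_mem_LinFun _ hΘ.1, fun a B x =>
    (congrArg (Θ B) (E.actJ_trunc h a B x).symm).trans (hΘ.2 a B _)⟩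

lemma actN_trunc {n n' : ℕ} (h : n ≤ n') (a : A) (B : D.NilpAlg) (y : Fin n' → B) :
    E.actN n a B (fun s => y (Fin.castLE h s)) = fun s => E.actN n' a B y (Fin.castLE h s) := by
  unfold actN
  rw [cons_castLE h, E.actJ_trunc h]
  rfl

lemma uPull_mem {n n' : ℕ} (h : n ≤ n') {Ψ : D.Fun n} (hΨ : Ψ ∈ E.HomN n) :
    uPull h Ψ ∈ E.HomN n' :=
  ⟨uPull_mem_LinFun _ hΨ.1, fun a B y =>
    (congrArg (Ψ B) (E.actN_trunc h a B y).symm).trans (hΨ.2 a B _)⟩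

/-- `i^* : X_n(E) → Hom_A(N^n, Ĝa)`. -/
def iStar (n : ℕ) : E.X n →ₗ[R] E.HomN n := iPull.restrict fun _ h => E.iPull_mem h

/-- `u^* : Hom_A(N^n, Ĝa) → Hom_A(N^{n'}, Ĝa)` for `n ≤ n'`. -/
def uStar {n n' : ℕ} (h : n ≤ n') : E.HomN n →ₗ[R] E.HomN n' :=
  (uPull h).restrict fun _ hΨ => E.uPull_mem h hΨ

/-! ### The module `H(E)` -/

/-- The `R`-linear span of `i^* φ^* X_{n-1}(E)` (zero for `n = 0`). -/
def den : (n : ℕ) → Submodule R (D.Fun n)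
  | 0 => ⊥
  | n + 1 => Submodule.span R {Ψ | ∃ Θ ∈ E.X n, Ψ = iPull (frobPull Θ)}

/-- `H_n(E) = Hom_A(N^n, Ĝa) / i^* φ^* (X_{n-1}(E)^φ)`. -/
abbrev Hlevel (n : ℕ) : Type (u + 1) := E.HomN n ⧸ (E.den n).comap (E.HomN n).subtype

lemma frob_castLE {B : Type u} [CommRing B] [Algebra R B] {k k' : ℕ} (h : k ≤ k')
    (x : Fin (k' + 1) → B) :
    D.frob (fun s => x (Fin.castLE (Nat.succ_le_succ h) s)) =
      fun s => D.frob x (Fin.castLE h s) := by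
  have e : ∀ j < k + 1, ext (fun s => x (Fin.castLE (Nat.succ_le_succ h) s)) j = ext x j := by
    intro j hj
    unfold ext; rw [dif_pos hj, dif_pos (by omega)]; rfl
  funext s
  have hs := s.2
  simp only [frob, frobSeq, Fin.val_castLE]
  rw [e 0 (by omega)]
  congr 1
  refine Finset.sum_congr rfl fun j hj => ?_
  have hj' := Finset.mem_range.1 hj
  rw [e (j + 1) (by omega)]

lemma uPull_den {n n' : ℕ} (h : n ≤ n') : E.den n ≤ (E.den n').comap (uPull h) := by
  cases n with
  | zero => simp [den]
  | succ n =>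
    cases n' with
    | zero => omega
    | succ n' =>
      refine Submodule.span_le.2 ?_
      rintro _ ⟨Θ, hΘ, rfl⟩
      refine Submodule.subset_span ⟨_, E.uPull_mem_X (Nat.le_of_succ_le_succ h) hΘ, ?_⟩
      funext B y
      have e : D.frob (B := B.carrier) (Fin.cons 0 fun s => y (Fin.castLE h s)) =
          fun s => D.frob (B := B.carrier) (Fin.cons 0 y) (Fin.castLE h s) := by
        rw [cons_castLE h, frob_castLE h]
      exact congrArg (Θ (D.twist B)) e

/-- `u^* : H_n(E) → H_{n'}(E)` for `n ≤ n'`. -/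
def uH (n n' : ℕ) (h : n ≤ n') : E.Hlevel n →ₗ[R] E.Hlevel n' :=
  Submodule.mapQ _ _ (E.uStar h) fun _ hx => E.uPull_den h hx

/-- `H(E)`, the direct limit of the `H_n(E)`. -/
abbrev H : Type (u + 1) := Module.DirectLimit E.Hlevel E.uH

/-- The class in `H(E)` of an element of `Hom_A(N^n, Ĝa)`. -/
def toH (n : ℕ) : E.HomN n →ₗ[R] E.H :=
  Module.DirectLimit.of R ℕ E.Hlevel E.uH n ∘ₗ Submodule.mkQ _

/-- The map `X_m(E) → H(E)` induced by `i^*`. -/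
def XtoH (m : ℕ) : E.X m →ₗ[R] E.H := E.toH m ∘ₗ E.iStar m

/-! ### Extensions of `E` by `Ĝa` -/

/-- Composition of `α : E → Ĝa` with the endomorphism `a` of `E`. -/
def compAct (a : A) : D.Fun 1 →ₗ[R] D.Fun 1 where
  toFun α := fun B x => α B (fun _ => E.act a B (x 0))
  map_add' _ _ := rfl
  map_smul' _ _ := rfl

/-- The cocycles of extensions of `E` by `Ĝa`.  A family `η` of morphisms `η_a : E → Ĝa` of
`Fq`-module schemes defines the operators `a (x, y) = (a x, η_a(x) + a y)` on `E × Ĝa`; the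
conditions say that this is an `Fq`-linear action of `A`, and that it is strict. -/
def Der : Submodule R (A → D.Fun 1) where
  carrier := {η | (∀ a, η a ∈ D.LinFun 1) ∧ (∀ a b, η (a + b) = η a + η b) ∧
    (∀ (c : Fq) (a : A), η (c • a) = D.scalar c • η a) ∧
    (∀ a b, η (a * b) = algebraMap A R a • η b + E.compAct b (η a)) ∧
    ∀ a, D.IsTangent (η a) 0}
  add_mem' := by
    rintro f g ⟨h1, h2, h3, h4, h5⟩ ⟨k1, k2, k3, k4, k5⟩
    refine ⟨fun a => add_mem (h1 a) (k1 a), fun a b => ?_, fun c a => ?_, fun a b => ?_,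
      fun a B b hb => ?_⟩
    · simp only [Pi.add_apply, h2, k2]; abel
    · simp only [Pi.add_apply, h3, k3, smul_add]
    · simp only [Pi.add_apply, h4, k4, smul_add, map_add]; abel
    · simp only [Pi.add_apply, h5 a B b hb, k5 a B b hb, zero_smul, add_zero]
  zero_mem' := by
    refine ⟨fun a => zero_mem _, fun a b => ?_, fun c a => ?_, fun a b => ?_,
      fun a B b hb => ?_⟩ <;> simp
  smul_mem' := by
    rintro r f ⟨h1, h2, h3, h4, h5⟩
    refine ⟨fun a => Submodule.smul_mem _ r (h1 a), fun a b => ?_, fun c a => ?_, fun a b => ?_,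
      fun a B b hb => ?_⟩
    · simp only [Pi.smul_apply, h2, smul_add]
    · simp only [Pi.smul_apply, h3, smul_comm r]
    · simp only [Pi.smul_apply, h4, smul_add, map_smul, smul_comm r]
    · simp only [Pi.smul_apply, h5 a B b hb, zero_smul, smul_zero]

/-- Cocycles of extensions isomorphic to the trivial one, by `(x, y) ↦ (x, y + α(x))`. -/
def Inner : Submodule R E.Der where
  carrier := {η | ∃ α ∈ D.LinFun 1, ∀ a, η.1 a = E.compAct a α - algebraMap A R a • α}
  add_mem' := by
    rintro f g ⟨α, hα, h⟩ ⟨β, hβ, k⟩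
    refine ⟨α + β, add_mem hα hβ, fun a => ?_⟩
    simp only [Submodule.coe_add, Pi.add_apply, h, k, map_add, smul_add]; abel
  zero_mem' := ⟨0, zero_mem _, fun a => by simp⟩
  smul_mem' := by
    rintro r f ⟨α, hα, h⟩
    refine ⟨r • α, Submodule.smul_mem _ r hα, fun a => ?_⟩
    simp only [Submodule.coe_smul, Pi.smul_apply, h, map_smul, smul_sub, smul_comm r]

/-- `Ext(E, Ĝa)`: isomorphism classes of extensions of `E` by `Ĝa`. -/
abbrev Ext := E.Der ⧸ E.Inner

/-- A pair `(η, s)` stands for the extension `E × Ĝa` with cocycle `η` together with the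
`R`-linear retraction `(x, y) ↦ s x + y` of `Lie Ĝa` in its Lie algebra.  These are the pairs
isomorphic to the trivial extension with `s = 0`, by `(x, y) ↦ (x, y + α(x))`. -/
def RigInner : Submodule R (E.Der × R) where
  carrier := {p | ∃ α ∈ D.LinFun 1,
    (∀ a, p.1.1 a = E.compAct a α - algebraMap A R a • α) ∧ D.IsTangent α (-p.2)}
  add_mem' := by
    rintro f g ⟨α, hα, h, h'⟩ ⟨β, hβ, k, k'⟩
    refine ⟨α + β, add_mem hα hβ, fun a => ?_, fun B b hb => ?_⟩
    · simp only [Prod.fst_add, Submodule.coe_add, Pi.add_apply, h, k, map_add, smul_add]; abel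
    · simp only [Pi.add_apply, h' B b hb, k' B b hb, Prod.snd_add, neg_add, add_smul]
  zero_mem' := ⟨0, zero_mem _, fun a => by simp, fun B b hb => by simp⟩
  smul_mem' := by
    rintro r f ⟨α, hα, h, h'⟩
    refine ⟨r • α, Submodule.smul_mem _ r hα, fun a => ?_, fun B b hb => ?_⟩
    · simp only [Prod.smul_fst, Submodule.coe_smul, Pi.smul_apply, h, map_smul, smul_sub,
        smul_comm r]
    · simp only [Pi.smul_apply, h' B b hb, Prod.smul_snd, smul_eq_mul, neg_smul, mul_smul,
        smul_neg]

/-- `H_dR(E) = Ext^♯(E, Ĝa)`: isomorphism classes of extensions of `E` by `Ĝa` together with a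
splitting of the associated extension of Lie algebras. -/
abbrev HdR := (E.Der × R) ⧸ E.RigInner

/-- `Lie(E)^*`; the coordinate of `E` identifies `Lie(E)` with `R`. -/
abbrev LieDual (_ : D.AdmissibleModule) := Module.Dual R R

/-- `Lie(E)^* → H_dR(E)`: a linear form `l` gives the trivial extension with the retraction
`(x, y) ↦ l(x) + y`. -/
def lieToHdR : E.LieDual →ₗ[R] E.HdR :=
  E.RigInner.mkQ ∘ₗ LinearMap.inr R E.Der R ∘ₗ LinearMap.applyₗ (1 : R)

/-- `H_dR(E) → Ext(E, Ĝa)`, forgetting the splitting. -/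
def hdRToExt : E.HdR →ₗ[R] E.Ext :=
  Submodule.mapQ _ _ (LinearMap.fst R E.Der R) fun _ ⟨α, hα, h, _⟩ => ⟨α, hα, h⟩

/-- The cocycle `E → N^n` of the extension `J^nE` of `E` by `N^n`, for the splitting given by
the Teichmüller section: the component in `N^n` of `a v(x)`. -/
def jetCocycle (n : ℕ) (a : A) (B : D.NilpAlg) (x : B) : Fin n → B :=
  Fin.tail (E.actJ n a B (Fin.cons x 0))

lemma actJ_teich (n : ℕ) (a : A) (B : D.NilpAlg) (x : B) :
    E.actJ n a B (Fin.cons x 0) =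
      (Fin.cons (E.act a B x) 0 + Fin.cons 0 (E.jetCocycle n a B x) : Fin (n + 1) → B) := by
  rw [← cons_add, add_zero, zero_add]
  conv_lhs => rw [← Fin.cons_self_tail (E.actJ n a B (Fin.cons x 0)), actJ_head]
  rfl

lemma jetCocycle_sq_zero (n : ℕ) (a : A) (B : D.NilpAlg) (b : B) (hb : b * b = 0) :
    E.jetCocycle n a B b = 0 := by
  have hQ : ∀ s, s ≠ 0 → b ^ D.Q ^ s = 0 := by
    intro s hs
    refine pow_eq_zero_of_le (m := 2) ?_ (by rw [pow_two, hb])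
    exact D.two_le_Q.trans (Nat.le_self_pow hs _)
  have hz : ∀ s, s ≠ 0 → ext (Fin.cons b 0 : Fin (n + 1) → B) s = 0 := by
    intro s hs
    unfold ext
    split_ifs with h
    · obtain ⟨s, rfl⟩ := Nat.exists_eq_succ_of_ne_zero hs
      rfl
    · rfl
  have h0 : ext (Fin.cons b 0 : Fin (n + 1) → B) 0 = b := rfl
  have hmul : ∀ (z : ℕ → B) (s : ℕ), s ≠ 0 →
      D.mulSeq z (ext (Fin.cons b 0 : Fin (n + 1) → B)) s = 0 := by
    intro z s hs
    refine Finset.sum_eq_zero fun j _ => Finset.sum_eq_zero fun l _ => ?_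
    rcases Nat.eq_zero_or_pos l with rfl | hl
    · rw [h0, Nat.sub_zero, hQ s hs, mul_zero, mul_zero]
    · rw [hz l hl.ne', zero_pow (D.Q_pow_ne_zero _), mul_zero, mul_zero]
  obtain ⟨T, hT⟩ : ∃ T : D.Witt n B, T = (Fin.cons b 0 : Fin (n + 1) → B) := ⟨_, rfl⟩
  have eT : ∀ s, ext T s = ext (Fin.cons b 0 : Fin (n + 1) → B) s := fun s => by rw [hT]
  have eT' : ext T = ext (Fin.cons b 0 : Fin (n + 1) → B) := funext eT
  have hsq : T * T = 0 := by
    funext s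
    change D.mulSeq (ext T) (ext T) s = 0
    rw [eT']
    by_cases hs : (s : ℕ) = 0
    · rw [hs]; simp [mulSeq, h0, hb]
    · exact hmul _ _ hs
  have h : E.act a (D.W n B) T = algebraMap A R a • T := E.strict a (D.W n B) T hsq
  have h3 : ∀ s : Fin n, (algebraMap R (D.Witt n B) (algebraMap A R a) * T) s.succ = 0 := by
    intro s
    rw [← D.truncSeq_ext T, witt_algebraMap, ← truncSeq_mulSeq, eT']
    exact hmul _ _ (by simp)
  rw [← Algebra.smul_def, ← h, hT] at h3
  funext s
  exact h3 s

/-- The cocycle of the push-out `E_Ψ^*` of the extension `J^nE` along `Ψ : N^n → Ĝa`. -/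
def push (n : ℕ) : E.HomN n →ₗ[R] E.Der where
  toFun Ψ := ⟨fun a B x => Ψ.1 B (E.jetCocycle n a B (x 0)), by
    obtain ⟨Ψ, ⟨p1, p2, p3⟩, p4⟩ := Ψ
    have tail_add : ∀ (B : D.NilpAlg) (x y : Fin (n + 1) → B),
      Fin.tail (x + y) = (Fin.tail x + Fin.tail y : Fin n → B) := fun _ _ _ => rfl
    refine ⟨fun a => ⟨fun B x y => ?_, fun c B x => ?_, fun B B' g x => ?_⟩, fun a b => ?_,
      fun c a => ?_, fun a b => ?_, fun a B b hb => ?_⟩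
    · change Ψ B (Fin.tail (E.actJ n a B (Fin.cons (x 0 + y 0) 0))) = _
      have h := cons_add (x 0) (y 0) (0 : Fin n → B) 0
      rw [add_zero] at h
      rw [h, actJ_add, tail_add, p1]
      rfl
    · change Ψ B (Fin.tail (E.actJ n a B (Fin.cons (D.scalar c • x 0) 0))) = _
      have h := cons_smul (D.scalar c) (x 0) (0 : Fin n → B)
      rw [smul_zero] at h
      rw [h, actJ_scalar]
      exact p2 c B _
    · change Ψ B' (Fin.tail (E.actJ n a B' (Fin.cons (g (x 0)) 0))) = _
      have h := cons_map g (x 0) (0 : Fin n → B)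
      have h' : (fun s => g ((0 : Fin n → B) s)) = 0 := by funext s; simp
      rw [h'] at h
      rw [h, actJ_map]
      exact p3 B B' g _
    · funext B x
      change Ψ B (Fin.tail (E.actJ n (a + b) B _)) = _
      rw [add_actJ, tail_add, p1]
      rfl
    · funext B x
      change Ψ B (Fin.tail (E.actJ n (c • a) B _)) = _
      rw [Algebra.smul_def, mul_actJ, scalar_actJ]
      exact p2 c B _
    · funext B x
      change Ψ B (Fin.tail (E.actJ n (a * b) B _)) = _
      rw [mul_actJ, actJ_teich, actJ_add, tail_add, p1, add_comm]
      exact congrArg₂ _ (p4 a B _) rfl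
    · change Ψ B (E.jetCocycle n a B b) = _
      rw [jetCocycle_sq_zero _ _ _ _ _ hb, zero_smul]
      have h := p1 B 0 0
      rw [add_zero] at h
      exact left_eq_add.1 h⟩
  map_add' _ _ := rfl
  map_smul' _ _ := rfl

/-- The connecting map `∂ : Hom_A(N^n, Ĝa) → Ext(E, Ĝa)`, `Ψ ↦ E_Ψ^*`. -/
def boundary (n : ℕ) : E.HomN n →ₗ[R] E.Ext := E.Inner.mkQ ∘ₗ E.push n

/-- `Ψ ↦ (E_Ψ^*, s_Ψ)`.  On `E_Ψ^* = E × Ĝa`, split by the Teichmüller section, the retraction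
`s_Ψ` induced by `ρ(x_0, …, x_n) = (x_1, …, x_n)` is `(x, y) ↦ y`. -/
def rigBoundary (n : ℕ) : E.HomN n →ₗ[R] E.HdR :=
  E.RigInner.mkQ ∘ₗ LinearMap.inl R E.Der R ∘ₗ E.push n

/-! ### The module `I(E)` -/

/-- `I_n(E)`, the image of `∂`. -/
abbrev Ilevel (n : ℕ) : Submodule R E.Ext := LinearMap.range (E.boundary n)

lemma push_uStar {n n' : ℕ} (h : n ≤ n') (Ψ : E.HomN n) :
    E.push n' (E.uStar h Ψ) = E.push n Ψ := by
  apply Subtype.ext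
  funext a B x
  change Ψ.1 B (fun s => E.jetCocycle n' a B (x 0) (Fin.castLE h s)) =
    Ψ.1 B (E.jetCocycle n a B (x 0))
  have e := E.actJ_trunc h a B (Fin.cons (x 0) 0)
  rw [← cons_castLE h] at e
  have e2 : E.jetCocycle n a B (x 0) = fun s => E.jetCocycle n' a B (x 0) (Fin.castLE h s) :=
    congrArg Fin.tail e
  rw [e2]

lemma Ilevel_mono {n n' : ℕ} (h : n ≤ n') : E.Ilevel n ≤ E.Ilevel n' := by
  rintro _ ⟨Ψ, rfl⟩
  exact ⟨E.uStar h Ψ, congrArg E.Inner.mkQ (E.push_uStar h Ψ)⟩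

/-- The map `I_n(E) → I_{n'}(E)` induced by `u^*`, that is, the inclusion in `Ext(E, Ĝa)`. -/
def uI (n n' : ℕ) (h : n ≤ n') : E.Ilevel n →ₗ[R] E.Ilevel n' :=
  Submodule.inclusion (E.Ilevel_mono h)

/-- `I(E)`, the direct limit of the `I_n(E)`. -/
abbrev I := Module.DirectLimit (fun n => E.Ilevel n) E.uI

/-- The class in `I(E)` of `∂Ψ`, for `Ψ` in `Hom_A(N^n, Ĝa)`. -/
def toI (n : ℕ) : E.HomN n →ₗ[R] E.I :=
  Module.DirectLimit.of R ℕ (fun n => E.Ilevel n) E.uI n ∘ₗ (E.boundary n).rangeRestrict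

/-- The canonical map `I(E) → Ext(E, Ĝa)`. -/
def IToExt : E.I →ₗ[R] E.Ext :=
  Module.DirectLimit.lift R ℕ (fun n => E.Ilevel n) E.uI (fun n => (E.Ilevel n).subtype)
    fun _ _ _ _ => rfl

/-! ### The characters `Ψ_i`, `Θ_m` and the constant `γ` -/

/-- `ϑ ∘ 𝔣^k` as a function on `N^{k+1}`, for `ϑ` on `N^1`. -/
def frobIter (ϑ : D.Fun 1) : (k : ℕ) → D.Fun (k + 1)
  | 0 => ϑ
  | k + 1 => frobPull (frobIter ϑ k)

/-- `Ψ_i = ϑ ∘ 𝔣^{i-1} : N^n → N^{n-i+1} → N^1 → Ĝa`, for `1 ≤ i ≤ n` (zero for other `i`). -/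
def Psi (ϑ : D.Fun 1) (n : ℕ) : ℕ → D.Fun n
  | 0 => 0
  | k + 1 => if h : k + 1 ≤ n then uPull h (frobIter ϑ k) else 0

/-- `ϑ` is the normalised character `ϑ_1` of `N^1`. -/
def IsTheta1 (ϑ : D.Fun 1) : Prop := ϑ ∈ E.HomN 1 ∧ D.IsTangent ϑ 1

/-- `Θ` is the normalised character `Θ_m` of order `m`:
`i^*Θ = Ψ_m - λ_{m-1} Ψ_{m-1} - ⋯ - λ_1 Ψ_1` with `λ_i ∈ R`. -/
def IsThetaM (ϑ : D.Fun 1) (m : ℕ) (Θ : D.Fun (m + 1)) : Prop :=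
  Θ ∈ E.X m ∧ ∃ lam : ℕ → R,
    iPull Θ = Psi ϑ m m - ∑ i ∈ Finset.Ico 1 m, lam i • Psi ϑ m i

/-- `γ = π g'(0)`, where `g = v^*Θ_m`. -/
def IsGamma (m : ℕ) (γ : R) : Prop :=
  ∃ (ϑ : D.Fun 1) (Θ : D.Fun (m + 1)) (d : R),
    E.IsTheta1 ϑ ∧ E.IsThetaM ϑ m Θ ∧ D.IsTangent (vPull Θ) d ∧ γ = D.π * d

end AdmissibleModule
end Modules
end FrobBase

end

/-!
# `H(E)` and the rigidified extensions of a Drinfeld module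

Everything is read off from derivatives at the origin. An `Fq`-linear function on `Ĝa` over
`Spf R` is a series `∑ c_i x ^ (q ^ i)` with `c_i → 0` (`exists_ser`), a function on `Ĝa^n` is a
sum of such series, and a function `f` with `f ∘ t = π f`, for an action of `t` with derivative `π`,
vanishes as soon as its derivative does (`eq_zero_of_tan_eq_zero`): `π` and
`π ^ (q ^ i)` differ for `i > 0`.

*Characters of `N^n`.* The module `N^1` is again a strict `A`-module on `Ĝa`, and its jet spaces
are the `N^{n+1}` (`HomN_succ`), the lateral Frobenius being the Frobenius of these jet spaces.
The coefficient of `x ^ (q ^ i)` in the action of `t` on `N^1` is divisible by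
`π ^ (q ^ i - 1)`, so the logarithm of `N^1` converges with coefficients in `R`; it is `ϑ`
(`exists_isTheta1`). The derivatives of `Ψ_1, …, Ψ_n` form a diagonal matrix with entries powers of
`π`, so for each `Ψ` the multiple `π ^ n Ψ` is a combination of them. On the first axis `Ψ_{k+1}` is
`x ^ (Q ^ k) + …`, where `Q = |A/𝔭|` and the dots have higher degree; hence the coefficients of that
combination are divisible by `π ^ n`, and `Hom_A(N^n, Ĝa)` is free on `Ψ_1, …, Ψ_n`
(`exists_eq_sum_Psi`).

*The Drinfeld hypothesis* is used only through `ker t`: it is finite, so that `t` is not zero modulo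
`π` (`exists_not_dvd_coef_of_kernelFinite`). Then `X_0(E) = 0`, and a character of `J^nE` is
determined by its restriction to `N^n`. The trivialisations of `E_Ψ^*` are the extensions of `Ψ` to
a character of `J^nE` (`exists_mem_X_of_push`, `push_iStar`). The trivialisations that respect the
splitting `s_Ψ` are the extensions with derivative zero along `E`. This gives the kernels of `∂`
and of `Ψ ↦ (E_Ψ^*, s_Ψ)`, hence both the exactness of the upper row and the commutativity of the
diagram.

*Characters with leading coefficient `1`.* Modulo `π`, composition with `t` is right
multiplication by a nonzero skew polynomial, so that division with remainder, followed by
`π`-adic approximation, shows that the `Fq`-linear functions modulo all `α ∘ t - π α` are finitely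
generated over `R` (`exists_division`). The extensions `E_{Ψ_i}^*` therefore satisfy a relation with
leading coefficient `1` in every large order, that is, there is a character of `J^{n+1}E` whose
restriction to `N^{n+1}` is `Ψ_{n+1}` plus lower terms (`exists_hasMonic`). The pull-back `φ^*`
shifts the coordinates of a character by one, and this lets the property descend to all orders
`≥ m` (`HasMonic.of_succ`). Pulled back by `φ^*`, these characters eliminate `Ψ_{n+1}` from
`H_{n+1}(E)` for all `n ≥ m`, and they account for all the denominators. So
`Hom_A(N^m, Ĝa) → H(E)` is bijective (`toH_injective`, `toH_surjective`), and `H(E)` is free of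
rank `m`; also `X_m(E) = R Θ_m`.

*The operator `𝔣^*` and `γ`.* For a character `Θ` with derivative zero along `E`,
`𝔣^* i^* Θ = i^* φ^* Θ` (`frobPull_iPull`). Since pull-backs along the Frobenius have derivative
zero along `E`, `𝔣^*` preserves the denominators; since `ker Φ` consists of the classes of such
`i^* Θ`, it is killed by `𝔣^*`, which therefore descends to the image of `Φ`. As
`X_m(E) = R Θ_m`, this kernel is zero exactly when the derivative of `Θ_m` along `E`, which is
`g'(0)`, is not zero (`rigBoundary_injective_iff`).
-/

noncomputable section

section

open Polynomial

/-! ### Additive polynomials over a finite field -/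

/-- If `n ≥ 1` is not a power of the prime `p`, some interior binomial coefficient of row `n` is
prime to `p`. -/
lemma exists_not_dvd_choose {p : ℕ} (hp : p.Prime) (n : ℕ) (h0 : n ≠ 0)
    (hn : ∀ i, n ≠ p ^ i) : ∃ j, 0 < j ∧ j < n ∧ ¬ p ∣ n.choose j := by
  haveI : Fact p.Prime := ⟨hp⟩
  induction n using Nat.strong_induction_on with
  | _ n ih =>
    by_cases hd : p ∣ n
    · obtain ⟨n', rfl⟩ := hd
      have h0' : n' ≠ 0 := by rintro rfl; simp at h0
      have hlt : n' < p * n' := lt_mul_of_one_lt_left (Nat.pos_of_ne_zero h0') hp.one_lt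
      obtain ⟨j, hj0, hjn, hj⟩ := ih n' hlt h0' (fun i hi => hn (i + 1) (by rw [hi, pow_succ']))
      refine ⟨p * j, Nat.mul_pos hp.pos hj0, Nat.mul_lt_mul_of_pos_left hjn hp.pos, ?_⟩
      have h1 := Choose.choose_modEq_choose_mod_mul_choose_div_nat (n := p * n') (k := p * j)
        (p := p)
      rw [Nat.mul_mod_right, Nat.mul_mod_right, Nat.choose_self, one_mul,
        Nat.mul_div_cancel_left _ hp.pos, Nat.mul_div_cancel_left _ hp.pos] at h1
      rwa [Nat.dvd_iff_mod_eq_zero, h1, ← Nat.dvd_iff_mod_eq_zero]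
    · have h1 : n ≠ 1 := by simpa using hn 0
      exact ⟨1, one_pos, by omega, by rwa [Nat.choose_one_right]⟩

/-- An exponent `p ^ i` that fixes a field with `p ^ e` elements is a power of `p ^ e`. -/
lemma exists_eq_pow_card (K : Type*) [Field K] [Finite K] {p i : ℕ} (hp : p.Prime) {e : ℕ}
    (hK : Nat.card K = p ^ e) (he : e ≠ 0) (h : ∀ x : K, x ^ p ^ i = x) :
    ∃ j, p ^ i = Nat.card K ^ j := by
  haveI := Fintype.ofFinite K
  have hlt := Nat.mod_lt i (Nat.pos_of_ne_zero he)
  have hfix : ∀ x : K, x ^ p ^ (i % e) = x := by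
    intro x
    have h1 : x ^ p ^ (e * (i / e)) = x := by
      rw [pow_mul, ← hK, Nat.card_eq_fintype_card]
      exact FiniteField.pow_card_pow _ _
    have h2 := h x
    rwa [← Nat.div_add_mod i e, pow_add, pow_mul, h1] at h2
  rcases Nat.eq_zero_or_pos (i % e) with h0 | h0
  · exact ⟨i / e, by rw [hK, ← pow_mul, Nat.mul_div_cancel' (Nat.dvd_of_mod_eq_zero h0)]⟩
  · exfalso
    have hp1 : 1 < p ^ (i % e) := Nat.one_lt_pow h0.ne' hp.one_lt
    have hne : (X ^ p ^ (i % e) - X : K[X]) ≠ 0 := FiniteField.X_pow_card_sub_X_ne_zero K hp1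
    have hle := Polynomial.card_le_degree_of_subset_roots (p := (X ^ p ^ (i % e) - X : K[X]))
      (Z := Finset.univ) (by
        intro x _
        rw [Polynomial.mem_roots hne]
        simp [hfix x])
    rw [FiniteField.X_pow_card_sub_X_natDegree_eq K hp1, Finset.card_univ,
      ← Nat.card_eq_fintype_card, hK] at hle
    exact absurd hle (not_le.2 (Nat.pow_lt_pow_right hp.one_lt hlt))

namespace FrobBase

variable {Fq A : Type v} {R : Type u} [Field Fq] [Finite Fq] [CommRing A] [Algebra Fq A]
  [CommRing R] [IsDomain R] [IsDiscreteValuationRing R] [Algebra A R] (D : FrobBase Fq A R)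

/-- The cardinality of `Fq`. -/
def q (_ : FrobBase Fq A R) : ℕ := Nat.card Fq

lemma exists_q_eq : ∃ p e : ℕ, p.Prime ∧ CharP R p ∧ e ≠ 0 ∧ D.q = p ^ e := by
  letI : Fintype Fq := Fintype.ofFinite _
  obtain ⟨p, hp⟩ := CharP.exists Fq
  obtain ⟨n, hn, hc⟩ := FiniteField.card Fq p
  refine ⟨p, n, hn, ?_, n.ne_zero, ?_⟩
  · exact charP_of_injective_ringHom (((algebraMap A R).comp (algebraMap Fq A)).injective) p
  · rw [q, Nat.card_eq_fintype_card, hc]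

lemma two_le_q : 2 ≤ D.q := by
  obtain ⟨p, k, hp, -, hk, h⟩ := D.exists_q_eq
  rw [h]
  exact hp.two_le.trans (Nat.le_self_pow hk p)

lemma q_pow_ne_zero (k : ℕ) : D.q ^ k ≠ 0 := pow_ne_zero _ (by have := D.two_le_q; omega)

lemma lt_q_pow (k : ℕ) : k < D.q ^ k := Nat.lt_pow_self D.two_le_q

lemma two_le_q_pow {k : ℕ} (hk : k ≠ 0) : 2 ≤ D.q ^ k :=
  D.two_le_q.trans (Nat.le_self_pow hk _)

lemma q_pow_injective : Function.Injective (fun i => D.q ^ i) :=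
  Nat.pow_right_injective D.two_le_q

lemma exists_Q_eq : ∃ f : ℕ, f ≠ 0 ∧ D.Q = D.q ^ f := by
  haveI := D.isMaximal
  letI : Field (A ⧸ D.𝔭) := Ideal.Quotient.field D.𝔭
  haveI : Finite (A ⧸ D.𝔭) := Nat.finite_of_card_ne_zero D.Q_ne_zero
  refine ⟨Module.finrank Fq (A ⧸ D.𝔭), ?_, Module.natCard_eq_pow_finrank⟩
  exact Module.finrank_pos.ne'

lemma scalar_pow_q (c : Fq) (i : ℕ) : D.scalar c ^ D.q ^ i = D.scalar c := by
  letI : Fintype Fq := Fintype.ofFinite _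
  rw [scalar, ← map_pow (algebraMap A R), ← map_pow (algebraMap Fq A), q,
    Nat.card_eq_fintype_card, FiniteField.pow_card_pow]

lemma add_pow_q {B : Type*} [CommRing B] [Algebra R B] (x y : B) (k : ℕ) :
    (x + y) ^ D.q ^ k = x ^ D.q ^ k + y ^ D.q ^ k := by
  obtain ⟨p, j, hp, hc, -, h⟩ := D.exists_q_eq
  cases subsingleton_or_nontrivial B
  · exact Subsingleton.elim _ _
  haveI : CharP Fq p := (((algebraMap A R).comp (algebraMap Fq A)).charP_iff
    ((algebraMap A R).comp (algebraMap Fq A)).injective p).2 hc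
  haveI : CharP B p := charP_of_injective_ringHom
    (((algebraMap R B).comp ((algebraMap A R).comp (algebraMap Fq A))).injective) p
  haveI : Fact p.Prime := ⟨hp⟩
  rw [h, ← pow_mul]
  exact add_pow_expChar_pow x y p _

lemma sum_pow_q {B : Type*} [CommRing B] [Algebra R B] {ι : Type*} (s : Finset ι) (f : ι → B)
    (k : ℕ) : (∑ i ∈ s, f i) ^ D.q ^ k = ∑ i ∈ s, f i ^ D.q ^ k := by
  classical
  induction s using Finset.induction_on with
  | empty => rw [Finset.sum_empty, Finset.sum_empty, zero_pow (D.q_pow_ne_zero k)]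
  | insert a s ha ih => rw [Finset.sum_insert ha, Finset.sum_insert ha, D.add_pow_q, ih]

/-! ### The `π`-adic topology of `R` -/

lemma maximalIdeal_pow (N : ℕ) :
    IsLocalRing.maximalIdeal R ^ N = Ideal.span {D.π ^ N} := by
  rw [← D.span_eq, Ideal.span_singleton_pow]; rfl

lemma smodEq_iff (N : ℕ) (x y : R) :
    x ≡ y [SMOD (IsLocalRing.maximalIdeal R ^ N • ⊤ : Submodule R R)] ↔ D.π ^ N ∣ x - y := by
  rw [SModEq.sub_mem, smul_eq_mul, Ideal.mul_top, D.maximalIdeal_pow, Ideal.mem_span_singleton]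

lemma eq_zero_of_forall_pow_dvd {r : R} (h : ∀ N, D.π ^ N ∣ r) : r = 0 := by
  haveI := D.complete
  refine IsHausdorff.haus (I := IsLocalRing.maximalIdeal R) inferInstance r fun N => ?_
  rw [D.smodEq_iff, sub_zero]
  exact h N

lemma isUnit_iff_not_dvd {r : R} : IsUnit r ↔ ¬ D.π ∣ r := by
  rw [← Ideal.mem_span_singleton]
  have h : Ideal.span {D.π} = IsLocalRing.maximalIdeal R := D.span_eq
  rw [h, IsLocalRing.mem_maximalIdeal, mem_nonunits_iff, not_not]

lemma dvd_φ_iff {r : R} : D.π ∣ D.φ r ↔ D.π ∣ r := by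
  constructor
  · intro h
    by_contra h'
    exact D.isUnit_iff_not_dvd.1 ((D.isUnit_iff_not_dvd.2 h').map D.φ) h
  · rintro ⟨y, rfl⟩
    rw [map_mul, φ_π]; exact dvd_mul_right _ _

lemma prime_π : Prime D.π := by
  refine ⟨D.π_ne_zero, D.π_not_unit, fun a b h => ?_⟩
  by_contra! hc
  exact D.isUnit_iff_not_dvd.1
    ((D.isUnit_iff_not_dvd.2 hc.1).mul (D.isUnit_iff_not_dvd.2 hc.2)) h

/-! ### Power series expansions of `Fq`-linear functions -/

/-- The test algebra `(R / π ^ N)[X]`, over which the `Fq`-linear functions on `Ĝa` are determined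
modulo `π ^ N` by their value at `X`. -/
abbrev polyAlg (N : ℕ) : D.NilpAlg where
  carrier := (R ⧸ Ideal.span {D.π ^ N})[X]
  nilp := ⟨N, by
    rw [← map_pow, IsScalarTower.algebraMap_apply R (R ⧸ Ideal.span {D.π ^ N}) _]
    have : algebraMap R (R ⧸ Ideal.span {D.π ^ N}) (D.π ^ N) = 0 :=
      Ideal.Quotient.eq_zero_iff_mem.2 (Ideal.mem_span_singleton_self _)
    rw [this, map_zero]⟩

/-- The substitution `X ↦ b` from `(R / π ^ N)[X]` to an algebra in which `π ^ N = 0`. -/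
def polyEval {N : ℕ} (B : D.NilpAlg) (hB : algebraMap R B D.π ^ N = 0) (b : B) :
    D.polyAlg N →ₐ[R] B :=
  Polynomial.eval₂AlgHom (Ideal.Quotient.liftₐ (Ideal.span {D.π ^ N}) (Algebra.ofId R B)
    (by
      intro a ha
      obtain ⟨y, rfl⟩ := Ideal.mem_span_singleton.1 ha
      rw [map_mul, map_pow]
      change algebraMap R B D.π ^ N * _ = 0
      rw [hB, zero_mul])) b (fun _ => Commute.all _ _)

lemma polyEval_X {N : ℕ} (B : D.NilpAlg) (hB : algebraMap R B D.π ^ N = 0) (b : B) :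
    D.polyEval B hB b (X : (R ⧸ Ideal.span {D.π ^ N})[X]) = b :=
  Polynomial.eval₂_X _ _

lemma polyAlg_nilp (N : ℕ) : algebraMap R (D.polyAlg N) D.π ^ N = 0 := by
  rw [← map_pow]
  change algebraMap R ((R ⧸ Ideal.span {D.π ^ N})[X]) (D.π ^ N) = 0
  rw [IsScalarTower.algebraMap_apply R (R ⧸ Ideal.span {D.π ^ N}) _]
  have : algebraMap R (R ⧸ Ideal.span {D.π ^ N}) (D.π ^ N) = 0 :=
    Ideal.Quotient.eq_zero_iff_mem.2 (Ideal.mem_span_singleton_self _)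
  rw [this, map_zero]

variable {D}

lemma algebraMap_eq_zero_of_dvd {B : Type*} [CommRing B] [Algebra R B] {N : ℕ}
    (hB : algebraMap R B D.π ^ N = 0) {r : R} (h : D.π ^ N ∣ r) : algebraMap R B r = 0 := by
  obtain ⟨y, rfl⟩ := h
  rw [map_mul, map_pow, hB, zero_mul]

/-- `f` is the function `x ↦ ∑ c_i x ^ (q ^ i)` on `Ĝa`, where `c_i → 0` in the `π`-adic
topology: on each test algebra almost all the terms vanish. -/
structure HasSer (f : D.Fun 1) (c : ℕ → R) : Prop where
  null : ∀ N, ∃ M, ∀ i ≥ M, D.π ^ N ∣ c i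
  eval : ∀ (B : D.NilpAlg) (x : Fin 1 → B) (M : ℕ), (∀ i ≥ M, algebraMap R B (c i) = 0) →
    f B x = ∑ i ∈ Finset.range M, c i • x 0 ^ D.q ^ i

lemma exists_bound {c : ℕ → R} (hc : ∀ N, ∃ M, ∀ i ≥ M, D.π ^ N ∣ c i) (B : D.NilpAlg) :
    ∃ M, ∀ i ≥ M, algebraMap R B (c i) = 0 := by
  obtain ⟨N, hN⟩ := B.nilp
  obtain ⟨M, hM⟩ := hc N
  exact ⟨M, fun i hi => algebraMap_eq_zero_of_dvd hN (hM i hi)⟩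

/-- A null sequence of coefficients defines a function on `Ĝa`. -/
lemma exists_hasSer {c : ℕ → R} (hc : ∀ N, ∃ M, ∀ i ≥ M, D.π ^ N ∣ c i) :
    ∃ f : D.Fun 1, HasSer f c := by
  refine ⟨fun B x => ∑ᶠ i, c i • x 0 ^ D.q ^ i, hc, fun B x M hM => ?_⟩
  refine finsum_eq_sum_of_support_subset _ fun i hi => ?_
  rw [Finset.coe_range, Set.mem_Iio]
  by_contra h
  exact hi (by simp only [Algebra.smul_def, hM i (not_lt.1 h), zero_mul])

lemma HasSer.mem {f : D.Fun 1} {c : ℕ → R} (h : HasSer f c) : f ∈ D.LinFun 1 := by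
  refine ⟨fun B x y => ?_, fun a B x => ?_, fun B B' g x => ?_⟩ <;>
  obtain ⟨M, hM⟩ := exists_bound h.null B
  · rw [h.eval B _ M hM, h.eval B _ M hM, h.eval B _ M hM, ← Finset.sum_add_distrib]
    simp only [Pi.add_apply, D.add_pow_q, smul_add]
  · rw [h.eval B _ M hM, h.eval B _ M hM, Finset.smul_sum]
    simp only [Pi.smul_apply, _root_.smul_pow, D.scalar_pow_q, smul_comm (D.scalar a)]
  · rw [h.eval B _ M hM, h.eval B' _ M fun i hi => by rw [← g.commutes, hM i hi, map_zero],
      map_sum]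
    simp only [map_smul, map_pow]

lemma HasSer.coeff {f : D.Fun 1} {c : ℕ → R} (h : HasSer f c) (N i : ℕ) :
    Polynomial.coeff (R := R ⧸ Ideal.span {D.π ^ N})
      (f (D.polyAlg N) (fun _ => (X : (R ⧸ Ideal.span {D.π ^ N})[X]))) (D.q ^ i) =
      Ideal.Quotient.mk _ (c i) := by
  obtain ⟨M, hM⟩ := exists_bound h.null (D.polyAlg N)
  rw [h.eval _ _ (M + i + 1) fun i hi => hM i (by omega)]
  have e : ∀ j, (c j • (X : (R ⧸ Ideal.span {D.π ^ N})[X]) ^ D.q ^ j : D.polyAlg N) =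
      (C (Ideal.Quotient.mk _ (c j)) * X ^ D.q ^ j : (R ⧸ Ideal.span {D.π ^ N})[X]) :=
    fun j => Algebra.smul_def (A := (R ⧸ Ideal.span {D.π ^ N})[X]) _ _
  rw [Finset.sum_congr rfl fun j _ => e j]
  refine (Polynomial.finsetSum_coeff (R := R ⧸ Ideal.span {D.π ^ N}) _ _ _).trans ?_
  rw [Finset.sum_eq_single i]
  · simp
  · intro j _ hj
    rw [Polynomial.coeff_C_mul_X_pow, if_neg]
    exact fun h => hj (D.q_pow_injective h).symm
  · intro h; exact absurd (Finset.mem_range.2 (by omega)) h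

lemma eq_of_forall_mk_eq {a b : R}
    (h : ∀ N, Ideal.Quotient.mk (Ideal.span {D.π ^ N}) a = Ideal.Quotient.mk _ b) : a = b :=
  sub_eq_zero.1 <| D.eq_zero_of_forall_pow_dvd fun N =>
    Ideal.mem_span_singleton.1 (Ideal.Quotient.eq.1 (h N))

lemma HasSer.unique {f : D.Fun 1} {c d : ℕ → R} (h : HasSer f c) (h' : HasSer f d) : c = d :=
  funext fun i => eq_of_forall_mk_eq (D := D) fun N => by rw [← h.coeff, ← h'.coeff]

lemma HasSer.fun_unique {f g : D.Fun 1} {c : ℕ → R} (h : HasSer f c) (h' : HasSer g c) :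
    f = g := by
  funext B x
  obtain ⟨M, hM⟩ := exists_bound h.null B
  rw [h.eval B x M hM, h'.eval B x M hM]

/-- The mixed terms of an additive polynomial vanish. -/
lemma _root_.Polynomial.choose_mul_coeff_eq_zero_of_additive {S : Type*} [CommRing S] {P : S[X]}
    (h : P.eval₂ ((C : S[X] →+* S[X][X]).comp C) (X + C X) =
      P.eval₂ ((C : S[X] →+* S[X][X]).comp C) X +
        P.eval₂ ((C : S[X] →+* S[X][X]).comp C) (C X))
    {n j : ℕ} (hj : 0 < j) (hjn : j < n) : (n.choose j : S) * P.coeff n = 0 := by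
  have e : ∀ z, P.eval₂ ((C : S[X] →+* S[X][X]).comp C) z = (P.map C).comp z := fun z => by
    rw [Polynomial.comp, Polynomial.eval₂_map]
  have h3 : (P.map C).comp (C (X : S[X])) = C P := by
    rw [Polynomial.comp, Polynomial.eval₂_at_apply, Polynomial.eval_map, Polynomial.eval₂_C_X]
  rw [e, e, e, ← Polynomial.taylor_apply, Polynomial.comp_X, h3] at h
  have h1 := congrArg (fun G : S[X][X] => (G.coeff j).coeff (n - j)) h
  simp only [Polynomial.taylor_coeff, Polynomial.coeff_add, Polynomial.coeff_map,
    Polynomial.coeff_C, if_neg hj.ne', if_neg (Nat.sub_ne_zero_of_lt hjn),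
    add_zero] at h1
  have h2 : Polynomial.hasseDeriv j (P.map C) = (Polynomial.hasseDeriv j P).map C := by
    ext1 i
    simp [Polynomial.hasseDeriv_coeff]
  rwa [h2, Polynomial.eval_map, Polynomial.eval₂_C_X, Polynomial.hasseDeriv_coeff,
    Nat.sub_add_cancel hjn.le] at h1

lemma apply_eq_polyEval {f : D.Fun 1} (hf : f ∈ D.LinFun 1) {N : ℕ} (B : D.NilpAlg)
    (hB : algebraMap R B D.π ^ N = 0) (b : B) :
    f B (fun _ => b) = D.polyEval B hB b
      (f (D.polyAlg N) (fun _ => (X : (R ⧸ Ideal.span {D.π ^ N})[X]))) := by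
  rw [← hf.2.2]
  exact congrArg (f B) (funext fun _ => (D.polyEval_X B hB b).symm)

/-- The polynomial representing an `Fq`-linear function modulo `π ^ N` involves only the powers
`X ^ (q ^ i)`. -/
lemma exists_eq_q_pow {f : D.Fun 1} (hf : f ∈ D.LinFun 1) (N : ℕ) {n : ℕ}
    (hn : Polynomial.coeff (R := R ⧸ Ideal.span {D.π ^ N})
      (f (D.polyAlg N) (fun _ => (X : (R ⧸ Ideal.span {D.π ^ N})[X]))) n ≠ 0) :
    ∃ i, n = D.q ^ i := by
  obtain ⟨P, hP⟩ : ∃ P : (R ⧸ Ideal.span {D.π ^ N})[X],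
    P = f (D.polyAlg N) (fun _ => (X : (R ⧸ Ideal.span {D.π ^ N})[X])) := ⟨_, rfl⟩
  rw [← hP] at hn
  obtain ⟨p, e, hp, hc, he, hq⟩ := D.exists_q_eq
  haveI := hc
  -- additivity is tested at the generic pair of points, over `(R / π ^ N)[X][Y]`
  let B : D.NilpAlg := ⟨(R ⧸ Ideal.span {D.π ^ N})[X][X], ⟨N, by
    rw [IsScalarTower.algebraMap_apply R ((R ⧸ Ideal.span {D.π ^ N})[X]) _, ← map_pow,
      D.polyAlg_nilp, map_zero]⟩⟩
  have hB : algebraMap R B D.π ^ N = 0 := by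
    change algebraMap R ((R ⧸ Ideal.span {D.π ^ N})[X][X]) D.π ^ N = 0
    rw [IsScalarTower.algebraMap_apply R ((R ⧸ Ideal.span {D.π ^ N})[X]) _, ← map_pow,
      D.polyAlg_nilp, map_zero]
  have h1 : ∀ z : (R ⧸ Ideal.span {D.π ^ N})[X][X], f B (fun _ => z) =
      P.eval₂ ((C : (R ⧸ Ideal.span {D.π ^ N})[X] →+* _).comp C) z := by
    intro z
    rw [apply_eq_polyEval hf B hB, ← hP]
    have : ((Ideal.Quotient.liftₐ (Ideal.span {D.π ^ N}) (Algebra.ofId R B)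
      (fun a ha => by
        obtain ⟨y, rfl⟩ := Ideal.mem_span_singleton.1 ha
        rw [map_mul, map_pow]
        change algebraMap R B D.π ^ N * _ = 0
        rw [hB, zero_mul]) :
        (R ⧸ Ideal.span {D.π ^ N}) →ₐ[R] B) : (R ⧸ Ideal.span {D.π ^ N}) →+* B) =
        ((C : (R ⧸ Ideal.span {D.π ^ N})[X] →+* _).comp C) := by
      refine Ideal.Quotient.ringHom_ext (RingHom.ext fun r => rfl)
    exact congrArg (fun ψ => P.eval₂ ψ z) this
  have hadd := hf.1 B (fun _ => X) (fun _ => C X)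
  rw [h1, h1] at hadd
  have hadd' := (h1 (X + C X)).symm.trans hadd
  have hlin : ∀ c : Fq, P.coeff n * (Ideal.Quotient.mk _ (D.scalar c)) ^ n =
      Ideal.Quotient.mk _ (D.scalar c) * P.coeff n := by
    intro c
    have h2 := hf.2.1 c (D.polyAlg N) (fun _ => (X : (R ⧸ Ideal.span {D.π ^ N})[X]))
    rw [← hP] at h2
    have h3 := apply_eq_polyEval hf (D.polyAlg N) (D.polyAlg_nilp N)
      (C (Ideal.Quotient.mk _ (D.scalar c)) * X)
    rw [← hP] at h3
    have h4 : D.polyEval (D.polyAlg N) (D.polyAlg_nilp N)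
        (C (Ideal.Quotient.mk _ (D.scalar c)) * X) P =
        P.comp (C (Ideal.Quotient.mk _ (D.scalar c)) * X) := by
      have : ((Ideal.Quotient.liftₐ (Ideal.span {D.π ^ N}) (Algebra.ofId R (D.polyAlg N))
        (fun a ha => by
          obtain ⟨y, rfl⟩ := Ideal.mem_span_singleton.1 ha
          rw [map_mul, map_pow]
          change algebraMap R (D.polyAlg N) D.π ^ N * _ = 0
          rw [D.polyAlg_nilp, zero_mul]) :
          (R ⧸ Ideal.span {D.π ^ N}) →ₐ[R] (D.polyAlg N)) :
          (R ⧸ Ideal.span {D.π ^ N}) →+* (D.polyAlg N)) =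
          (C : (R ⧸ Ideal.span {D.π ^ N}) →+* _) := by
        refine Ideal.Quotient.ringHom_ext (RingHom.ext fun r => rfl)
      exact congrArg (fun ψ => P.eval₂ ψ (C (Ideal.Quotient.mk _ (D.scalar c)) * X)) this
    have h5 : (D.scalar c • P : (R ⧸ Ideal.span {D.π ^ N})[X]) =
        C (Ideal.Quotient.mk _ (D.scalar c)) * P := Algebra.smul_def _ _
    have h6 : P.comp (C (Ideal.Quotient.mk _ (D.scalar c)) * X) =
        C (Ideal.Quotient.mk _ (D.scalar c)) * P := by
      rw [← h4, ← h5, ← h3, ← h2]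
      refine congrArg (f (D.polyAlg N)) (funext fun _ => ?_)
      exact (Algebra.smul_def (A := (R ⧸ Ideal.span {D.π ^ N})[X]) _ _).symm
    have h7 := congrArg (fun G => Polynomial.coeff G n) h6
    simpa only [Polynomial.comp_C_mul_X_coeff, Polynomial.coeff_C_mul] using h7
  -- a scalar of `Fq` that kills the coefficient is zero
  have hunit : ∀ c : Fq, Ideal.Quotient.mk (Ideal.span {D.π ^ N}) (D.scalar c) * P.coeff n = 0 →
      c = 0 := by
    intro c h
    by_contra h0
    have hu : IsUnit (Ideal.Quotient.mk (Ideal.span {D.π ^ N}) (D.scalar c)) :=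
      ((((Ideal.Quotient.mk (Ideal.span {D.π ^ N})).comp (algebraMap A R)).comp
        (algebraMap Fq A)).isUnit_map (Ne.isUnit h0))
    exact hn (hu.mul_right_eq_zero.1 h)
  have hpow : ∃ i, n = p ^ i := by
    by_contra! hc'
    have h0 : n ≠ 0 := by
      rintro rfl
      refine hn ?_
      have h2 := hlin 0
      simpa [scalar] using h2
    obtain ⟨j, hj0, hjn, hj⟩ := exists_not_dvd_choose hp n h0 hc'
    have h2 := Polynomial.choose_mul_coeff_eq_zero_of_additive hadd' hj0 hjn
    have h3 := hunit (n.choose j : Fq) (by simpa [scalar] using h2)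
    haveI : CharP Fq p := (((algebraMap A R).comp (algebraMap Fq A)).charP_iff
      ((algebraMap A R).comp (algebraMap Fq A)).injective p).2 hc
    exact hj ((CharP.cast_eq_zero_iff Fq p _).1 h3)
  obtain ⟨i, rfl⟩ := hpow
  exact exists_eq_pow_card Fq hp hq he fun x => by
    refine sub_eq_zero.1 (hunit _ ?_)
    have h2 := hlin x
    rw [mul_comm] at h2
    simp only [scalar, map_sub, map_pow, sub_mul] at h2 ⊢
    rw [h2, sub_self]

/-- Every morphism of `Fq`-module formal schemes `Ĝa → Ĝa` has an expansion
`x ↦ ∑ c_i x ^ (q ^ i)`. -/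
lemma exists_ser {f : D.Fun 1} (hf : f ∈ D.LinFun 1) : ∃ c, HasSer f c := by
  haveI := D.complete
  obtain ⟨P, hP⟩ : ∃ P : (N : ℕ) → (R ⧸ Ideal.span {D.π ^ N})[X],
    ∀ N, P N = f (D.polyAlg N) (fun _ => (X : (R ⧸ Ideal.span {D.π ^ N})[X])) := ⟨_, fun _ => rfl⟩
  have hle : ∀ {N N' : ℕ}, N ≤ N' → Ideal.span {D.π ^ N'} ≤ Ideal.span {D.π ^ N} := fun h =>
    Ideal.span_singleton_le_span_singleton.2 (pow_dvd_pow _ h)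
  have compat : ∀ {N N' : ℕ} (h : N ≤ N'), (P N').map (Ideal.Quotient.factor (hle h)) = P N := by
    intro N N' h
    let g : D.polyAlg N' →ₐ[R] D.polyAlg N :=
      Polynomial.mapAlgHom (Ideal.Quotient.factorₐ R (hle h))
    have h1 := hf.2.2 _ _ g (fun _ => (X : (R ⧸ Ideal.span {D.π ^ N'})[X]))
    rw [← hP] at h1
    refine Eq.trans h1.symm ((congrArg _ (funext fun _ => ?_)).trans (hP N).symm)
    exact Polynomial.map_X _
  have hc : ∀ n, ∃ c : R, ∀ N, Ideal.Quotient.mk _ c = (P N).coeff n := by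
    intro n
    choose a ha using fun N => Ideal.Quotient.mk_surjective ((P N).coeff n)
    obtain ⟨L, hL⟩ := IsPrecomplete.prec (I := IsLocalRing.maximalIdeal R) inferInstance
      (f := a) (by
        intro N N' h
        rw [D.smodEq_iff, ← Ideal.mem_span_singleton, ← Ideal.Quotient.eq, ha, ← compat h,
          Polynomial.coeff_map, ← ha]
        rfl)
    refine ⟨L, fun N => ?_⟩
    rw [← ha, eq_comm, Ideal.Quotient.eq, Ideal.mem_span_singleton, ← D.smodEq_iff]
    exact hL N
  choose c hc using hc
  have hnull : ∀ N, ∀ i ≥ (P N).natDegree + 1, D.π ^ N ∣ c (D.q ^ i) := by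
    intro N i hi
    rw [← Ideal.mem_span_singleton, ← Ideal.Quotient.eq_zero_iff_mem, hc]
    exact Polynomial.coeff_eq_zero_of_natDegree_lt (by have := D.lt_q_pow i; omega)
  refine ⟨fun i => c (D.q ^ i), fun N => ⟨_, hnull N⟩, fun B x M hM => ?_⟩
  obtain ⟨N, hN⟩ := B.nilp
  set M' := max M ((P N).natDegree + 1) with hM'
  have hPN : P N = ∑ i ∈ Finset.range M', C (Ideal.Quotient.mk _ (c (D.q ^ i))) * X ^ D.q ^ i := by
    ext n
    rw [Polynomial.finsetSum_coeff]
    simp only [Polynomial.coeff_C_mul_X_pow]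
    by_cases hn : ∃ i, n = D.q ^ i
    · obtain ⟨i, rfl⟩ := hn
      have e : ∀ j, (D.q ^ i = D.q ^ j) ↔ i = j := fun j =>
        ⟨fun h => D.q_pow_injective h, fun h => by rw [h]⟩
      simp only [e, Finset.sum_ite_eq, Finset.mem_range]
      split_ifs with h
      · exact (hc _ _).symm
      · refine Polynomial.coeff_eq_zero_of_natDegree_lt ?_
        have := D.lt_q_pow i
        omega
    · rw [Finset.sum_eq_zero fun i _ => if_neg fun h => hn ⟨i, h⟩]
      by_contra h
      refine hn (exists_eq_q_pow hf N (n := n) ?_)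
      rwa [← hP]
  have h1 : f B x = D.polyEval B hN (x 0) (P N) := by
    rw [hP, ← apply_eq_polyEval hf B hN]
    exact congrArg (f B) (funext fun s => by rw [Subsingleton.elim s 0])
  have h2 : ∀ i, D.polyEval B hN (x 0)
      (C (Ideal.Quotient.mk _ (c (D.q ^ i))) * X ^ D.q ^ i : (R ⧸ Ideal.span {D.π ^ N})[X]) =
      c (D.q ^ i) • x 0 ^ D.q ^ i := by
    intro i
    rw [Algebra.smul_def, ← (D.polyEval B hN (x 0)).commutes]
    refine (map_mul (D.polyEval B hN (x 0)) _ _).trans (congrArg₂ _ rfl ?_)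
    exact (map_pow (D.polyEval B hN (x 0)) _ _).trans (by rw [polyEval_X])
  have h3 : D.polyEval B hN (x 0) (P N) = ∑ i ∈ Finset.range M', c (D.q ^ i) • x 0 ^ D.q ^ i := by
    rw [hPN]
    refine (map_sum (D.polyEval B hN (x 0)) _ _).trans (Finset.sum_congr rfl fun i _ => h2 i)
  rw [h1, h3]
  symm
  refine Finset.sum_subset (Finset.range_mono (le_max_left _ _)) fun i _ hi => ?_
  rw [Algebra.smul_def, hM i (by simpa using hi), zero_mul]

open Classical in
/-- The coefficients of the expansion of an `Fq`-linear function on `Ĝa` (zero for other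
functions). -/
def coef (f : D.Fun 1) : ℕ → R := if h : ∃ c, HasSer f c then h.choose else 0

lemma hasSer_coef {f : D.Fun 1} (hf : f ∈ D.LinFun 1) : HasSer f (coef f) := by
  have h := exists_ser hf
  rw [coef, dif_pos h]
  exact h.choose_spec

lemma HasSer.coef_eq {f : D.Fun 1} {c : ℕ → R} (h : HasSer f c) : coef f = c :=
  (hasSer_coef h.mem).unique h

lemma ext_coef {f g : D.Fun 1} (hf : f ∈ D.LinFun 1) (hg : g ∈ D.LinFun 1)
    (h : ∀ i, coef f i = coef g i) : f = g :=
  (hasSer_coef hf).fun_unique ((funext h : coef f = coef g) ▸ hasSer_coef hg)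

lemma HasSer.add {f g : D.Fun 1} {c d : ℕ → R} (h : HasSer f c) (h' : HasSer g d) :
    HasSer (f + g) (c + d) := by
  have hnull : ∀ N, ∃ M, ∀ i ≥ M, D.π ^ N ∣ (c + d) i := by
    intro N
    obtain ⟨M, hM⟩ := h.null N
    obtain ⟨M', hM'⟩ := h'.null N
    exact ⟨max M M', fun i hi => dvd_add (hM i (le_of_max_le_left hi))
      (hM' i (le_of_max_le_right hi))⟩
  refine ⟨hnull, fun B x M hM => ?_⟩
  obtain ⟨M₁, hM₁⟩ := exists_bound h.null B
  obtain ⟨M₂, hM₂⟩ := exists_bound h'.null B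
  have e : (f + g) B x = ∑ i ∈ Finset.range (max M (max M₁ M₂)), (c + d) i • x 0 ^ D.q ^ i := by
    rw [Pi.add_apply, Pi.add_apply, h.eval B x (max M (max M₁ M₂)) fun i hi => hM₁ i (by omega),
      h'.eval B x (max M (max M₁ M₂)) fun i hi => hM₂ i (by omega), ← Finset.sum_add_distrib]
    simp only [Pi.add_apply, add_smul]
  rw [e]
  symm
  refine Finset.sum_subset (Finset.range_mono (le_max_left _ _)) fun i _ hi => ?_
  rw [Algebra.smul_def, hM i (by simpa using hi), zero_mul]

lemma coef_add {f g : D.Fun 1} (hf : f ∈ D.LinFun 1) (hg : g ∈ D.LinFun 1) (i : ℕ) :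
    coef (f + g) i = coef f i + coef g i :=
  congrFun ((hasSer_coef hf).add (hasSer_coef hg)).coef_eq i

lemma HasSer.smul {f : D.Fun 1} {c : ℕ → R} (h : HasSer f c) (r : R) :
    HasSer (r • f) (r • c) := by
  refine ⟨fun N => ?_, fun B x M hM => ?_⟩
  · obtain ⟨M, hM⟩ := h.null N
    exact ⟨M, fun i hi => (hM i hi).mul_left _⟩
  · obtain ⟨M₁, hM₁⟩ := exists_bound h.null B
    have e : (r • f) B x = ∑ i ∈ Finset.range (max M M₁), (r • c) i • x 0 ^ D.q ^ i := by
      rw [Pi.smul_apply, Pi.smul_apply, h.eval B x (max M M₁) fun i hi => hM₁ i (by omega),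
        Finset.smul_sum]
      simp only [Pi.smul_apply, smul_eq_mul, mul_smul]
    rw [e]
    symm
    refine Finset.sum_subset (Finset.range_mono (le_max_left _ _)) fun i _ hi => ?_
    rw [Algebra.smul_def, hM i (by simpa using hi), zero_mul]

lemma coef_zero (i : ℕ) : coef (0 : D.Fun 1) i = 0 := by
  have h := coef_add (zero_mem (D.LinFun 1)) (zero_mem (D.LinFun 1)) i
  rw [add_zero] at h
  exact left_eq_add.1 h

lemma coef_smul {f : D.Fun 1} (hf : f ∈ D.LinFun 1) (r : R) (i : ℕ) :
    coef (r • f) i = r * coef f i := by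
  exact congrFun ((hasSer_coef hf).smul r).coef_eq i

lemma coef_sub {f g : D.Fun 1} (hf : f ∈ D.LinFun 1) (hg : g ∈ D.LinFun 1) (i : ℕ) :
    coef (f - g) i = coef f i - coef g i := by
  have h := coef_add (sub_mem hf hg) hg i
  rw [sub_add_cancel] at h
  rw [h, add_sub_cancel_right]

lemma coef_sum {ι : Type*} (s : Finset ι) (f : ι → D.Fun 1) (hf : ∀ j, f j ∈ D.LinFun 1) (i : ℕ) :
    coef (∑ j ∈ s, f j) i = ∑ j ∈ s, coef (f j) i := by
  classical
  induction s using Finset.induction_on with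
  | empty => rw [Finset.sum_empty, Finset.sum_empty, coef_zero]
  | insert a s ha ih =>
    rw [Finset.sum_insert ha, Finset.sum_insert ha, ← ih, coef_add (hf a) (sum_mem fun j _ => hf j)]

/-- Composition of functions on `Ĝa`. -/
def compFun (f g : D.Fun 1) : D.Fun 1 := fun B x => f B (fun _ => g B x)

lemma compFun_mem {f g : D.Fun 1} (hf : f ∈ D.LinFun 1) (hg : g ∈ D.LinFun 1) :
    compFun f g ∈ D.LinFun 1 := by
  refine ⟨fun B x y => ?_, fun c B x => ?_, fun B B' φ x => ?_⟩
  · refine Eq.trans (congrArg (f B) (funext fun _ => hg.1 B x y)) (hf.1 B _ _)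
  · refine Eq.trans (congrArg (f B) (funext fun _ => hg.2.1 c B x)) (hf.2.1 c B _)
  · refine Eq.trans (congrArg (f B') (funext fun _ => hg.2.2 B B' φ x)) (hf.2.2 B B' φ _)

lemma coef_compFun {f g : D.Fun 1} (hf : f ∈ D.LinFun 1) (hg : g ∈ D.LinFun 1) (i : ℕ) :
    coef (compFun f g) i =
      ∑ p ∈ Finset.HasAntidiagonal.antidiagonal i, coef f p.1 * coef g p.2 ^ D.q ^ p.1 := by
  refine eq_of_forall_mk_eq (D := D) fun N => ?_
  rw [← (hasSer_coef (compFun_mem hf hg)).coeff]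
  obtain ⟨M₁, hM₁⟩ := exists_bound (hasSer_coef hf).null (D.polyAlg N)
  obtain ⟨M₂, hM₂⟩ := exists_bound (hasSer_coef hg).null (D.polyAlg N)
  set M := max (max M₁ M₂) (i + 1) with hM
  have hg1 := (hasSer_coef hg).eval (D.polyAlg N) (fun _ => (X : (R ⧸ Ideal.span {D.π ^ N})[X])) M
    fun i hi => hM₂ i (by omega)
  have e : compFun f g (D.polyAlg N) (fun _ => (X : (R ⧸ Ideal.span {D.π ^ N})[X])) =
      (∑ p ∈ Finset.range M ×ˢ Finset.range M,
        C (Ideal.Quotient.mk _ (coef f p.1 * coef g p.2 ^ D.q ^ p.1)) * X ^ D.q ^ (p.1 + p.2) :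
        (R ⧸ Ideal.span {D.π ^ N})[X]) := by
    rw [compFun, (hasSer_coef hf).eval (D.polyAlg N) _ M fun i hi => hM₁ i (by omega),
      Finset.sum_product]
    refine Finset.sum_congr rfl fun j _ => ?_
    rw [hg1, D.sum_pow_q, Finset.smul_sum]
    refine Finset.sum_congr rfl fun h _ => ?_
    rw [_root_.smul_pow, smul_smul, ← pow_mul, ← pow_add, add_comm h j]
    exact Algebra.smul_def (A := (R ⧸ Ideal.span {D.π ^ N})[X]) _ _
  rw [e, Polynomial.finsetSum_coeff]
  simp only [Polynomial.coeff_C_mul_X_pow]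
  rw [map_sum, ← Finset.sum_filter]
  refine Finset.sum_congr ?_ fun _ _ => rfl
  ext ⟨a, b⟩
  simp only [Finset.mem_filter, Finset.mem_product, Finset.mem_range,
    Finset.HasAntidiagonal.mem_antidiagonal]
  constructor
  · rintro ⟨-, h⟩; exact (D.q_pow_injective h).symm
  · rintro h; exact ⟨⟨by omega, by omega⟩, by rw [h]⟩

/-- The derivative at the origin is the coefficient of `x`. -/
lemma isTangent_iff {f : D.Fun 1} (hf : f ∈ D.LinFun 1) (d : R) :
    D.IsTangent f d ↔ d = coef f 0 := by
  have key : D.IsTangent f (coef f 0) := by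
    intro B b hb
    obtain ⟨M, hM⟩ := exists_bound (hasSer_coef hf).null B
    rw [(hasSer_coef hf).eval B _ (M + 1) fun i hi => hM i (by omega),
      Finset.sum_range_succ', Finset.sum_eq_zero, zero_add, pow_zero, pow_one]
    intro i _
    rw [pow_eq_zero_of_le (D.two_le_q_pow (Nat.succ_ne_zero i)) (by rw [pow_two, hb]), smul_zero]
  refine ⟨fun h => ?_, fun h => h ▸ key⟩
  refine eq_of_forall_mk_eq (D := D) fun N => ?_
  let B : D.NilpAlg := ⟨DualNumber (R ⧸ Ideal.span {D.π ^ N}), ⟨N, by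
    rw [IsScalarTower.algebraMap_apply R (R ⧸ Ideal.span {D.π ^ N}) _, ← map_pow, ← map_pow]
    have : algebraMap R (R ⧸ Ideal.span {D.π ^ N}) (D.π ^ N) = 0 :=
      Ideal.Quotient.eq_zero_iff_mem.2 (Ideal.mem_span_singleton_self _)
    rw [this, map_zero]⟩⟩
  have h1 := h B DualNumber.eps DualNumber.eps_mul_eps
  rw [key B DualNumber.eps DualNumber.eps_mul_eps] at h1
  have h2 := congrArg (fun z : DualNumber (R ⧸ Ideal.span {D.π ^ N}) => z.snd) h1
  have h3 : ∀ r : R, (r • DualNumber.eps : DualNumber (R ⧸ Ideal.span {D.π ^ N})).snd =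
      Ideal.Quotient.mk _ r := fun r => by
    rw [TrivSqZeroExt.snd_smul, DualNumber.snd_eps, Algebra.smul_def, mul_one]; rfl
  exact (h3 d).symm.trans (h2.symm.trans (h3 _))

/-! ### Functions of several variables -/

/-- The restriction of a function on `Ĝa^k` to the `s`-th axis. -/
def slice {k : ℕ} (s : Fin k) : D.Fun k →ₗ[R] D.Fun 1 where
  toFun f := fun B x => f B (Pi.single s (x 0))
  map_add' _ _ := rfl
  map_smul' _ _ := rfl

lemma slice_apply {k : ℕ} (s : Fin k) (f : D.Fun k) (B : D.NilpAlg) (x : Fin 1 → B) :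
    slice s f B x = f B (Pi.single s (x 0)) := rfl

lemma slice_mem {k : ℕ} (s : Fin k) {f : D.Fun k} (hf : f ∈ D.LinFun k) :
    slice s f ∈ D.LinFun 1 := by
  refine ⟨fun B x y => ?_, fun c B x => ?_, fun B B' φ x => ?_⟩
  · simp only [slice_apply, Pi.add_apply, Pi.single_add, hf.1]
  · simp only [slice_apply, Pi.smul_apply, Pi.single_smul, hf.2.1]
  · simp only [slice_apply, ← hf.2.2]
    refine congrArg (f B') (funext fun t => ?_)
    exact (Pi.apply_single (fun _ => φ) (fun _ => map_zero φ) s (x 0) t).symm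

lemma LinFun.apply_sum {k : ℕ} {f : D.Fun k} (hf : f ∈ D.LinFun k) {ι : Type*} (s : Finset ι)
    (B : D.NilpAlg) (x : ι → Fin k → B) : f B (∑ i ∈ s, x i) = ∑ i ∈ s, f B (x i) :=
  map_sum (AddMonoidHom.mk' (f B) (hf.1 B)) x s

lemma LinFun.apply_zero {k : ℕ} {f : D.Fun k} (hf : f ∈ D.LinFun k) (B : D.NilpAlg) :
    f B 0 = 0 :=
  map_zero (AddMonoidHom.mk' (f B) (hf.1 B))

lemma apply_eq_sum_slice {k : ℕ} {f : D.Fun k} (hf : f ∈ D.LinFun k) (B : D.NilpAlg)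
    (x : Fin k → B) : f B x = ∑ s, slice s f B (fun _ => x s) := by
  conv_lhs => rw [← Finset.univ_sum_single x, LinFun.apply_sum hf]
  rfl

lemma ext_slice {k : ℕ} {f g : D.Fun k} (hf : f ∈ D.LinFun k) (hg : g ∈ D.LinFun k)
    (h : ∀ s, slice s f = slice s g) : f = g := by
  funext B x
  rw [apply_eq_sum_slice hf, apply_eq_sum_slice hg]
  simp only [h]

/-- The coefficients of the derivative at the origin of an `Fq`-linear function on `Ĝa^k`. -/
def tan {k : ℕ} (f : D.Fun k) (s : Fin k) : R := coef (slice s f) 0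

lemma tan_eq {k : ℕ} {f : D.Fun k} (hf : f ∈ D.LinFun k) (s : Fin k) {d : R}
    (h : ∀ (B : D.NilpAlg) (b : B), b * b = 0 → f B (Pi.single s b) = d • b) : tan f s = d :=
  ((isTangent_iff (slice_mem s hf) d).1 fun B b hb => h B b hb).symm

lemma apply_single {k : ℕ} {f : D.Fun k} (hf : f ∈ D.LinFun k) (s : Fin k) (B : D.NilpAlg) (b : B)
    (hb : b * b = 0) : f B (Pi.single s b) = tan f s • b :=
  (isTangent_iff (slice_mem s hf) _).2 rfl B b hb

lemma tan_add {k : ℕ} {f g : D.Fun k} (hf : f ∈ D.LinFun k) (hg : g ∈ D.LinFun k) (s : Fin k) :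
    tan (f + g) s = tan f s + tan g s := by
  rw [tan, map_add, coef_add (slice_mem s hf) (slice_mem s hg)]; rfl

lemma tan_sub {k : ℕ} {f g : D.Fun k} (hf : f ∈ D.LinFun k) (hg : g ∈ D.LinFun k) (s : Fin k) :
    tan (f - g) s = tan f s - tan g s := by
  rw [tan, map_sub, coef_sub (slice_mem s hf) (slice_mem s hg)]; rfl

lemma tan_smul {k : ℕ} {f : D.Fun k} (hf : f ∈ D.LinFun k) (r : R) (s : Fin k) :
    tan (r • f) s = r * tan f s := by
  rw [tan, map_smul, coef_smul (slice_mem s hf)]; rfl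

lemma tan_zero {k : ℕ} (s : Fin k) : tan (0 : D.Fun k) s = 0 := by
  rw [tan, map_zero, coef_zero]

/-- A homomorphism from `Ĝa^k`, with a `π`-endomorphism `T` whose derivative is multiplication by
`π`, to `Ĝa` is determined by its derivative: comparing coefficients in `f ∘ T = π f` gives
`(π ^ (q ^ i) - π) f_i = 0` for the first non-zero coefficients `f_i`. -/
lemma eq_zero_of_tan_eq_zero {k : ℕ} {f : D.Fun k} (hf : f ∈ D.LinFun k)
    (T : (B : D.NilpAlg) → (Fin k → B) → Fin k → B)
    (hT : ∀ s, (fun B x => T B x s : D.Fun k) ∈ D.LinFun k)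
    (hT0 : ∀ (l : Fin k) (B : D.NilpAlg) (b : B), b * b = 0 →
      T B (Pi.single l b) = Pi.single l (D.π • b))
    (hfT : ∀ (B : D.NilpAlg) (x : Fin k → B), f B (T B x) = D.π • f B x)
    (h0 : ∀ s, tan f s = 0) : f = 0 := by
  have hTl : ∀ s l, coef (slice l (fun B x => T B x s : D.Fun k)) 0 = if s = l then D.π else 0 := by
    intro s l
    refine tan_eq (hT s) l fun B b hb => ?_
    rw [hT0 l B b hb, Pi.single_apply]
    split_ifs <;> simp
  have hcomp : ∀ l, D.π • slice l f =
      ∑ s, compFun (slice s f) (slice l (fun B x => T B x s : D.Fun k)) := by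
    intro l
    funext B x
    rw [Finset.sum_apply, Finset.sum_apply]
    exact (hfT B _).symm.trans (apply_eq_sum_slice hf B _)
  have key : ∀ i s, coef (slice s f) i = 0 := by
    intro i
    induction i using Nat.strong_induction_on with
    | _ i ih =>
      intro l
      rcases Nat.eq_zero_or_pos i with rfl | hi
      · exact h0 l
      have h1 := congrArg (fun g => coef g i) (hcomp l)
      beta_reduce at h1
      rw [coef_smul (slice_mem l hf), coef_sum _ _
        fun s => compFun_mem (slice_mem s hf) (slice_mem l (hT s))] at h1
      have h2 : ∀ s, coef (compFun (slice s f) (slice l (fun B x => T B x s : D.Fun k))) i =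
          coef (slice s f) i * (if s = l then D.π else 0) ^ D.q ^ i := by
        intro s
        rw [coef_compFun (slice_mem s hf) (slice_mem l (hT s)), Finset.sum_eq_single (i, 0)]
        · rw [hTl]
        · rintro ⟨a, b⟩ hab hne
          have hab' := Finset.HasAntidiagonal.mem_antidiagonal.1 hab
          have : a < i := by
            rcases Nat.eq_zero_or_pos b with rfl | hb
            · exact absurd (by simpa using hab') hne
            · simp only at hab'; omega
          rw [ih a this, zero_mul]
        · intro h; exact absurd (Finset.HasAntidiagonal.mem_antidiagonal.2 (by simp)) h
      rw [Finset.sum_congr rfl fun s _ => h2 s, Finset.sum_eq_single l, if_pos rfl] at h1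
      · have h3 : D.q ^ i = D.q ^ i - 2 + 1 + 1 := by have := D.two_le_q_pow hi.ne'; omega
        have h4 : D.π * ((1 - D.π ^ (D.q ^ i - 2 + 1)) * coef (slice l f) i) = 0 := by
          rw [h3, pow_succ] at h1
          linear_combination h1
        have h5 : IsUnit (1 - D.π ^ (D.q ^ i - 2 + 1)) := by
          rw [D.isUnit_iff_not_dvd, dvd_sub_left (dvd_pow_self _ (Nat.succ_ne_zero _))]
          exact fun h => D.π_not_unit (isUnit_of_dvd_one h)
        have h6 := (mul_eq_zero.1 h4).resolve_left D.π_ne_zero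
        exact (mul_eq_zero.1 h6).resolve_left h5.ne_zero
      · intro s _ hs
        rw [if_neg hs, zero_pow (D.q_pow_ne_zero i), mul_zero]
      · intro h; exact absurd (Finset.mem_univ l) h
  refine ext_slice hf (zero_mem _) fun s => ?_
  refine ext_coef (slice_mem s hf) (slice_mem s (zero_mem _)) fun i => ?_
  rw [key i s, map_zero, coef_zero]

/-! ### Reduction modulo `π` -/

lemma LinFun.eq_smul_of_dvd {f : D.Fun 1} (hf : f ∈ D.LinFun 1) (h : ∀ i, D.π ∣ coef f i) :
    ∃ g ∈ D.LinFun 1, f = D.π • g := by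
  choose c hc using h
  have hnull : ∀ N, ∃ M, ∀ i ≥ M, D.π ^ N ∣ c i := by
    intro N
    obtain ⟨M, hM⟩ := (hasSer_coef hf).null (N + 1)
    refine ⟨M, fun i hi => ?_⟩
    have h1 := hM i hi
    rw [hc, pow_succ'] at h1
    exact (mul_dvd_mul_iff_left D.π_ne_zero).1 h1
  obtain ⟨g, hg⟩ := exists_hasSer hnull
  refine ⟨g, hg.mem, (hasSer_coef hf).fun_unique ?_⟩
  have h1 : coef f = D.π • c := funext hc
  rw [h1]
  exact hg.smul _

/-- Reduction modulo `π` embeds the ring of `Fq`-linear functions in a skew power series ring, so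
that a product in it vanishes modulo `π` only if a factor does. -/
lemma dvd_coef_of_compFun {f g : D.Fun 1} (hf : f ∈ D.LinFun 1) (hg : g ∈ D.LinFun 1)
    (h : ∀ i, D.π ∣ coef (compFun f g) i) (hg0 : ∃ i, ¬ D.π ∣ coef g i) (i : ℕ) :
    D.π ∣ coef f i := by
  classical
  by_contra hi
  have hf0 : ∃ i, ¬ D.π ∣ coef f i := ⟨i, hi⟩
  have h1 := h (Nat.find hf0 + Nat.find hg0)
  rw [coef_compFun hf hg, ← Finset.add_sum_erase _ _ (a := (Nat.find hf0, Nat.find hg0))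
    (Finset.HasAntidiagonal.mem_antidiagonal.2 rfl), dvd_add_left] at h1
  · rcases D.prime_π.dvd_or_dvd h1 with h2 | h2
    · exact Nat.find_spec hf0 h2
    · exact Nat.find_spec hg0 (D.prime_π.dvd_of_dvd_pow h2)
  · refine Finset.dvd_sum ?_
    rintro ⟨a, b⟩ hab
    obtain ⟨hne, hab'⟩ := Finset.mem_erase.1 hab
    rw [Finset.HasAntidiagonal.mem_antidiagonal] at hab'
    simp only at hab'
    by_cases ha : a < Nat.find hf0
    · exact (not_not.1 (Nat.find_min hf0 ha)).mul_right _
    · have hb : b < Nat.find hg0 := by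
        by_contra hb
        have h3 : a = Nat.find hf0 := by omega
        have h4 : b = Nat.find hg0 := by omega
        exact hne (by rw [h3, h4])
      exact ((not_not.1 (Nat.find_min hg0 hb)).trans
        (dvd_pow_self _ (D.q_pow_ne_zero _))).mul_left _

/-- The functions on `Ĝa^k` form a `π`-adically separated module. -/
lemma LinFun.eq_zero_of_forall_smul {k : ℕ} {f : D.Fun k}
    (h : ∀ N, ∃ g : D.Fun k, f = D.π ^ N • g) : f = 0 := by
  funext B x
  obtain ⟨N, hN⟩ := B.nilp
  obtain ⟨g, hg⟩ := h N
  rw [hg, Pi.smul_apply, Pi.smul_apply, Algebra.smul_def, map_pow, hN, zero_mul]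
  rfl

lemma LinFun.eq_zero_of_smul_eq_zero {k : ℕ} {f : D.Fun k} (hf : f ∈ D.LinFun k) {r : R}
    (hr : r ≠ 0) (h : r • f = 0) : f = 0 := by
  refine ext_slice hf (zero_mem _) fun s => ?_
  refine ext_coef (slice_mem s hf) (slice_mem s (zero_mem _)) fun i => ?_
  have h1 := coef_smul (slice_mem s hf) r i
  rw [← map_smul, h, map_zero, coef_zero] at h1
  rw [map_zero, coef_zero]
  exact (mul_eq_zero.1 h1.symm).resolve_left hr

end FrobBase

end

namespace FrobBase

variable {Fq A : Type v} {R : Type u} [Field Fq] [Finite Fq] [CommRing A] [Algebra Fq A]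
  [CommRing R] [IsDomain R] [IsDiscreteValuationRing R] [Algebra A R] {D : FrobBase Fq A R}

/-! ### Verschiebung and Frobenius on Witt vectors -/

section WittOperators

variable (D)
variable {B : Type*} [CommRing B] [Algebra R B]

/-- The Verschiebung of infinite Witt vectors, in components. -/
def shiftSeq (x : ℕ → B) : ℕ → B
  | 0 => 0
  | s + 1 => x s

lemma shiftSeq_map {B' : Type*} [CommRing B'] [Algebra R B'] (g : B →ₐ[R] B') (x : ℕ → B) :
    shiftSeq (fun j => g (x j)) = fun s => g (shiftSeq x s) := by
  funext s
  cases s with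
  | zero => exact (map_zero g).symm
  | succ s => rfl

lemma ghost_shiftSeq_zero (x : ℕ → B) : D.ghost (shiftSeq x) 0 = 0 := by
  simp [ghost, shiftSeq]

lemma ghost_shiftSeq_succ (x : ℕ → B) (s : ℕ) :
    D.ghost (shiftSeq x) (s + 1) = algebraMap R B D.π * D.ghost x s := by
  rw [ghost, Finset.sum_range_succ', ghost, Finset.mul_sum]
  simp only [shiftSeq, zero_pow (D.Q_pow_ne_zero _), mul_zero, add_zero, Nat.add_sub_add_right]
  exact Finset.sum_congr rfl fun j _ => by ring

lemma ghost_wcB (r : R) (s : ℕ) : D.ghost (D.wcB B r) s = algebraMap R B (D.φ^[s] r) := by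
  rw [← D.ghost_wc]
  simp [wcB, ghost]

lemma wcB_map {B' : Type*} [CommRing B'] [Algebra R B'] (g : B →ₐ[R] B') (r : R) :
    D.wcB B' r = fun s => g (D.wcB B r s) := by
  funext s
  rw [wcB, wcB, g.commutes]

lemma frobSeq_map {B' : Type*} [CommRing B'] [Algebra R B'] (g : B →ₐ[R] B') (x : ℕ → B) :
    D.frobSeq (fun j => g (x j)) = fun s => g (D.frobSeq x s) := by
  funext s
  simp only [frobSeq, map_add, map_sum, map_mul, map_pow, AlgHom.commutes, apply_ite g, map_zero]

lemma mulSeq_shiftSeq_shiftSeq (x y : ℕ → B) :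
    D.mulSeq (shiftSeq x) (shiftSeq y) = shiftSeq (D.mulSeq (D.wcB B D.π) (D.mulSeq x y)) := by
  obtain ⟨X, rfl⟩ := exists_lift (R := R) x
  obtain ⟨Y, rfl⟩ := exists_lift (R := R) y
  rw [D.wcB_map (MvPolynomial.aeval (R := R) (id : B → B))]
  simp only [mulSeq_map, shiftSeq_map]
  rw [D.ghost_injective D.torsionFree_mvPolynomial (x := D.mulSeq (shiftSeq X) (shiftSeq Y))
    (y := shiftSeq (D.mulSeq (D.wcB _ D.π) (D.mulSeq X Y)))]
  intro s
  cases s with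
  | zero => simp only [ghost_mulSeq, ghost_shiftSeq_zero, zero_mul]
  | succ s =>
    have h := D.φ_iterate_π_pow s 1
    rw [pow_one] at h
    simp only [ghost_mulSeq, ghost_shiftSeq_succ, ghost_wcB, h]
    ring

lemma mulSeq_wcB_shiftSeq (r : R) (x : ℕ → B) :
    D.mulSeq (D.wcB B r) (shiftSeq x) = shiftSeq (D.mulSeq (D.wcB B (D.φ r)) x) := by
  obtain ⟨X, rfl⟩ := exists_lift (R := R) x
  rw [D.wcB_map (MvPolynomial.aeval (R := R) (id : B → B)),
    D.wcB_map (MvPolynomial.aeval (R := R) (id : B → B))]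
  simp only [mulSeq_map, shiftSeq_map]
  rw [D.ghost_injective D.torsionFree_mvPolynomial (x := D.mulSeq (D.wcB _ r) (shiftSeq X))
    (y := shiftSeq (D.mulSeq (D.wcB _ (D.φ r)) X))]
  intro s
  cases s with
  | zero => simp only [ghost_mulSeq, ghost_shiftSeq_zero, mul_zero]
  | succ s =>
    simp only [ghost_mulSeq, ghost_shiftSeq_succ, ghost_wcB, Function.iterate_succ_apply]
    ring

lemma frobSeq_mulSeq (x y : ℕ → B) :
    D.frobSeq (D.mulSeq x y) = D.mulSeq (D.frobSeq x) (D.frobSeq y) := by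
  obtain ⟨X, rfl⟩ := exists_lift (R := R) x
  obtain ⟨Y, rfl⟩ := exists_lift (R := R) y
  simp only [mulSeq_map, frobSeq_map]
  rw [D.ghost_injective D.torsionFree_mvPolynomial (x := D.frobSeq (D.mulSeq X Y))
    (y := D.mulSeq (D.frobSeq X) (D.frobSeq Y))]
  intro s
  simp only [ghost_mulSeq, ghost_frobSeq]

lemma frobSeq_wcB (r : R) : D.frobSeq (D.wcB B r) = D.wcB B (D.φ r) := by
  have h : D.frobSeq (D.wc r) = D.wc (D.φ r) := by
    refine D.ghost_injective D.torsionFree_self fun s => ?_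
    rw [ghost_frobSeq, ghost_wc, ghost_wc, Function.iterate_succ_apply]
  have h2 := D.frobSeq_map (Algebra.ofId R B) (D.wc r)
  rw [h] at h2
  exact h2

lemma φ_wc (r : R) (s : ℕ) : D.φ (D.wc r s) = D.wc (D.φ r) s := by
  have h : (fun s => D.φ (D.wc r s)) = D.wc (D.φ r) := by
    refine D.ghost_injective D.torsionFree_self fun s => ?_
    have h1 := congrArg D.φ (D.ghost_wc r s)
    rw [ghost_wc, ← Function.iterate_succ_apply, Function.iterate_succ_apply', ← h1]
    simp only [ghost, Algebra.algebraMap_self, RingHom.id_apply, map_sum, map_mul, map_pow,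
      D.φ_π]
  exact congrFun h s

lemma frobSeq_congr {x x' : ℕ → B} (s : ℕ) (h : ∀ j ≤ s + 1, x j = x' j) :
    D.frobSeq x s = D.frobSeq x' s := by
  unfold frobSeq
  rw [h 0 (Nat.zero_le _)]
  congr 1
  refine Finset.sum_congr rfl fun j hj => ?_
  rw [h (j + 1) (by have := Finset.mem_range.1 hj; omega)]

/-- Multiplication by a Witt vector with a single, square-zero, component is multiplication by a
ghost component. -/
lemma mulSeq_single (z : ℕ → B) (l : ℕ) {b : B} (hb : b * b = 0) :
    D.mulSeq z (fun j => if j = l then b else 0) =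
      fun s => if s = l then D.ghost z l * b else 0 := by
  funext s
  have hQ : ∀ k, k ≠ 0 → b ^ D.Q ^ k = 0 := fun k hk =>
    pow_eq_zero_of_le (D.two_le_Q.trans (Nat.le_self_pow hk _)) (by rw [pow_two, hb])
  rw [mulSeq]
  split_ifs with hs
  · subst hs
    rw [ghost, Finset.sum_mul]
    refine Finset.sum_congr rfl fun j hj => ?_
    have hj' : j ≤ s := Nat.lt_succ_iff.1 (Finset.mem_range.1 hj)
    rw [Finset.sum_eq_single s]
    · rw [if_pos rfl, Nat.sub_self, pow_zero, pow_one, min_eq_left hj', max_eq_right hj',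
        Nat.sub_self, wc_apply_zero, map_pow]
      ring
    · intro l _ hl
      rw [if_neg hl, zero_pow (D.Q_pow_ne_zero _), mul_zero, mul_zero]
    · intro h; exact absurd (Finset.mem_range.2 (Nat.lt_succ_self s)) h
  · refine Finset.sum_eq_zero fun j _ => Finset.sum_eq_zero fun i hi => ?_
    have hi' := Finset.mem_range.1 hi
    split_ifs with h
    · rw [hQ _ (by omega), mul_zero, mul_zero]
    · rw [zero_pow (D.Q_pow_ne_zero _), mul_zero, mul_zero]

lemma ghost_single (l : ℕ) (b : B) :
    D.ghost (fun j => if j = l then b else 0) l = algebraMap R B D.π ^ l * b := by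
  rw [ghost, Finset.sum_eq_single l]
  · simp
  · intro j _ hj
    rw [if_neg hj, zero_pow (D.Q_pow_ne_zero _), mul_zero]
  · intro h; exact absurd (Finset.mem_range.2 (Nat.lt_succ_self l)) h

lemma ext_single {n : ℕ} (l : Fin n) (b : B) :
    ext (Pi.single l b : Fin n → B) = fun j => if j = (l : ℕ) then b else 0 := by
  funext j
  unfold ext
  split_ifs with h h' h'
  · obtain rfl : l = ⟨j, h⟩ := Fin.ext h'.symm
    exact Pi.single_eq_same _ _
  · exact Pi.single_eq_of_ne (fun h2 => h' (congrArg Fin.val h2)) _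
  · omega
  · rfl

end WittOperators

section WittAlg

variable {B : Type u} [CommRing B] [Algebra R B] {n : ℕ}

/-- The Verschiebung `W_n(B) → W_{n+1}(B)`. -/
def versch (y : D.Witt n B) : D.Witt (n + 1) B := (Fin.cons 0 y : Fin (n + 2) → B)

lemma truncSeq_shiftSeq (x : ℕ → B) :
    D.truncSeq (n + 1) (shiftSeq x) = versch (D.truncSeq n x) := by
  funext s
  refine Fin.cases rfl (fun s => rfl) s

lemma versch_eq (y : D.Witt n B) : versch y = D.truncSeq (n + 1) (shiftSeq (ext y)) := by
  rw [truncSeq_shiftSeq, truncSeq_ext]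

lemma versch_add (x y : D.Witt n B) : versch (x + y) = versch x + versch y := by
  have h := AdmissibleModule.cons_add (0 : B) 0 x y
  rw [add_zero] at h
  exact h

lemma versch_sum {ι : Type*} (s : Finset ι) (f : ι → D.Witt n B) :
    versch (∑ i ∈ s, f i) = ∑ i ∈ s, versch (f i) :=
  map_sum (AddMonoidHom.mk' (versch : D.Witt n B → D.Witt (n + 1) B) versch_add) f s

lemma smul_versch (r : R) (y : D.Witt n B) : r • versch y = versch (D.φ r • y) := by
  rw [Algebra.smul_def, Algebra.smul_def, witt_algebraMap, witt_algebraMap, versch_eq,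
    ← truncSeq_mulSeq, mulSeq_wcB_shiftSeq, truncSeq_shiftSeq, truncSeq_mulSeq, truncSeq_ext]

lemma versch_mul_versch (x y : D.Witt n B) :
    versch x * versch y = versch (D.π • (x * y)) := by
  rw [versch_eq, versch_eq, ← truncSeq_mulSeq, mulSeq_shiftSeq_shiftSeq, truncSeq_shiftSeq,
    truncSeq_mulSeq, truncSeq_mulSeq, truncSeq_ext, truncSeq_ext, Algebra.smul_def,
    witt_algebraMap]

lemma versch_pow (y : D.Witt n B) (k : ℕ) :
    versch y ^ (k + 1) = versch (D.π ^ k • y ^ (k + 1)) := by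
  induction k with
  | zero => simp
  | succ k ih =>
    rw [pow_succ, ih, versch_mul_versch]
    congr 1
    rw [smul_mul_assoc, smul_smul, ← pow_succ', ← pow_succ]

lemma algebraMap_twist (B : D.NilpAlg) (r : R) :
    algebraMap R (D.twist B) r = algebraMap R B (D.φ r) := rfl

lemma mulSeq_twist (B : D.NilpAlg) (x y : ℕ → B) :
    D.mulSeq (B := D.twist B) x y = D.mulSeq (B := B.carrier) x y := by
  funext s
  refine Finset.sum_congr rfl fun j _ => Finset.sum_congr rfl fun l _ => ?_
  rw [algebraMap_twist, φ_wc, map_pow, φ_π]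
  rfl

lemma frob_truncSeq (x : ℕ → B) :
    D.frob (k := n + 1) (D.truncSeq (n + 1) x) = D.truncSeq n (D.frobSeq x) := by
  funext s
  have hs := s.2
  refine D.frobSeq_congr _ fun j hj => ?_
  unfold ext
  rw [dif_pos (by omega)]
  rfl

/-- The Frobenius `W_{n+1}(B) → W_n(B^φ)` is a homomorphism of `R`-algebras. -/
def frobHom (n : ℕ) (B : D.NilpAlg) : D.W (n + 1) B →ₐ[R] D.W n (D.twist B) where
  toFun x := D.frob (B := B.carrier) (k := n + 1) x
  map_one' := by
    have h : (1 : D.Witt (n + 1) B) = D.truncSeq (n + 1) (D.wcB B 1) := by rw [wcB_one]; rfl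
    refine (congrArg (D.frob (B := B.carrier) (k := n + 1)) h).trans ?_
    rw [frob_truncSeq, frobSeq_wcB, map_one, wcB_one]
    rfl
  map_mul' x y := by
    have h : ∀ a b : D.Witt (n + 1) B, D.frob (B := B.carrier) (k := n + 1) (a * b) =
        D.truncSeq n (D.mulSeq (B := B.carrier) (ext (D.frob (B := B.carrier) (k := n + 1) a))
          (ext (D.frob (B := B.carrier) (k := n + 1) b))) := by
      intro a b
      rw [← D.truncSeq_ext a, ← D.truncSeq_ext b, ← truncSeq_mulSeq, frob_truncSeq,
        frob_truncSeq, frob_truncSeq, frobSeq_mulSeq, truncSeq_mulSeq]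
      exact (congrArg₂ (· * ·) (D.truncSeq_ext _) (D.truncSeq_ext _)).symm.trans
        (D.truncSeq_mulSeq _ _).symm
    refine (h x y).trans ?_
    rw [← mulSeq_twist]
    rfl
  map_zero' := by
    have h := D.frob_add (B := B.carrier) (k := n + 1) 0 0
    rw [add_zero] at h
    exact left_eq_add.1 h
  map_add' x y := D.frob_add (B := B.carrier) (k := n + 1) x y
  commutes' r := by
    have h : D.frob (B := B.carrier) (k := n + 1) (D.truncSeq (n + 1) (D.wcB B r)) =
      D.truncSeq n (D.wcB B (D.φ r)) := by rw [frob_truncSeq, frobSeq_wcB]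
    refine h.trans (funext fun s => ?_)
    change algebraMap R B _ = algebraMap R B (D.φ _)
    rw [φ_wc]

lemma frob_single {k : ℕ} {B : Type*} [CommRing B] [Algebra R B] (l : Fin k) {b : B}
    (hb : b * b = 0) : D.frob (Pi.single l.succ b) = Pi.single l (D.π • b) := by
  have hQ : ∀ k, k ≠ 0 → b ^ D.Q ^ k = 0 := fun k hk =>
    pow_eq_zero_of_le (D.two_le_Q.trans (Nat.le_self_pow hk _)) (by rw [pow_two, hb])
  funext s
  rw [frob, frobSeq, ext_single]
  have h0 : (if (0 : ℕ) = (l.succ : ℕ) then b else 0) = 0 := if_neg (by simp)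
  beta_reduce
  rw [h0, zero_pow D.Q_ne_zero, ite_self, zero_add]
  have h1 : ∀ j, (if j + 1 = (l.succ : ℕ) then b else 0) = if j = (l : ℕ) then b else 0 := by
    intro j; simp
  simp only [h1]
  by_cases hs : s = l
  · subst hs
    rw [Finset.sum_eq_single (s : ℕ), if_pos rfl, Nat.sub_self, pow_zero, pow_one, wc_apply_zero,
      Pi.single_eq_same, Algebra.smul_def]
    · intro j _ hj
      rw [if_neg hj, zero_pow (D.Q_pow_ne_zero _), mul_zero]
    · intro h; exact absurd (Finset.mem_range.2 (Nat.lt_succ_self _)) h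
  · rw [Pi.single_eq_of_ne hs]
    refine Finset.sum_eq_zero fun j hj => ?_
    have hj' := Finset.mem_range.1 hj
    have hs' : (s : ℕ) ≠ l := fun h => hs (Fin.ext h)
    split_ifs with h
    · rw [hQ _ (by omega), mul_zero]
    · rw [zero_pow (D.Q_pow_ne_zero _), mul_zero]

lemma frob_single_zero {k : ℕ} {B : Type*} [CommRing B] [Algebra R B] (b : B) :
    D.frob (k := k + 1) (Pi.single 0 b) = Pi.single 0 (b ^ D.Q) := by
  funext s
  rw [frob, frobSeq, ext_single]
  have h1 : ∀ j, (if j + 1 = ((0 : Fin (k + 2)) : ℕ) then b else 0) = 0 := by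
    intro j; simp
  simp only [h1, zero_pow (D.Q_pow_ne_zero _), mul_zero, Finset.sum_const_zero, add_zero]
  by_cases hs : s = 0
  · subst hs; simp
  · rw [Pi.single_eq_of_ne hs]
    exact if_neg fun h => hs (Fin.ext h)

lemma frob_single_zero_sq {k : ℕ} {B : Type*} [CommRing B] [Algebra R B] {b : B}
    (hb : b * b = 0) : D.frob (k := k) (Pi.single 0 b) = 0 := by
  have hQ : ∀ k, k ≠ 0 → b ^ D.Q ^ k = 0 := fun k hk =>
    pow_eq_zero_of_le (D.two_le_Q.trans (Nat.le_self_pow hk _)) (by rw [pow_two, hb])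
  cases k with
  | zero => exact Subsingleton.elim _ _
  | succ k =>
    have := hQ 1 one_ne_zero
    rw [pow_one] at this
    rw [frob_single_zero, this, Pi.single_zero]

end WittAlg

/-! ### Pull-back along the Frobenius -/

/-- The twist of a homomorphism of test algebras. -/
def twistHom {B B' : D.NilpAlg} (g : B →ₐ[R] B') : D.twist B →ₐ[R] D.twist B' :=
  { (g : B →+* B') with commutes' := fun r => g.commutes (D.φ r) }

lemma frobPull_apply {k : ℕ} (f : D.Fun k) (B : D.NilpAlg) (x : Fin (k + 1) → B) :
    frobPull f B x = f (D.twist B) (D.frob (B := B.carrier) x) := rfl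

lemma frobPull_mem {k : ℕ} {f : D.Fun k} (hf : f ∈ D.LinFun k) :
    frobPull f ∈ D.LinFun (k + 1) := by
  refine ⟨fun B x y => ?_, fun c B x => ?_, fun B B' g x => ?_⟩
  · rw [frobPull_apply, frob_add]
    exact hf.1 (D.twist B) _ _
  · rw [frobPull_apply, frob_scalar_smul]
    have h := hf.2.1 c (D.twist B) (D.frob (B := B.carrier) x)
    have e : ∀ y : B, (HSMul.hSMul (β := D.twist B) (D.scalar c) y : D.twist B) =
        (D.scalar c • y : B) := fun y => by rw [twist_smul, φ_scalar]
    exact (congrArg (f (D.twist B)) (funext fun s => (e _).symm)).trans (h.trans (e _))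
  · rw [frobPull_apply, frob_map]
    exact hf.2.2 _ _ (twistHom g) _

lemma tan_frobPull_succ {k : ℕ} {f : D.Fun k} (hf : f ∈ D.LinFun k) (s : Fin k) :
    tan (frobPull f) s.succ = D.π * D.φ (tan f s) := by
  refine tan_eq (frobPull_mem hf) _ fun B b hb => ?_
  rw [frobPull_apply, frob_single s hb]
  have hb' : (D.π • b) * (D.π • b) = 0 := by rw [smul_mul_smul_comm, hb, smul_zero]
  refine (apply_single hf s (D.twist B) (D.π • b) hb').trans ?_
  rw [twist_smul, smul_smul, mul_comm]

lemma tan_frobPull_zero {k : ℕ} {f : D.Fun k} (hf : f ∈ D.LinFun k) :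
    tan (frobPull f) 0 = 0 := by
  refine tan_eq (frobPull_mem hf) _ fun B b hb => ?_
  rw [frobPull_apply, frob_single_zero_sq hb, zero_smul]
  exact LinFun.apply_zero hf _

/-- On the first axis the Frobenius is `x ↦ x ^ Q`. -/
lemma hasSer_slice_zero_frobPull {k : ℕ} {f : D.Fun (k + 1)} (hf : f ∈ D.LinFun (k + 1)) {e : ℕ}
    (he : D.Q = D.q ^ e) :
    HasSer (slice 0 (frobPull f))
      (fun i => if e ≤ i then D.φ (coef (slice 0 f) (i - e)) else 0) := by
  have hs := hasSer_coef (slice_mem 0 hf)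
  refine ⟨fun N => ?_, fun B x M hM => ?_⟩
  · obtain ⟨M, hM⟩ := hs.null N
    refine ⟨M + e, fun i hi => ?_⟩
    rw [if_pos (by omega)]
    obtain ⟨y, hy⟩ := hM (i - e) (by omega)
    rw [hy, map_mul, map_pow, φ_π]
    exact dvd_mul_right _ _
  · have h1 : slice 0 (frobPull f) B x = slice 0 f (D.twist B) (fun _ => x 0 ^ D.Q) := by
      rw [slice_apply, frobPull_apply, frob_single_zero]; rfl
    rw [h1]
    refine (hs.eval (D.twist B) (fun _ => x 0 ^ D.Q) M fun i hi => ?_).trans ?_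
    · have h2 := hM (i + e) (by omega)
      rw [if_pos (Nat.le_add_left _ _), Nat.add_sub_cancel] at h2
      exact h2
    · have h2 : ∀ i, (HSMul.hSMul (β := D.twist B) (coef (slice 0 f) i) ((x 0 ^ D.Q) ^ D.q ^ i) :
          D.twist B) = (D.φ (coef (slice 0 f) i) • x 0 ^ D.q ^ (i + e) : B) := fun i => by
        rw [twist_smul, he, ← pow_mul, ← pow_add, Nat.add_comm e i]
      have h3 : ∑ i ∈ Finset.range M, (HSMul.hSMul (β := D.twist B) (coef (slice 0 f) i)
          ((x 0 ^ D.Q) ^ D.q ^ i) : D.twist B) =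
          (∑ i ∈ Finset.range M, D.φ (coef (slice 0 f) i) • x 0 ^ D.q ^ (i + e) : B) :=
        Finset.sum_congr rfl fun i _ => h2 i
      refine h3.trans ?_
      have h4 : ∑ i ∈ Finset.range M, (D.φ (coef (slice 0 f) i) • x 0 ^ D.q ^ (i + e) : B) =
          ∑ i ∈ Finset.range (M + e),
            (if e ≤ i then D.φ (coef (slice 0 f) (i - e)) else 0) • x 0 ^ D.q ^ i := by
        rw [add_comm M e, Finset.sum_range_add, Finset.sum_eq_zero (s := Finset.range e), zero_add]
        · refine Finset.sum_congr rfl fun i _ => ?_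
          rw [if_pos (Nat.le_add_right _ _), Nat.add_sub_cancel_left, add_comm i e]
        · intro i hi
          rw [if_neg (by have := Finset.mem_range.1 hi; omega), zero_smul]
      refine h4.trans (Eq.symm ?_)
      refine Finset.sum_subset (Finset.range_mono (Nat.le_add_right _ _)) fun i _ hi => ?_
      rw [Algebra.smul_def, hM i (by simpa using hi), zero_mul]

lemma coef_slice_zero_frobPull {k : ℕ} {f : D.Fun (k + 1)} (hf : f ∈ D.LinFun (k + 1)) {e : ℕ}
    (he : D.Q = D.q ^ e) (i : ℕ) :
    coef (slice 0 (frobPull f)) i = if e ≤ i then D.φ (coef (slice 0 f) (i - e)) else 0 :=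
  congrFun (hasSer_slice_zero_frobPull hf he).coef_eq i

namespace AdmissibleModule

variable (E : D.AdmissibleModule)

/-! ### The module `N^1` and its jet spaces -/

/-- The endomorphism `a` of `E`, as a function on `Ĝa`. -/
def actFun (a : A) : D.Fun 1 := fun B x => E.act a B (x 0)

lemma actFun_mem (a : A) : E.actFun a ∈ D.LinFun 1 := by
  refine ⟨fun B x y => E.act_add a B _ _, fun c B x => ?_, fun B B' g x => E.act_natural a B B' g _⟩
  change E.act a B (D.scalar c • x 0) = D.scalar c • E.act a B (x 0)
  rw [← scalar_act E, ← mul_act, mul_comm, mul_act, scalar_act]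

lemma coef_actFun_zero (a : A) : coef (E.actFun a) 0 = algebraMap A R a :=
  ((isTangent_iff (E.actFun_mem a) _).1 fun B b hb => E.strict a B b hb).symm

lemma actJ_comp_mem (n : ℕ) (a : A) (s : Fin (n + 1)) :
    (fun B x => E.actJ n a B x s : D.Fun (n + 1)) ∈ D.LinFun (n + 1) := by
  exact ⟨fun B x y => congrFun (E.actJ_add n a B x y) s,
    fun c B x => congrFun (E.actJ_scalar n a c B x) s,
    fun B B' g x => congrFun (E.actJ_map n a B B' g x) s⟩

lemma φ_algebraMap (a : A) : D.φ (algebraMap A R a) = algebraMap A R a := D.φ.commutes a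

lemma φ_iterate_algebraMap (a : A) (s : ℕ) : D.φ^[s] (algebraMap A R a) = algebraMap A R a :=
  Function.iterate_fixed (φ_algebraMap a) s

/-- The derivative at the origin of the action of `a` on `J^nE` is multiplication by `a`. -/
lemma actJ_single (n : ℕ) (a : A) (l : Fin (n + 1)) (B : D.NilpAlg) (b : B) (hb : b * b = 0) :
    E.actJ n a B (Pi.single l b) = Pi.single l (algebraMap A R a • b) := by
  obtain ⟨T, hT⟩ : ∃ T : D.Witt n B, T = (Pi.single l b : Fin (n + 1) → B) := ⟨_, rfl⟩
  have hext : ext T = fun j => if j = (l : ℕ) then b else 0 := by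
    rw [← ext_single l b, hT]
  have hmul : ∀ z : ℕ → B, D.truncSeq n z * T =
      fun s : Fin (n + 1) => if (s : ℕ) = l then D.ghost z l * b else 0 := by
    intro z
    conv_lhs => rw [← D.truncSeq_ext T, ← truncSeq_mulSeq, hext, D.mulSeq_single z l hb]
    rfl
  have hsq : T * T = 0 := by
    conv_lhs => enter [1]; rw [← D.truncSeq_ext T]
    rw [hmul, hext, ghost_single]
    funext s
    rw [mul_assoc, hb, mul_zero, ite_self]
    rfl
  have h : E.act a (D.W n B) T = algebraMap A R a • T := E.strict a (D.W n B) T hsq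
  rw [Algebra.smul_def, witt_algebraMap, hmul, ghost_wcB, φ_iterate_algebraMap] at h
  rw [actJ, ← hT]
  refine h.trans (funext fun s => ?_)
  rw [Pi.single_apply, Algebra.smul_def]
  simp only [Fin.ext_iff]

/-- A character of `J^nE` is determined by its derivative at the origin. -/
lemma X_eq_zero {n : ℕ} {Θ : D.Fun (n + 1)} (hΘ : Θ ∈ E.X n) (h : ∀ s, tan Θ s = 0) : Θ = 0 :=
  eq_zero_of_tan_eq_zero hΘ.1 (fun B x => E.actJ n D.t B x) (E.actJ_comp_mem n D.t)
    (fun l B b hb => E.actJ_single n D.t l B b hb) (fun B x => hΘ.2 D.t B x) h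

lemma actFun_eq_sum (a : A) (B : D.NilpAlg) : ∃ M₀, ∀ M ≥ M₀, ∀ x : B,
    E.act a B x = ∑ i ∈ Finset.range M, coef (E.actFun a) i • x ^ D.q ^ i := by
  obtain ⟨M₀, h⟩ := exists_bound (hasSer_coef (E.actFun_mem a)).null B
  exact ⟨M₀, fun M hM x => (hasSer_coef (E.actFun_mem a)).eval B (fun _ => x) M
    fun i hi => h i (le_trans hM hi)⟩

/-- In the Witt vector coordinates of `N^{n+1}` the action of `a = ∑ a_i τ^i` is that of
`∑ φ(a_i) π ^ (q ^ i - 1) τ^i` on the ring `W_n(B)`. -/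
lemma actN_eq_sum (n : ℕ) (a : A) (B : D.NilpAlg) : ∃ M₀, ∀ M ≥ M₀, ∀ y : D.Witt n B,
    E.actN (n + 1) a B y = (∑ i ∈ Finset.range M,
      (D.φ (coef (E.actFun a) i) * D.π ^ (D.q ^ i - 1)) • y ^ D.q ^ i : D.Witt n B) := by
  obtain ⟨M₀, h⟩ := E.actFun_eq_sum a (D.W (n + 1) B)
  refine ⟨M₀, fun M hM y => ?_⟩
  have h1 : E.actJ (n + 1) a B (Fin.cons 0 y) = versch (∑ i ∈ Finset.range M,
      (D.φ (coef (E.actFun a) i) * D.π ^ (D.q ^ i - 1)) • y ^ D.q ^ i : D.Witt n B) := by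
    refine (h M hM (versch y)).trans ?_
    rw [versch_sum]
    refine Finset.sum_congr rfl fun i _ => ?_
    have e : D.q ^ i = (D.q ^ i - 1) + 1 := by have := D.q_pow_ne_zero i; omega
    rw [mul_smul, ← smul_versch]
    conv_lhs => rw [e]
    refine (congrArg _ (versch_pow y (D.q ^ i - 1))).trans ?_
    rw [← e]
    rfl
  exact congrArg (Fin.tail (α := fun _ => B.carrier)) h1

lemma actN_add (n : ℕ) (a : A) (B : D.NilpAlg) (x y : Fin n → B) :
    E.actN n a B (x + y) = E.actN n a B x + E.actN n a B y := by
  have h := cons_add (0 : B) 0 x y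
  rw [add_zero] at h
  rw [actN, h, actJ_add]
  rfl

lemma add_actN (n : ℕ) (a b : A) (B : D.NilpAlg) (x : Fin n → B) :
    E.actN n (a + b) B x = E.actN n a B x + E.actN n b B x := by
  rw [actN, add_actJ]
  rfl

lemma mul_actN (n : ℕ) (a b : A) (B : D.NilpAlg) (x : Fin n → B) :
    E.actN n (a * b) B x = E.actN n a B (E.actN n b B x) := by
  rw [actN, mul_actJ, ← cons_actN]
  rfl

lemma scalar_actN (n : ℕ) (c : Fq) (B : D.NilpAlg) (x : Fin n → B) :
    E.actN n (algebraMap Fq A c) B x = D.scalar c • x := by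
  rw [actN, scalar_actJ]
  rfl

lemma actN_map (n : ℕ) (a : A) (B B' : D.NilpAlg) (g : B →ₐ[R] B') (x : Fin n → B) :
    E.actN n a B' (fun s => g (x s)) = fun s => g (E.actN n a B x s) := by
  have h := cons_map g (0 : B) x
  rw [map_zero] at h
  rw [actN, h, actJ_map]
  rfl

lemma actN_one_sq_zero (a : A) (B : D.NilpAlg) (b : B) (hb : b * b = 0) :
    E.actN 1 a B (fun _ => b) = fun _ => algebraMap A R a • b := by
  have h : (Fin.cons 0 (fun _ => b) : Fin 2 → B) = Pi.single 1 b := by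
    funext s; fin_cases s <;> rfl
  rw [actN, h, E.actJ_single 1 a 1 B b hb]
  funext s
  fin_cases s
  rfl

/-- The `A`-module scheme `N^1`, an admissible module with coordinate `x_1`. -/
def kernelModule : D.AdmissibleModule where
  act a B y := E.actN 1 a B (fun _ => y) 0
  act_natural a B B' g x := congrFun (E.actN_map 1 a B B' g (fun _ => x)) 0
  act_add a B x y := congrFun (E.actN_add 1 a B (fun _ => x) (fun _ => y)) 0
  add_act a b B x := congrFun (E.add_actN 1 a b B (fun _ => x)) 0
  mul_act a b B x := by
    rw [mul_actN]
    exact congrArg (fun y => E.actN 1 a B y 0) (funext fun s => by rw [Subsingleton.elim s 0])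
  scalar_act c B x := by rw [scalar_actN]; rfl
  strict a B b hb := by rw [E.actN_one_sq_zero a B b hb]

lemma kernelModule_act_eq_sum (a : A) (B : D.NilpAlg) : ∃ M₀, ∀ M ≥ M₀, ∀ y : B,
    E.kernelModule.act a B y = ∑ i ∈ Finset.range M,
      (D.φ (coef (E.actFun a) i) * D.π ^ (D.q ^ i - 1)) • y ^ D.q ^ i := by
  obtain ⟨M₀, h⟩ := E.actN_eq_sum 0 a B
  refine ⟨M₀, fun M hM y => ?_⟩
  obtain ⟨Y, hY⟩ : ∃ Y : D.Witt 0 B, Y = fun _ => y := ⟨_, rfl⟩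
  have hY0 : D.wittHead 0 Y = y := by rw [hY]; rfl
  have h1 := congrArg (D.wittHead 0) (h M hM Y)
  rw [map_sum] at h1
  simp only [map_smul, map_pow, hY0] at h1
  rw [hY] at h1
  exact h1

lemma coef_kernelModule (a : A) (i : ℕ) : coef (E.kernelModule.actFun a) i =
    D.φ (coef (E.actFun a) i) * D.π ^ (D.q ^ i - 1) := by
  have hs : HasSer (E.kernelModule.actFun a)
      (fun i => D.φ (coef (E.actFun a) i) * D.π ^ (D.q ^ i - 1)) := by
    refine ⟨fun N => ?_, fun B x M hM => ?_⟩
    · obtain ⟨M, hM⟩ := (hasSer_coef (E.actFun_mem a)).null N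
      refine ⟨M, fun i hi => Dvd.dvd.mul_right ?_ _⟩
      obtain ⟨y, hy⟩ := hM i hi
      rw [hy, map_mul, map_pow, φ_π]
      exact dvd_mul_right _ _
    · obtain ⟨M₀, h⟩ := E.kernelModule_act_eq_sum a B
      refine (h (max M M₀) (le_max_right _ _) (x 0)).trans (Eq.symm ?_)
      refine Finset.sum_subset (Finset.range_mono (le_max_left _ _)) fun i _ hi => ?_
      rw [Algebra.smul_def, hM i (by simpa using hi), zero_mul]
  exact congrFun hs.coef_eq i

/-- `N^{n+1}E` is the jet space `J^n` of the module `N^1`. -/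
lemma actN_succ (n : ℕ) (a : A) (B : D.NilpAlg) (y : Fin (n + 1) → B) :
    E.actN (n + 1) a B y = E.kernelModule.actJ n a B y := by
  obtain ⟨M₀, h⟩ := E.actN_eq_sum n a B
  obtain ⟨M₁, h'⟩ := E.kernelModule_act_eq_sum a (D.W n B)
  rw [h (max M₀ M₁) (le_max_left _ _) y]
  exact (h' (max M₀ M₁) (le_max_right _ _) y).symm

lemma HomN_succ (n : ℕ) : E.HomN (n + 1) = E.kernelModule.X n := by
  ext Ψ
  refine and_congr Iff.rfl (forall_congr' fun a => forall_congr' fun B => forall_congr' fun y => ?_)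
  rw [actN_succ]

lemma HomN_zero {Ψ : D.Fun 0} (h : Ψ ∈ E.HomN 0) : Ψ = 0 := by
  funext B x
  rw [Subsingleton.elim x 0]
  exact LinFun.apply_zero h.1 B

/-- A character of `N^n` is determined by its derivative at the origin. -/
lemma HomN_eq_zero {n : ℕ} {Ψ : D.Fun n} (hΨ : Ψ ∈ E.HomN n) (h : ∀ s, tan Ψ s = 0) : Ψ = 0 := by
  cases n with
  | zero => exact E.HomN_zero hΨ
  | succ n => exact E.kernelModule.X_eq_zero (by rwa [← HomN_succ]) h

lemma HomN_ext {n : ℕ} {Ψ Ψ' : D.Fun n} (h : Ψ ∈ E.HomN n) (h' : Ψ' ∈ E.HomN n)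
    (e : ∀ s, tan Ψ s = tan Ψ' s) : Ψ = Ψ' :=
  sub_eq_zero.1 (E.HomN_eq_zero (sub_mem h h') fun s => by
    rw [tan_sub h.1 h'.1, e, sub_self])

/-- `φ^*` maps characters of `J^nE` to characters of `J^{n+1}E`. -/
lemma frobPull_mem_X {n : ℕ} {Θ : D.Fun (n + 1)} (hΘ : Θ ∈ E.X n) :
    frobPull Θ ∈ E.X (n + 1) := by
  refine ⟨frobPull_mem hΘ.1, fun a B x => ?_⟩
  have h1 := E.act_natural a _ _ (frobHom n B) x
  have h2 := hΘ.2 a (D.twist B) (D.frob (B := B.carrier) x)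
  refine (congrArg (Θ (D.twist B)) h1.symm).trans (h2.trans ?_)
  refine (D.twist_smul (algebraMap A R a) B (frobPull Θ B x)).trans ?_
  rw [φ_algebraMap]

/-- `𝔣^*` maps characters of `N^n` to characters of `N^{n+1}`. -/
lemma frobPull_mem_HomN {n : ℕ} {Ψ : D.Fun n} (hΨ : Ψ ∈ E.HomN n) :
    frobPull Ψ ∈ E.HomN (n + 1) := by
  cases n with
  | zero =>
    rw [E.HomN_zero hΨ, map_zero]
    exact zero_mem _
  | succ n =>
    rw [HomN_succ] at hΨ ⊢
    exact E.kernelModule.frobPull_mem_X hΨ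

/-! ### The logarithm of `N^1` -/

open Classical in
/-- The coefficients of the logarithm attached to a series `π + ∑ T_i τ^i`: they solve
`(π - π ^ (q ^ i)) b_i = ∑_{j < i} b_j T_{i-j} ^ (q ^ j)` with `b_0 = 1`, where the division is
possible. -/
def logCoef (D : FrobBase Fq A R) (T : ℕ → R) (i : ℕ) : R :=
  if i = 0 then 1 else
    if h : ∃ y, (D.π - D.π ^ D.q ^ i) * y =
      ∑ j : Fin i, logCoef D T j * T (i - j) ^ D.q ^ (j : ℕ) then h.choose else 0
termination_by i
decreasing_by exact j.2

lemma logCoef_zero (T : ℕ → R) : logCoef D T 0 = 1 := by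
  rw [logCoef, if_pos rfl]

lemma logCoef_spec {T : ℕ → R} (hT : ∀ i, i ≠ 0 → D.π ^ (D.q ^ i - 1) ∣ T i) {i : ℕ}
    (hi : i ≠ 0) : (D.π - D.π ^ D.q ^ i) * logCoef D T i =
      ∑ j ∈ Finset.range i, logCoef D T j * T (i - j) ^ D.q ^ j ∧
        D.π ^ (i - 1) ∣ logCoef D T i := by
  have h3 : D.q ^ i = D.q ^ i - 2 + 1 + 1 := by have := D.two_le_q_pow hi; omega
  have h4 : D.π - D.π ^ D.q ^ i = D.π * (1 - D.π ^ (D.q ^ i - 2 + 1)) := by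
    conv_lhs => rw [h3]
    rw [pow_succ]; ring
  have h5 : IsUnit (1 - D.π ^ (D.q ^ i - 2 + 1)) := by
    rw [D.isUnit_iff_not_dvd, dvd_sub_left (dvd_pow_self _ (Nat.succ_ne_zero _))]
    exact fun h => D.π_not_unit (isUnit_of_dvd_one h)
  -- `(q ^ (i - j) - 1) q ^ j ≥ q ^ i - q ^ (i - 1) ≥ i`
  have h6 : D.π ^ i ∣ ∑ j ∈ Finset.range i, logCoef D T j * T (i - j) ^ D.q ^ j := by
    refine Finset.dvd_sum fun j hj => Dvd.dvd.mul_left ?_ _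
    have hj' := Finset.mem_range.1 hj
    have h7 := pow_dvd_pow_of_dvd (hT (i - j) (by omega)) (D.q ^ j)
    rw [← pow_mul] at h7
    refine (pow_dvd_pow _ ?_).trans h7
    have h8 : 2 * D.q ^ (i - 1) ≤ D.q ^ i := by
      conv_rhs => rw [show i = i - 1 + 1 by omega, pow_succ']
      exact Nat.mul_le_mul_right _ D.two_le_q
    have h9 : D.q ^ j ≤ D.q ^ (i - 1) :=
      Nat.pow_le_pow_right (by have := D.two_le_q; omega) (by omega)
    have h10 := D.lt_q_pow (i - 1)
    rw [Nat.sub_mul, ← pow_add, Nat.sub_add_cancel hj'.le, one_mul]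
    omega
  have hex : ∃ y, (D.π - D.π ^ D.q ^ i) * y =
      ∑ j : Fin i, logCoef D T j * T (i - j) ^ D.q ^ (j : ℕ) := by
    rw [Fin.sum_univ_eq_sum_range (fun j => logCoef D T j * T (i - j) ^ D.q ^ j), h4]
    obtain ⟨u, hu⟩ := h5
    obtain ⟨y, hy⟩ := h6
    refine ⟨↑u⁻¹ * (D.π ^ (i - 1) * y), ?_⟩
    rw [hy, ← hu, mul_assoc, Units.mul_inv_cancel_left, ← mul_assoc, ← pow_succ',
      Nat.sub_add_cancel (Nat.pos_of_ne_zero hi)]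
  have e : logCoef D T i = hex.choose := by
    rw [logCoef, if_neg hi, dif_pos hex]
  have e2 := hex.choose_spec
  rw [← e, Fin.sum_univ_eq_sum_range (fun j => logCoef D T j * T (i - j) ^ D.q ^ j)] at e2
  refine ⟨e2, ?_⟩
  rw [← e2, h4, mul_assoc] at h6
  have h7 : D.π ^ i = D.π * D.π ^ (i - 1) := by
    rw [← pow_succ', Nat.sub_add_cancel (Nat.pos_of_ne_zero hi)]
  rw [h7, mul_dvd_mul_iff_left D.π_ne_zero] at h6
  exact (h5.dvd_mul_left).1 h6

lemma tan_one_eq {f : D.Fun 1} : tan f 0 = coef f 0 := by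
  have h : slice 0 f = f := by
    funext B x
    exact congrArg (f B) (funext fun s => by rw [Subsingleton.elim s 0, Pi.single_eq_same])
  rw [tan, h]

/-- The normalised character of `N^1`: the coefficients of the action on `N^1` are divisible by
high powers of `π`, so that its logarithm has integral coefficients tending to zero. -/
lemma exists_isTheta1 : ∃ ϑ, E.IsTheta1 ϑ := by
  obtain ⟨T, hT⟩ : ∃ T, T = coef (E.kernelModule.actFun D.t) := ⟨_, rfl⟩
  have hTd : ∀ i, i ≠ 0 → D.π ^ (D.q ^ i - 1) ∣ T i := fun i _ => by
    rw [hT, coef_kernelModule]; exact dvd_mul_left _ _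
  have hT0 : T 0 = D.π := by rw [hT]; exact E.kernelModule.coef_actFun_zero D.t
  obtain ⟨ϑ, hϑ⟩ := exists_hasSer (c := logCoef D T) fun N => ⟨N + 1, fun i hi =>
    (pow_dvd_pow _ (by omega)).trans (logCoef_spec hTd (by omega)).2⟩
  have hm := E.kernelModule.actFun_mem D.t
  have htan : coef ϑ 0 = 1 := by rw [hϑ.coef_eq, logCoef_zero]
  have hcomm : compFun ϑ (E.kernelModule.actFun D.t) = D.π • ϑ := by
    refine ext_coef (compFun_mem hϑ.mem hm) (Submodule.smul_mem _ _ hϑ.mem) fun i => ?_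
    rw [coef_compFun hϑ.mem hm, coef_smul hϑ.mem, ← hT, hϑ.coef_eq,
      Finset.Nat.sum_antidiagonal_eq_sum_range_succ
        (fun j h => logCoef D T j * T h ^ D.q ^ j), Finset.sum_range_succ, Nat.sub_self, hT0]
    rcases eq_or_ne i 0 with rfl | hi
    · simp [mul_comm]
    · rw [← (logCoef_spec hTd hi).1]; ring
  have hcomm' : ∀ (B : D.NilpAlg) (y : B), ϑ B (fun _ => E.kernelModule.act D.t B y) =
      D.π • ϑ B (fun _ => y) := fun B y => congrFun (congrFun hcomm B) (fun _ => y)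
  refine ⟨ϑ, ⟨hϑ.mem, fun a B y => ?_⟩, (isTangent_iff hϑ.mem _).2 htan.symm⟩
  -- `ϑ ∘ a - a ϑ` commutes with `t` and has derivative zero
  have ha := E.kernelModule.actFun_mem a
  have hmem : compFun ϑ (E.kernelModule.actFun a) - algebraMap A R a • ϑ ∈ D.LinFun 1 :=
    sub_mem (compFun_mem hϑ.mem ha) (Submodule.smul_mem _ _ hϑ.mem)
  have h0 : compFun ϑ (E.kernelModule.actFun a) - algebraMap A R a • ϑ = 0 := by
    refine eq_zero_of_tan_eq_zero hmem
      (fun B x => fun _ => E.kernelModule.act D.t B (x 0)) (fun s => hm)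
      (fun l B b hb => ?_) (fun B x => ?_) (fun s => ?_)
    · funext s
      rw [Subsingleton.elim l 0, Subsingleton.elim s 0, Pi.single_eq_same, Pi.single_eq_same]
      exact E.kernelModule.strict D.t B b hb
    · change ϑ B (fun _ => E.kernelModule.act a B (E.kernelModule.act D.t B (x 0))) -
        algebraMap A R a • ϑ B (fun _ => E.kernelModule.act D.t B (x 0)) =
        D.π • (ϑ B (fun _ => E.kernelModule.act a B (x 0)) - algebraMap A R a • ϑ B x)
      rw [← mul_act, mul_comm a, mul_act, hcomm', hcomm', smul_sub, smul_comm (algebraMap A R a)]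
      congr 4
      exact funext fun s => by rw [Subsingleton.elim s 0]
    · rw [Subsingleton.elim s 0, tan_one_eq,
        coef_sub (compFun_mem hϑ.mem ha) (Submodule.smul_mem _ _ hϑ.mem),
        coef_smul hϑ.mem, coef_compFun hϑ.mem ha]
      simp [coef_actFun_zero, htan]
  have h1 := sub_eq_zero.1 (congrFun (congrFun h0 B) y)
  refine Eq.trans (congrArg (ϑ B) (funext fun s => ?_)) h1
  rw [Subsingleton.elim s 0]
  exact congrArg (fun z => E.actN 1 a B z 0) (funext fun s => by rw [Subsingleton.elim s 0])

lemma IsTheta1.unique {ϑ ϑ' : D.Fun 1} (h : E.IsTheta1 ϑ) (h' : E.IsTheta1 ϑ') : ϑ = ϑ' :=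
  E.HomN_ext h.1 h'.1 fun s => by
    rw [Subsingleton.elim s 0, tan_one_eq, tan_one_eq, ← (isTangent_iff h.1.1 _).1 h.2,
      ← (isTangent_iff h'.1.1 _).1 h'.2]

/-! ### The basis `Ψ_1, …, Ψ_n` of the characters of `N^n` -/

lemma slice_uPull {k k' : ℕ} (h : k ≤ k') {Ψ : D.Fun k} (hΨ : Ψ ∈ D.LinFun k) (s : Fin k') :
    slice s (uPull h Ψ) = if hs : (s : ℕ) < k then slice ⟨s, hs⟩ Ψ else 0 := by
  split_ifs with hs
  · funext B x
    refine congrArg (Ψ B) (funext fun t => ?_)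
    rw [Pi.single_apply, Pi.single_apply]
    simp only [Fin.ext_iff, Fin.val_castLE]
  · funext B x
    refine Eq.trans (congrArg (Ψ B) (funext fun t => ?_)) (LinFun.apply_zero hΨ B)
    refine Pi.single_eq_of_ne (fun h' => hs ?_) _
    rw [← h']
    exact t.2

lemma tan_uPull {k k' : ℕ} (h : k ≤ k') {Ψ : D.Fun k} (hΨ : Ψ ∈ D.LinFun k) (s : Fin k') :
    tan (uPull h Ψ) s = if hs : (s : ℕ) < k then tan Ψ ⟨s, hs⟩ else 0 := by
  rw [tan, slice_uPull h hΨ]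
  split_ifs
  · rfl
  · exact coef_zero 0

lemma tan_iPull {n : ℕ} (Θ : D.Fun (n + 1)) (s : Fin n) : tan (iPull Θ) s = tan Θ s.succ := by
  have h : slice s (iPull Θ) = slice s.succ Θ := by
    funext B x
    refine congrArg (Θ B) (funext fun t => ?_)
    refine Fin.cases ?_ (fun t => ?_) t
    · rw [Fin.cons_zero, Pi.single_eq_of_ne (Fin.succ_ne_zero s).symm]
    · rw [Fin.cons_succ, Pi.single_apply, Pi.single_apply]
      simp only [Fin.succ_inj]
  rw [tan, h]
  rfl

lemma vPull_eq_slice {n : ℕ} (Θ : D.Fun (n + 1)) : vPull Θ = slice 0 Θ := by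
  funext B x
  refine congrArg (Θ B) (funext fun t => ?_)
  refine Fin.cases ?_ (fun t => ?_) t
  · rw [Fin.cons_zero, Pi.single_eq_same]
  · rw [Fin.cons_succ, Pi.single_eq_of_ne (Fin.succ_ne_zero t)]
    rfl

lemma vPull_mem {n : ℕ} {Θ : D.Fun (n + 1)} (h : Θ ∈ D.LinFun (n + 1)) : vPull Θ ∈ D.LinFun 1 := by
  rw [vPull_eq_slice]
  exact slice_mem 0 h

lemma coef_vPull_zero {n : ℕ} (Θ : D.Fun (n + 1)) : coef (vPull Θ) 0 = tan Θ 0 := by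
  rw [vPull_eq_slice]
  rfl

variable {E} {ϑ : D.Fun 1}

lemma frobIter_mem (hϑ : E.IsTheta1 ϑ) (k : ℕ) : frobIter ϑ k ∈ E.HomN (k + 1) := by
  induction k with
  | zero => exact hϑ.1
  | succ k ih => exact E.frobPull_mem_HomN ih

lemma tan_frobIter (hϑ : E.IsTheta1 ϑ) (k : ℕ) (s : Fin (k + 1)) :
    tan (frobIter ϑ k) s = if (s : ℕ) = k then D.π ^ k else 0 := by
  induction k with
  | zero =>
    obtain rfl : s = 0 := Fin.ext (by have := s.2; omega)
    rw [frobIter, tan_one_eq, ← (isTangent_iff hϑ.1.1 _).1 hϑ.2]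
    simp
  | succ k ih =>
    refine Fin.cases ?_ (fun s => ?_) s
    · rw [frobIter, tan_frobPull_zero (frobIter_mem hϑ k).1]
      simp
    · rw [frobIter, tan_frobPull_succ (frobIter_mem hϑ k).1, ih]
      simp only [Fin.val_succ, Nat.add_right_cancel_iff]
      split_ifs
      · rw [map_pow, φ_π, pow_succ']
      · rw [map_zero, mul_zero]

lemma Psi_succ (ϑ : D.Fun 1) {n k : ℕ} (h : k < n) : Psi ϑ n (k + 1) = uPull h (frobIter ϑ k) := by
  rw [Psi, dif_pos (Nat.succ_le_of_lt h)]

lemma uPull_Psi (ϑ : D.Fun 1) {n n' k : ℕ} (hn : n ≤ n') (h : k < n) :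
    uPull hn (Psi ϑ n (k + 1)) = Psi ϑ n' (k + 1) := by
  rw [Psi_succ ϑ h, Psi_succ ϑ (h.trans_le hn)]
  rfl

lemma Psi_mem (hϑ : E.IsTheta1 ϑ) {n k : ℕ} (h : k < n) : Psi ϑ n (k + 1) ∈ E.HomN n := by
  rw [Psi_succ ϑ h]
  exact E.uPull_mem _ (frobIter_mem hϑ k)

lemma tan_Psi (hϑ : E.IsTheta1 ϑ) {n k : ℕ} (h : k < n) (s : Fin n) :
    tan (Psi ϑ n (k + 1)) s = if (s : ℕ) = k then D.π ^ k else 0 := by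
  rw [Psi_succ ϑ h, tan_uPull _ (frobIter_mem hϑ k).1]
  split_ifs with h1 h2 h2
  · rw [tan_frobIter hϑ, if_pos h2]
  · rw [tan_frobIter hϑ, if_neg h2]
  · omega
  · rfl

/-- On the first axis `Ψ_{k+1}` is `x ↦ x ^ (Q ^ k) + …`. -/
lemma coef_slice_zero_frobIter (hϑ : E.IsTheta1 ϑ) {e : ℕ} (he : D.Q = D.q ^ e) (k : ℕ) :
    coef (slice 0 (frobIter ϑ k)) (e * k) = 1 ∧
      ∀ i < e * k, coef (slice 0 (frobIter ϑ k)) i = 0 := by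
  induction k with
  | zero =>
    refine ⟨?_, fun i hi => by omega⟩
    have h := tan_frobIter hϑ 0 0
    rw [if_pos (Fin.val_zero _), pow_zero] at h
    exact h
  | succ k ih =>
    have h := coef_slice_zero_frobPull (frobIter_mem hϑ k).1 he
    refine ⟨?_, fun i hi => ?_⟩
    · rw [frobIter, h, if_pos (by rw [mul_add]; omega), mul_add, mul_one, Nat.add_sub_cancel, ih.1,
        map_one]
    · rw [frobIter, h]
      split_ifs with hi'
      · rw [ih.2 _ (by rw [mul_add] at hi; omega), map_zero]
      · rfl

lemma sum_Psi_mem (hϑ : E.IsTheta1 ϑ) {n : ℕ} (c : ℕ → R) :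
    ∑ k ∈ Finset.range n, c k • Psi ϑ n (k + 1) ∈ E.HomN n :=
  sum_mem fun _ hk => Submodule.smul_mem _ _ (Psi_mem hϑ (Finset.mem_range.1 hk))

lemma tan_sum {k : ℕ} {ι : Type*} (s : Finset ι) (f : ι → D.Fun k)
    (hf : ∀ j ∈ s, f j ∈ D.LinFun k) (l : Fin k) :
    tan (∑ j ∈ s, f j) l = ∑ j ∈ s, tan (f j) l := by
  classical
  induction s using Finset.induction_on with
  | empty => rw [Finset.sum_empty, Finset.sum_empty, tan_zero]
  | insert a s ha ih =>
    rw [Finset.sum_insert ha, Finset.sum_insert ha,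
      tan_add (hf a (Finset.mem_insert_self _ _)) (sum_mem fun j hj =>
        hf j (Finset.mem_insert_of_mem hj)), ih fun j hj => hf j (Finset.mem_insert_of_mem hj)]

lemma tan_sum_Psi (hϑ : E.IsTheta1 ϑ) {n : ℕ} (c : ℕ → R) (s : Fin n) :
    tan (∑ k ∈ Finset.range n, c k • Psi ϑ n (k + 1)) s = c s * D.π ^ (s : ℕ) := by
  rw [tan_sum _ _ fun k hk => Submodule.smul_mem _ _ (Psi_mem hϑ (Finset.mem_range.1 hk)).1,
    Finset.sum_eq_single (s : ℕ)]
  · rw [tan_smul (Psi_mem hϑ s.2).1, tan_Psi hϑ s.2, if_pos rfl]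
  · intro k hk hks
    rw [tan_smul (Psi_mem hϑ (Finset.mem_range.1 hk)).1, tan_Psi hϑ (Finset.mem_range.1 hk),
      if_neg (Ne.symm hks), mul_zero]
  · intro h; exact absurd (Finset.mem_range.2 s.2) h

/-- The restriction to the first axis shows that a combination of the `Ψ_i` is divisible by
`π ^ N` only if its coefficients are. -/
lemma dvd_of_sum_Psi (hϑ : E.IsTheta1 ϑ) {n N : ℕ} (c : ℕ → R) {Ψ : D.Fun n} (hΨ : Ψ ∈ D.LinFun n)
    (h : ∑ k ∈ Finset.range n, c k • Psi ϑ n (k + 1) = D.π ^ N • Ψ) : ∀ k < n, D.π ^ N ∣ c k := by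
  obtain ⟨e, he0, he⟩ := D.exists_Q_eq
  intro k
  induction k using Nat.strong_induction_on with
  | _ k ih =>
    intro hk
    cases n with
    | zero => omega
    | succ n =>
      have hsl : ∀ j < n + 1, slice 0 (Psi ϑ (n + 1) (j + 1)) = slice 0 (frobIter ϑ j) := by
        intro j hj
        rw [Psi_succ ϑ hj, slice_uPull _ (frobIter_mem hϑ j).1, dif_pos (by simp)]
        rfl
      have h1 := congrArg (fun f => coef (slice 0 f) (e * k)) h
      simp only [map_smul] at h1
      rw [coef_smul (slice_mem 0 hΨ), map_sum] at h1
      have h2 : ∑ j ∈ Finset.range (n + 1), slice 0 (c j • Psi ϑ (n + 1) (j + 1)) =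
          ∑ j ∈ Finset.range (n + 1), c j • slice 0 (frobIter ϑ j) := by
        refine Finset.sum_congr rfl fun j hj => ?_
        rw [map_smul, hsl j (Finset.mem_range.1 hj)]
      have hm : ∀ j, slice 0 (frobIter ϑ j) ∈ D.LinFun 1 := fun j =>
        slice_mem 0 (frobIter_mem hϑ j).1
      rw [h2, coef_sum _ _ fun j => Submodule.smul_mem _ _ (hm j),
        ← Finset.add_sum_erase _ _ (Finset.mem_range.2 hk), coef_smul (hm k),
        (coef_slice_zero_frobIter hϑ he k).1, mul_one] at h1
      rw [← dvd_add_left (c := ∑ j ∈ (Finset.range (n + 1)).erase k,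
        coef (c j • slice 0 (frobIter ϑ j)) (e * k)), h1]
      · exact dvd_mul_right _ _
      · refine Finset.dvd_sum fun j hj => ?_
        obtain ⟨hne, hj'⟩ := Finset.mem_erase.1 hj
        have hj' := Finset.mem_range.1 hj'
        rw [coef_smul (hm j)]
        rcases lt_or_gt_of_ne hne with hlt | hgt
        · exact (ih j hlt hj').mul_right _
        · rw [(coef_slice_zero_frobIter hϑ he j).2 _
            (Nat.mul_lt_mul_of_pos_left hgt (Nat.pos_of_ne_zero he0)), mul_zero]
          exact dvd_zero _

/-- The characters `Ψ_1, …, Ψ_n` generate `Hom_A(N^n, Ĝa)`. -/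
lemma exists_eq_sum_Psi (hϑ : E.IsTheta1 ϑ) {n : ℕ} {Ψ : D.Fun n} (hΨ : Ψ ∈ E.HomN n) :
    ∃ c : ℕ → R, Ψ = ∑ k ∈ Finset.range n, c k • Psi ϑ n (k + 1) := by
  have h1 : ∑ k ∈ Finset.range n,
      (if h : k < n then D.π ^ (n - k) * tan Ψ ⟨k, h⟩ else 0) • Psi ϑ n (k + 1) = D.π ^ n • Ψ := by
    refine E.HomN_ext (sum_Psi_mem hϑ _) (Submodule.smul_mem _ _ hΨ) fun s => ?_
    rw [tan_sum_Psi hϑ, tan_smul hΨ.1, dif_pos s.2, mul_right_comm, ← pow_add,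
      Nat.sub_add_cancel s.2.le]
  have h2 := dvd_of_sum_Psi hϑ _ hΨ.1 h1
  choose! c hc using h2
  refine ⟨c, sub_eq_zero.1 (LinFun.eq_zero_of_smul_eq_zero (r := D.π ^ n)
    (sub_mem hΨ (sum_Psi_mem hϑ c)).1 (pow_ne_zero _ D.π_ne_zero) ?_)⟩
  rw [smul_sub, ← h1, Finset.smul_sum, sub_eq_zero]
  refine Finset.sum_congr rfl fun k hk => ?_
  rw [hc k (Finset.mem_range.1 hk), mul_smul]

open Classical in
/-- The coordinates of a character of `N^n` with respect to `Ψ_1, …, Ψ_n`, read off from the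
derivative at the origin. -/
def coord {n : ℕ} (Ψ : D.Fun n) (s : Fin n) : R :=
  if h : ∃ c, tan Ψ s = c * D.π ^ (s : ℕ) then h.choose else 0

lemma coord_eq {n : ℕ} {Ψ : D.Fun n} {s : Fin n} {c : R} (h : tan Ψ s = c * D.π ^ (s : ℕ)) :
    coord Ψ s = c := by
  have h1 : ∃ c, tan Ψ s = c * D.π ^ (s : ℕ) := ⟨c, h⟩
  rw [coord, dif_pos h1]
  exact mul_right_cancel₀ (pow_ne_zero _ D.π_ne_zero) (h1.choose_spec.symm.trans h)

variable (E)

lemma tan_eq_coord {n : ℕ} {Ψ : D.Fun n} (hΨ : Ψ ∈ E.HomN n) (s : Fin n) :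
    tan Ψ s = coord Ψ s * D.π ^ (s : ℕ) := by
  obtain ⟨ϑ, hϑ⟩ := E.exists_isTheta1
  obtain ⟨c, rfl⟩ := exists_eq_sum_Psi hϑ hΨ
  rw [coord_eq (tan_sum_Psi hϑ c s), tan_sum_Psi hϑ]

lemma coord_add {n : ℕ} {Ψ Ψ' : D.Fun n} (hΨ : Ψ ∈ E.HomN n) (hΨ' : Ψ' ∈ E.HomN n) (s : Fin n) :
    coord (Ψ + Ψ') s = coord Ψ s + coord Ψ' s :=
  coord_eq (by rw [tan_add hΨ.1 hΨ'.1, E.tan_eq_coord hΨ, E.tan_eq_coord hΨ', add_mul])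

lemma coord_sub {n : ℕ} {Ψ Ψ' : D.Fun n} (hΨ : Ψ ∈ E.HomN n) (hΨ' : Ψ' ∈ E.HomN n) (s : Fin n) :
    coord (Ψ - Ψ') s = coord Ψ s - coord Ψ' s :=
  coord_eq (by rw [tan_sub hΨ.1 hΨ'.1, E.tan_eq_coord hΨ, E.tan_eq_coord hΨ', sub_mul])

lemma coord_smul {n : ℕ} {Ψ : D.Fun n} (hΨ : Ψ ∈ E.HomN n) (r : R) (s : Fin n) :
    coord (r • Ψ) s = r * coord Ψ s :=
  coord_eq (by rw [tan_smul hΨ.1, E.tan_eq_coord hΨ, mul_assoc])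

lemma coord_uPull {n n' : ℕ} (h : n ≤ n') {Ψ : D.Fun n} (hΨ : Ψ ∈ E.HomN n) (s : Fin n') :
    coord (uPull h Ψ) s = if hs : (s : ℕ) < n then coord Ψ ⟨s, hs⟩ else 0 := by
  refine coord_eq ?_
  rw [tan_uPull h hΨ.1]
  split_ifs with hs
  · exact E.tan_eq_coord hΨ _
  · rw [zero_mul]

/-- `i^*φ^*Θ` and `𝔣^*i^*Θ` differ by a multiple of `Ψ_1`. -/
lemma coord_iPull_frobPull_succ {n : ℕ} {Θ : D.Fun (n + 1)} (hΘ : Θ ∈ E.X n) (s : Fin n) :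
    coord (iPull (frobPull Θ)) s.succ = D.φ (coord (iPull Θ) s) := by
  refine coord_eq ?_
  rw [tan_iPull, tan_frobPull_succ hΘ.1, ← tan_iPull, E.tan_eq_coord (E.iPull_mem hΘ), map_mul,
    map_pow, φ_π, Fin.val_succ, pow_succ]
  ring

variable {E}

lemma coord_sum_Psi (hϑ : E.IsTheta1 ϑ) {n : ℕ} (c : ℕ → R) (s : Fin n) :
    coord (∑ k ∈ Finset.range n, c k • Psi ϑ n (k + 1)) s = c s :=
  coord_eq (tan_sum_Psi hϑ c s)

lemma coord_Psi (hϑ : E.IsTheta1 ϑ) {n k : ℕ} (h : k < n) (s : Fin n) :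
    coord (Psi ϑ n (k + 1)) s = if (s : ℕ) = k then 1 else 0 := by
  refine coord_eq ?_
  rw [tan_Psi hϑ h]
  split_ifs with hs
  · rw [one_mul, hs]
  · rw [zero_mul]

variable (E)

lemma HomN_ext_coord {n : ℕ} {Ψ Ψ' : D.Fun n} (h : Ψ ∈ E.HomN n) (h' : Ψ' ∈ E.HomN n)
    (e : ∀ s, coord Ψ s = coord Ψ' s) : Ψ = Ψ' :=
  E.HomN_ext h h' fun s => by rw [E.tan_eq_coord h, E.tan_eq_coord h', e]

/-- A character of `N^{n+1}` without component along `Ψ_{n+1}` comes from `N^n`. -/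
lemma exists_uPull_of_coord_last {n : ℕ} {Ψ : D.Fun (n + 1)} (hΨ : Ψ ∈ E.HomN (n + 1))
    (h : coord Ψ (Fin.last n) = 0) : ∃ Ψ' ∈ E.HomN n, Ψ = uPull n.le_succ Ψ' := by
  obtain ⟨ϑ, hϑ⟩ := E.exists_isTheta1
  obtain ⟨c, rfl⟩ := exists_eq_sum_Psi hϑ hΨ
  rw [coord_sum_Psi hϑ, Fin.val_last] at h
  refine ⟨_, sum_Psi_mem hϑ (n := n) c, ?_⟩
  rw [Finset.sum_range_succ, h, zero_smul, add_zero, map_sum]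
  refine Finset.sum_congr rfl fun k hk => ?_
  rw [map_smul, uPull_Psi ϑ _ (Finset.mem_range.1 hk)]

/-! ### Drinfeld modules: `t` does not act by zero modulo `π` -/

open Polynomial in
/-- On the affine line over the residue field, a point of the finite `R`-scheme `ker t` is
constant; so the generic point is not in `ker t`, and `t` does not vanish modulo `π`. -/
lemma exists_not_dvd_coef_of_kernelFinite {N : ℕ} (h : E.KernelFiniteOfDegree D.t N) :
    ∃ i, ¬ D.π ∣ coef (E.actFun D.t) i := by
  by_contra! hdvd
  obtain ⟨S, _, _, e, _, -, -, hnat⟩ := h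
  have hact : ∀ x : D.polyAlg 1, E.act D.t (D.polyAlg 1) x = 0 := fun x =>
    (hasSer_coef (E.actFun_mem D.t)).eval (D.polyAlg 1) (fun _ => x) 0 fun i _ =>
      algebraMap_eq_zero_of_dvd (D.polyAlg_nilp 1) ((pow_one D.π).symm ▸ hdvd i)
  haveI hmax : (Ideal.span {D.π ^ 1}).IsMaximal := by
    rw [pow_one]
    have := IsLocalRing.maximalIdeal.isMaximal R
    rwa [← D.span_eq] at this
  haveI := hmax.isPrime
  obtain ⟨x, hx⟩ : ∃ x : (R ⧸ Ideal.span {D.π ^ 1})[X], x = Polynomial.X :=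
    ⟨_, rfl⟩
  obtain ⟨h, hh⟩ := (e (D.polyAlg 1)).surjective ⟨x, hact x⟩
  have hconst : (D.polyEval (D.polyAlg 1) (D.polyAlg_nilp 1) 0).comp h = h := by
    refine AlgHom.ext fun s => ?_
    have hint : IsIntegral R (h s) := (Algebra.IsIntegral.isIntegral s).map h
    obtain ⟨P, hP⟩ : ∃ P : (R ⧸ Ideal.span {D.π ^ 1})[X], P = h s := ⟨h s, rfl⟩
    have hint' : IsIntegral R P := hP ▸ hint
    have hdeg : P.natDegree = 0 := by
      by_contra h0
      exact Polynomial.transcendental _ h0 (mem_nonZeroDivisors_of_ne_zero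
        (Polynomial.leadingCoeff_ne_zero.2 fun hP0 => h0 (hP0 ▸ natDegree_zero))) (hint'.tower_top
        (A := R ⧸ Ideal.span {D.π ^ 1})).isAlgebraic
    obtain ⟨c, hc⟩ := Polynomial.natDegree_eq_zero.1 hdeg
    obtain ⟨r, rfl⟩ := Ideal.Quotient.mk_surjective c
    have h1 : h s = algebraMap R (D.polyAlg 1) r := by rw [← hP, ← hc]; rfl
    rw [AlgHom.comp_apply, h1]
    exact (D.polyEval (D.polyAlg 1) (D.polyAlg_nilp 1) 0).commutes r
  have h1 := hnat _ _ (D.polyEval (D.polyAlg 1) (D.polyAlg_nilp 1) 0) h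
  rw [hconst, hh] at h1
  have h2 : x = 0 := h1.trans ((congrArg _ hx).trans (D.polyEval_X _ _ _))
  exact Polynomial.X_ne_zero (hx.symm.trans h2)

lemma IsDrinfeld.exists_not_dvd_coef {E : D.AdmissibleModule} {C : PuncturedCurve Fq A} {r : ℕ}
    (h : E.IsDrinfeld C r) : ∃ i, ¬ D.π ∣ coef (E.actFun D.t) i := by
  have ht : D.t ≠ 0 := fun h0 => D.t_notMem (h0 ▸ zero_mem _)
  obtain ⟨d, -, hd⟩ := h D.t ht
  exact E.exists_not_dvd_coef_of_kernelFinite hd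

variable {E}

lemma eq_zero_of_compFun_actFun (ht : ∃ i, ¬ D.π ∣ coef (E.actFun D.t) i) {f : D.Fun 1}
    (hf : f ∈ D.LinFun 1) (h : compFun f (E.actFun D.t) = D.π • f) : f = 0 := by
  have key : ∀ N, ∃ g ∈ D.LinFun 1, f = D.π ^ N • g ∧ compFun g (E.actFun D.t) = D.π • g := by
    intro N
    induction N with
    | zero => exact ⟨f, hf, by rw [pow_zero, one_smul], h⟩
    | succ N ih =>
      obtain ⟨g, hg, hfg, hgt⟩ := ih
      have h1 := dvd_coef_of_compFun hg (E.actFun_mem D.t) (fun i => by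
        rw [hgt, coef_smul hg]; exact dvd_mul_right _ _) ht
      obtain ⟨g', hg', rfl⟩ := LinFun.eq_smul_of_dvd hg h1
      refine ⟨g', hg', by rw [hfg, smul_smul, pow_succ], sub_eq_zero.1 ?_⟩
      refine LinFun.eq_zero_of_smul_eq_zero (r := D.π) (sub_mem
        (compFun_mem hg' (E.actFun_mem D.t)) (Submodule.smul_mem _ _ hg')) D.π_ne_zero ?_
      rw [smul_sub, sub_eq_zero]
      exact hgt
  exact LinFun.eq_zero_of_forall_smul fun N =>
    let ⟨g, _, hg, _⟩ := key N
    ⟨g, hg⟩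

lemma X_zero (ht : ∃ i, ¬ D.π ∣ coef (E.actFun D.t) i) : E.X 0 = ⊥ := by
  refine (Submodule.eq_bot_iff _).2 fun Θ hΘ => eq_zero_of_compFun_actFun ht hΘ.1 ?_
  funext B x
  refine Eq.trans (congrArg (Θ B) (funext fun s => ?_)) (hΘ.2 D.t B x)
  rw [Subsingleton.elim s 0, actJ_head]
  rfl

variable (E)

/-! ### Characters of `J^nE` and trivialisations of `E_Ψ^*` -/

/-- The cocycle of the trivial extension, twisted by `α`. -/
def innerDer (α : D.LinFun 1) : E.Der :=
  ⟨fun a => E.compAct a α.1 - algebraMap A R a • α.1, by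
    refine ⟨fun a => sub_mem (compFun_mem α.2 (E.actFun_mem a)) (Submodule.smul_mem _ _ α.2),
      fun a b => ?_, fun c a => ?_, fun a b => ?_, fun a B b hb => ?_⟩
    · have h : E.compAct (a + b) α.1 = E.compAct a α.1 + E.compAct b α.1 := by
        funext B x
        exact (congrArg (α.1 B) (funext fun _ => E.add_act a b B (x 0))).trans (α.2.1 B _ _)
      beta_reduce
      rw [h, map_add, add_smul]
      abel
    · have h : E.compAct (c • a) α.1 = D.scalar c • E.compAct a α.1 := by
        funext B x
        refine (congrArg (α.1 B) (funext fun _ => ?_)).trans (α.2.2.1 c B _)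
        rw [Algebra.smul_def, E.mul_act, E.scalar_act]
        rfl
      beta_reduce
      have h2 : algebraMap A R (c • a) = D.scalar c * algebraMap A R a := by
        rw [Algebra.smul_def, map_mul]
        rfl
      rw [h, h2, mul_smul, smul_sub]
    · have h : E.compAct (a * b) α.1 = E.compAct b (E.compAct a α.1) := by
        funext B x
        exact congrArg (α.1 B) (funext fun _ => E.mul_act a b B (x 0))
      beta_reduce
      rw [h, map_sub, map_smul, map_mul, mul_smul, smul_sub]
      abel
    · have h := (isTangent_iff α.2 _).2 rfl
      have h1 : α.1 B (fun _ => E.act a B b) = coef α.1 0 • algebraMap A R a • b := by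
        rw [E.strict a B b hb]
        exact h B _ (by rw [smul_mul_smul_comm, hb, smul_zero])
      change α.1 B (fun _ => E.act a B b) - algebraMap A R a • α.1 B (fun _ => b) = _
      rw [h1, h B b hb, smul_comm, sub_self, zero_smul]⟩

lemma innerDer_apply (α : D.LinFun 1) (a : A) :
    (E.innerDer α).1 a = E.compAct a α.1 - algebraMap A R a • α.1 := rfl

variable {E}

/-- A cocycle is determined by its value at `t`. -/
lemma Der_eq_zero (ht : ∃ i, ¬ D.π ∣ coef (E.actFun D.t) i) {η : E.Der} (h : η.1 D.t = 0) :
    η = 0 := by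
  refine Subtype.ext (funext fun a => eq_zero_of_compFun_actFun ht (η.2.1 a) ?_)
  have h1 := η.2.2.2.2.1 a D.t
  rw [mul_comm, η.2.2.2.2.1 D.t a, h, map_zero, smul_zero, add_zero, zero_add] at h1
  exact h1.symm

lemma push_eq_innerDer (ht : ∃ i, ¬ D.π ∣ coef (E.actFun D.t) i) {n : ℕ} {Ψ : E.HomN n}
    {α : D.LinFun 1} (h : (E.push n Ψ).1 D.t = (E.innerDer α).1 D.t) :
    E.push n Ψ = E.innerDer α :=
  sub_eq_zero.1 (Der_eq_zero ht (sub_eq_zero.2 h))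

variable (E)

/-- A homomorphism of extensions from `J^nE` to the trivial extension which is `Ψ` on `N^n` is a
character of `J^nE` that extends `Ψ`. -/
lemma exists_mem_X_of_push {n : ℕ} {Ψ : E.HomN n} {α : D.LinFun 1}
    (h : E.push n Ψ = E.innerDer α) : ∃ Θ ∈ E.X n, iPull Θ = Ψ.1 ∧ vPull Θ = -α.1 := by
  have cons_tail : ∀ (B : D.NilpAlg) (x : Fin (n + 1) → B),
      x = (Fin.cons (x 0) 0 + Fin.cons 0 (Fin.tail x) : Fin (n + 1) → B) := by
    intro B x
    rw [← cons_add, add_zero, zero_add, Fin.cons_self_tail]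
  have hact : ∀ (a : A) (B : D.NilpAlg) (x : Fin (n + 1) → B), Fin.tail (E.actJ n a B x) =
      E.jetCocycle n a B (x 0) + E.actN n a B (Fin.tail x) := by
    intro a B x
    conv_lhs => rw [cons_tail B x, actJ_add]
    rfl
  refine ⟨fun B x => Ψ.1 B (Fin.tail x) - α.1 B (fun _ => x 0), ⟨⟨fun B x y => ?_,
    fun c B x => ?_, fun B B' g x => ?_⟩, fun a B x => ?_⟩, ?_, ?_⟩
  · have h1 := Ψ.2.1.1 B (Fin.tail x) (Fin.tail y)
    have h2 := α.2.1 B (fun _ => x 0) (fun _ => y 0)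
    exact (congrArg₂ _ h1 h2).trans (add_sub_add_comm _ _ _ _)
  · have h1 := Ψ.2.1.2.1 c B (Fin.tail x)
    have h2 := α.2.2.1 c B (fun _ => x 0)
    exact (congrArg₂ _ h1 h2).trans (smul_sub _ _ _).symm
  · have h1 := Ψ.2.1.2.2 B B' g (Fin.tail x)
    have h2 := α.2.2.2 B B' g (fun _ => x 0)
    exact (congrArg₂ _ h1 h2).trans (map_sub _ _ _).symm
  · have h1 := congrFun (congrFun (congrArg (fun η : E.Der => η.1 a) h) B) (fun _ => x 0)
    have h2 : Ψ.1 B (E.jetCocycle n a B (x 0)) =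
      α.1 B (fun _ => E.act a B (x 0)) - algebraMap A R a • α.1 B (fun _ => x 0) := h1
    beta_reduce
    rw [hact, Ψ.2.1.1, Ψ.2.2, h2, actJ_head, smul_sub]
    abel
  · funext B y
    change Ψ.1 B y - α.1 B (fun _ => 0) = _
    exact sub_eq_self.2 (LinFun.apply_zero α.2 B)
  · funext B y
    change Ψ.1 B 0 - α.1 B (fun _ => y 0) = - α.1 B y
    rw [LinFun.apply_zero Ψ.2.1, zero_sub]
    exact congrArg (fun z => - α.1 B z) (funext fun s => by rw [Subsingleton.elim s 0])

lemma push_iStar {n : ℕ} (Θ : E.X n) :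
    E.push n (E.iStar n Θ) = E.innerDer (-⟨vPull Θ.1, vPull_mem Θ.2.1⟩) := by
  refine Subtype.ext (funext fun a => ?_)
  funext B x
  have h1 := Θ.2.2 a B (Fin.cons (x 0) 0)
  rw [actJ_teich, Θ.2.1.1] at h1
  change Θ.1 B (Fin.cons 0 (E.jetCocycle n a B (x 0))) =
    -Θ.1 B (Fin.cons (E.act a B (x 0)) 0) - algebraMap A R a • -Θ.1 B (Fin.cons (x 0) 0)
  rw [smul_neg, ← h1]
  abel

variable {E}

/-- `i^*` is injective. -/
lemma X_eq_zero_of_iPull (ht : ∃ i, ¬ D.π ∣ coef (E.actFun D.t) i) {n : ℕ} {Θ : D.Fun (n + 1)}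
    (hΘ : Θ ∈ E.X n) (h : iPull Θ = 0) : Θ = 0 := by
  have h0 : E.iStar n ⟨Θ, hΘ⟩ = 0 := Subtype.ext h
  have h1 := E.push_iStar ⟨Θ, hΘ⟩
  rw [h0, map_zero] at h1
  have h2 := congrArg (fun η : E.Der => η.1 D.t) h1
  have hv : (-⟨vPull Θ, vPull_mem hΘ.1⟩ : D.LinFun 1) = 0 := by
    refine Subtype.ext (eq_zero_of_compFun_actFun ht (Subtype.property _) ?_)
    exact sub_eq_zero.1 h2.symm
  have hv' : vPull Θ = 0 := neg_eq_zero.1 (congrArg Subtype.val hv)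
  refine E.X_eq_zero hΘ fun s => Fin.cases ?_ (fun s => ?_) s
  · rw [← coef_vPull_zero, hv', coef_zero]
  · rw [← tan_iPull, h, tan_zero]

lemma X_ext (ht : ∃ i, ¬ D.π ∣ coef (E.actFun D.t) i) {n : ℕ} {Θ Θ' : D.Fun (n + 1)}
    (hΘ : Θ ∈ E.X n) (hΘ' : Θ' ∈ E.X n) (h : iPull Θ = iPull Θ') : Θ = Θ' :=
  sub_eq_zero.1 (X_eq_zero_of_iPull ht (sub_mem hΘ hΘ') (by rw [map_sub, h, sub_self]))

/-- A character of `J^nE` whose restriction to `N^n` is divisible by `π` is divisible by `π`. -/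
lemma exists_eq_smul_of_dvd_coord (ht : ∃ i, ¬ D.π ∣ coef (E.actFun D.t) i) {n : ℕ}
    {Θ : D.Fun (n + 1)} (hΘ : Θ ∈ E.X n) (h : ∀ s, D.π ∣ coord (iPull Θ) s) :
    ∃ Θ' ∈ E.X n, Θ = D.π • Θ' := by
  obtain ⟨ϑ, hϑ⟩ := E.exists_isTheta1
  obtain ⟨c, hc⟩ := exists_eq_sum_Psi hϑ (E.iPull_mem hΘ)
  have hdvd : ∀ k < n, D.π ∣ c k := fun k hk => by
    have h1 := h ⟨k, hk⟩
    rwa [hc, coord_sum_Psi hϑ] at h1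
  choose! d hd using hdvd
  obtain ⟨Ψ, hΨ⟩ : ∃ Ψ : E.HomN n, iPull Θ = D.π • Ψ.1 := by
    refine ⟨⟨_, sum_Psi_mem hϑ d⟩, ?_⟩
    rw [hc, Finset.smul_sum]
    exact Finset.sum_congr rfl fun k hk => by rw [smul_smul, ← hd k (Finset.mem_range.1 hk)]
  have h1 := congrArg (fun η : E.Der => η.1 D.t) (E.push_iStar ⟨Θ, hΘ⟩)
  have e1 : E.iStar n ⟨Θ, hΘ⟩ = D.π • Ψ := Subtype.ext hΨ
  rw [e1, map_smul] at h1
  obtain ⟨η, hη⟩ : ∃ η, η = E.push n Ψ := ⟨_, rfl⟩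
  rw [← hη] at h1
  have hg := vPull_mem hΘ.1
  have h2 : D.π • η.1 D.t = D.π • vPull Θ - compFun (vPull Θ) (E.actFun D.t) := by
    refine Eq.trans h1 ?_
    change E.compAct D.t (-vPull Θ) - D.π • (-vPull Θ) = _
    rw [map_neg, smul_neg, sub_neg_eq_add, neg_add_eq_sub]
    rfl
  have h3 : ∀ i, D.π ∣ coef (compFun (vPull Θ) (E.actFun D.t)) i := fun i => by
    have e : compFun (vPull Θ) (E.actFun D.t) = D.π • (vPull Θ - η.1 D.t) := by
      rw [smul_sub, h2, sub_sub_cancel]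
    rw [e, coef_smul (sub_mem hg (η.2.1 _))]
    exact dvd_mul_right _ _
  obtain ⟨g, hg', hgΘ⟩ := LinFun.eq_smul_of_dvd hg
    (dvd_coef_of_compFun hg (E.actFun_mem D.t) h3 ht)
  have h4 : η.1 D.t = (E.innerDer (-⟨g, hg'⟩)).1 D.t := by
    refine sub_eq_zero.1 (LinFun.eq_zero_of_smul_eq_zero (r := D.π)
      (sub_mem (η.2.1 _) ((E.innerDer _).2.1 _)) D.π_ne_zero ?_)
    rw [smul_sub, h2, innerDer_apply, hgΘ]
    change D.π • D.π • g - D.π • compFun g (E.actFun D.t) -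
      D.π • (-compFun g (E.actFun D.t) - D.π • -g) = 0
    rw [smul_sub, smul_neg, smul_neg, smul_neg]
    abel
  obtain ⟨Θ', hΘ', e', -⟩ := E.exists_mem_X_of_push (push_eq_innerDer ht (hη ▸ h4))
  exact ⟨Θ', hΘ', X_ext ht hΘ (Submodule.smul_mem _ _ hΘ') (by rw [map_smul, e', hΨ])⟩

lemma exists_not_dvd_coord (ht : ∃ i, ¬ D.π ∣ coef (E.actFun D.t) i) {n : ℕ} (h : E.X n ≠ ⊥) :
    ∃ Θ ∈ E.X n, ∃ s, ¬ D.π ∣ coord (iPull Θ) s := by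
  by_contra! hc
  refine h ((Submodule.eq_bot_iff _).2 fun Θ hΘ => ?_)
  have key : ∀ N, ∃ Θ' ∈ E.X n, Θ = D.π ^ N • Θ' := by
    intro N
    induction N with
    | zero => exact ⟨Θ, hΘ, by rw [pow_zero, one_smul]⟩
    | succ N ih =>
      obtain ⟨Θ', hΘ', e⟩ := ih
      obtain ⟨Θ'', hΘ'', e'⟩ := exists_eq_smul_of_dvd_coord ht hΘ' (hc Θ' hΘ')
      exact ⟨Θ'', hΘ'', by rw [e, e', smul_smul, pow_succ]⟩
  exact LinFun.eq_zero_of_forall_smul fun N =>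
    let ⟨g, _, hg⟩ := key N
    ⟨g, hg⟩

lemma iPull_uPull {n n' : ℕ} (h : n ≤ n') (Θ : D.Fun (n + 1)) :
    iPull (uPull (Nat.succ_le_succ h) Θ) = uPull h (iPull Θ) := by
  funext B y
  exact congrArg (Θ B) (cons_castLE h 0 y).symm

/-- A character of `J^{n+1}E` without component along `Ψ_{n+1}` comes from `J^nE`. -/
lemma exists_uPull_of_coord_iPull_last (ht : ∃ i, ¬ D.π ∣ coef (E.actFun D.t) i) {n : ℕ}
    {Θ : D.Fun (n + 2)} (hΘ : Θ ∈ E.X (n + 1)) (h : coord (iPull Θ) (Fin.last n) = 0) :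
    ∃ Θ' ∈ E.X n, Θ = uPull (Nat.succ_le_succ n.le_succ) Θ' := by
  obtain ⟨Ψ, hΨ, e⟩ := E.exists_uPull_of_coord_last (E.iPull_mem hΘ) h
  have e1 : E.iStar (n + 1) ⟨Θ, hΘ⟩ = E.uStar n.le_succ ⟨Ψ, hΨ⟩ := Subtype.ext e
  have h1 := E.push_iStar ⟨Θ, hΘ⟩
  rw [e1, push_uStar] at h1
  obtain ⟨Θ', hΘ', e', -⟩ := E.exists_mem_X_of_push h1
  refine ⟨Θ', hΘ', X_ext ht hΘ (E.uPull_mem_X n.le_succ hΘ') ?_⟩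
  rw [e, iPull_uPull n.le_succ, e']

end AdmissibleModule

/-! ### Division by an `Fq`-linear function that does not vanish modulo `π` -/

/-- The function `x ↦ x ^ (q ^ i)` on `Ĝa`. -/
def qPow (D : FrobBase Fq A R) (i : ℕ) : D.Fun 1 := fun _ x => x 0 ^ D.q ^ i

lemma hasSer_smul_qPow (r : R) (i : ℕ) : HasSer (r • qPow D i) (Pi.single i r) := by
  refine ⟨fun N => ⟨i + 1, fun j hj => ?_⟩, fun B x M hM => ?_⟩
  · rw [Pi.single_eq_of_ne (by omega)]
    exact dvd_zero _
  · change r • x 0 ^ D.q ^ i = _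
    rw [Finset.sum_eq_single i]
    · rw [Pi.single_eq_same]
    · intro j _ hj
      rw [Pi.single_eq_of_ne hj, zero_smul]
    · intro h
      rw [Finset.mem_range, not_lt] at h
      rw [Algebra.smul_def, hM i h, zero_mul]

lemma smul_qPow_mem (r : R) (i : ℕ) : r • qPow D i ∈ D.LinFun 1 := (hasSer_smul_qPow r i).mem

lemma coef_smul_qPow (r : R) (i j : ℕ) : coef (r • qPow D i) j = if j = i then r else 0 := by
  rw [(hasSer_smul_qPow r i).coef_eq, Pi.single_apply]

lemma coef_compFun_smul_qPow (r : R) {g : D.Fun 1} (hg : g ∈ D.LinFun 1) {k i : ℕ} (h : k ≤ i) :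
    coef (compFun (r • qPow D k) g) i = r * coef g (i - k) ^ D.q ^ k := by
  rw [coef_compFun (smul_qPow_mem r k) hg, Finset.sum_eq_single (k, i - k)]
  · rw [coef_smul_qPow, if_pos rfl]
  · rintro ⟨a, b⟩ hab hne
    rw [Finset.HasAntidiagonal.mem_antidiagonal] at hab
    rw [coef_smul_qPow, if_neg, zero_mul]
    rintro rfl
    simp only at hab
    exact hne (by rw [← hab, Nat.add_sub_cancel_left])
  · intro hn
    exact absurd (Finset.HasAntidiagonal.mem_antidiagonal.2 (Nat.add_sub_cancel' h)) hn

lemma compFun_add_left (f f' g : D.Fun 1) : compFun (f + f') g = compFun f g + compFun f' g := rfl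

/-- Right division with remainder by `g`, modulo `π`. -/
lemma exists_division_mod_π {g : D.Fun 1} (hg : g ∈ D.LinFun 1) {h : ℕ} (hu : ¬ D.π ∣ coef g h)
    (hlt : ∀ i, h < i → D.π ∣ coef g i) (f : D.LinFun 1) :
    ∃ (r : ℕ → R) (α f' : D.LinFun 1), f.1 = ∑ i ∈ Finset.range h, r i • qPow D i +
      (compFun α.1 g - D.π • α.1) + D.π • f'.1 := by
  have key : ∀ (d : ℕ) (f : D.LinFun 1), (∀ i, h + d ≤ i → D.π ∣ coef f.1 i) →
      ∃ (r : ℕ → R) (α f' : D.LinFun 1), f.1 = ∑ i ∈ Finset.range h, r i • qPow D i +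
        (compFun α.1 g - D.π • α.1) + D.π • f'.1 := by
    intro d
    induction d with
    | zero =>
      intro f hf
      have hmem : ∑ i ∈ Finset.range h, coef f.1 i • qPow D i ∈ D.LinFun 1 :=
        sum_mem fun i _ => smul_qPow_mem _ _
      obtain ⟨f', hf', e⟩ := LinFun.eq_smul_of_dvd (sub_mem f.2 hmem) fun j => by
        rw [coef_sub f.2 hmem, coef_sum _ _ fun i => smul_qPow_mem _ _]
        simp only [coef_smul_qPow, Finset.sum_ite_eq, Finset.mem_range]
        split_ifs with hj
        · rw [sub_self]; exact dvd_zero _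
        · rw [sub_zero]; exact hf j (by omega)
      refine ⟨coef f.1, 0, ⟨f', hf'⟩, ?_⟩
      have h0 : compFun (0 : D.LinFun 1).1 g = 0 := rfl
      rw [h0, ← e, Submodule.coe_zero, smul_zero, sub_zero, add_zero, add_sub_cancel]
    | succ d ih =>
      intro f hf
      obtain ⟨c, hc⟩ : ∃ c, c * coef g h ^ D.q ^ d = coef f.1 (h + d) := by
        obtain ⟨v, hv⟩ := ((D.isUnit_iff_not_dvd.2 hu).pow (D.q ^ d)).exists_left_inv
        exact ⟨coef f.1 (h + d) * v, by rw [mul_assoc, hv, mul_one]⟩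
      have hcomp : compFun (c • qPow D d) g ∈ D.LinFun 1 := compFun_mem (smul_qPow_mem _ _) hg
      obtain ⟨r, α, f', e⟩ := ih ⟨f.1 - compFun (c • qPow D d) g, sub_mem f.2 hcomp⟩ fun i hi => by
        change D.π ∣ coef (f.1 - compFun (c • qPow D d) g) i
        rw [coef_sub f.2 hcomp, coef_compFun_smul_qPow c hg (by omega)]
        rcases Nat.eq_or_lt_of_le hi with rfl | hi'
        · rw [Nat.add_sub_cancel, hc, sub_self]; exact dvd_zero _
        · exact dvd_sub (hf i (by omega)) (((hlt (i - d) (by omega)).trans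
            (dvd_pow_self _ (D.q_pow_ne_zero _))).mul_left _)
      refine ⟨r, α + ⟨_, smul_qPow_mem c d⟩, f' + ⟨_, smul_qPow_mem c d⟩, ?_⟩
      rw [sub_eq_iff_eq_add.1 e, Submodule.coe_add, Submodule.coe_add, compFun_add_left, smul_add,
        smul_add]
      abel
  obtain ⟨M, hM⟩ := (hasSer_coef f.2).null 1
  exact key M f fun i hi => (pow_one D.π) ▸ hM i (by omega)

/-- The series `∑ π ^ k a_k` converges in `R`. -/
lemma exists_tsum_π (a : ℕ → R) :
    ∃ r : R, ∀ N, D.π ^ N ∣ r - ∑ k ∈ Finset.range N, D.π ^ k * a k := by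
  haveI := D.complete
  obtain ⟨r, hr⟩ := IsPrecomplete.prec (I := IsLocalRing.maximalIdeal R) inferInstance
    (f := fun N => ∑ k ∈ Finset.range N, D.π ^ k * a k) (fun {m n} hmn => by
      rw [D.smodEq_iff, ← dvd_neg, neg_sub, ← Finset.sum_Ico_eq_sub _ hmn]
      exact Finset.dvd_sum fun k hk =>
        (pow_dvd_pow _ (Finset.mem_Ico.1 hk).1).mul_right _)
  refine ⟨r, fun N => ?_⟩
  rw [← dvd_neg, neg_sub, ← D.smodEq_iff]
  exact hr N

/-- The series `∑ π ^ k a_k` of `Fq`-linear functions converges: it is a finite sum on every test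
algebra. -/
lemma exists_tsum_π_fun (a : ℕ → D.LinFun 1) : ∃ f : D.LinFun 1,
    ∀ (N : ℕ) (B : D.NilpAlg) (x : Fin 1 → B), algebraMap R B D.π ^ N = 0 →
      f.1 B x = ∑ k ∈ Finset.range N, D.π ^ k • (a k).1 B x := by
  obtain ⟨f, hf⟩ : ∃ f : D.Fun 1, ∀ (N : ℕ) (B : D.NilpAlg) (x : Fin 1 → B),
      algebraMap R B D.π ^ N = 0 → f B x = ∑ k ∈ Finset.range N, D.π ^ k • (a k).1 B x := by
    refine ⟨fun B x => ∑ᶠ k, D.π ^ k • (a k).1 B x, fun N B x hN => ?_⟩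
    refine finsum_eq_sum_of_support_subset _ fun k hk => ?_
    rw [Finset.coe_range, Set.mem_Iio]
    by_contra h
    refine hk ?_
    beta_reduce
    rw [Algebra.smul_def, map_pow, pow_eq_zero_of_le (not_lt.1 h) hN, zero_mul]
  refine ⟨⟨f, fun B x y => ?_, fun c B x => ?_, fun B B' g x => ?_⟩, hf⟩ <;>
  obtain ⟨N, hN⟩ := B.nilp
  · rw [hf N B _ hN, hf N B _ hN, hf N B _ hN, ← Finset.sum_add_distrib]
    exact Finset.sum_congr rfl fun k _ => by rw [(a k).2.1, smul_add]
  · rw [hf N B _ hN, hf N B _ hN, Finset.smul_sum]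
    exact Finset.sum_congr rfl fun k _ => by rw [(a k).2.2.1, smul_comm]
  · rw [hf N B _ hN, hf N B' _ (by rw [← g.commutes, ← map_pow, hN, map_zero]), map_sum]
    exact Finset.sum_congr rfl fun k _ => by rw [(a k).2.2.2, map_smul]

/-- Right division with remainder by `g - π`, obtained from the division modulo `π` by successive
approximation. -/
lemma exists_division {g : D.Fun 1} (hg : g ∈ D.LinFun 1) {h : ℕ} (hu : ¬ D.π ∣ coef g h)
    (hlt : ∀ i, h < i → D.π ∣ coef g i) (f : D.LinFun 1) :
    ∃ (r : ℕ → R) (α : D.LinFun 1), f.1 = ∑ i ∈ Finset.range h, r i • qPow D i +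
      (compFun α.1 g - D.π • α.1) := by
  choose r α f' hf' using exists_division_mod_π hg hu hlt
  choose s hs using fun i => exists_tsum_π (D := D) fun k => r (f'^[k] f) i
  obtain ⟨β, hβ⟩ := exists_tsum_π_fun fun k => α (f'^[k] f)
  refine ⟨s, β, ?_⟩
  funext B x
  obtain ⟨N, hN⟩ := B.nilp
  have key : ∀ M, f.1 B x = ∑ i ∈ Finset.range h,
      (∑ k ∈ Finset.range M, D.π ^ k * r (f'^[k] f) i) • x 0 ^ D.q ^ i +
      (∑ k ∈ Finset.range M, D.π ^ k • (α (f'^[k] f)).1 B (fun _ => g B x) -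
        D.π • ∑ k ∈ Finset.range M, D.π ^ k • (α (f'^[k] f)).1 B x) +
      D.π ^ M • (f'^[M] f).1 B x := by
    intro M
    induction M with
    | zero => simp
    | succ M ih =>
      have e := congrFun (congrFun (hf' (f'^[M] f)) B) x
      have e' : (f'^[M] f).1 B x = ∑ i ∈ Finset.range h, r (f'^[M] f) i • x 0 ^ D.q ^ i +
          ((α (f'^[M] f)).1 B (fun _ => g B x) - D.π • (α (f'^[M] f)).1 B x) +
          D.π • (f' (f'^[M] f)).1 B x := by
        refine e.trans (congrArg₂ _ (congrArg₂ _ ?_ rfl) rfl)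
        rw [Finset.sum_apply, Finset.sum_apply]
        rfl
      rw [ih, e', Function.iterate_succ_apply']
      simp only [Finset.sum_range_succ, add_smul, Finset.sum_add_distrib, smul_add, smul_sub,
        Finset.smul_sum, smul_smul, pow_succ]
      rw [mul_comm D.π (D.π ^ M)]
      abel
  rw [key N]
  change _ = (∑ i ∈ Finset.range h, s i • qPow D i : D.Fun 1) B x +
    (β.1 B (fun _ => g B x) - D.π • β.1 B x)
  rw [hβ N B _ hN, hβ N B _ hN, Algebra.smul_def (D.π ^ N), map_pow, hN, zero_mul, add_zero,
    Finset.sum_apply, Finset.sum_apply]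
  congr 1
  refine Finset.sum_congr rfl fun i _ => ?_
  refine sub_eq_zero.1 (?_ : _ - s i • x 0 ^ D.q ^ i = 0)
  rw [← sub_smul, ← neg_sub, neg_smul, Algebra.smul_def, algebraMap_eq_zero_of_dvd hN (hs i N),
    zero_mul, neg_zero]

namespace AdmissibleModule

variable (E : D.AdmissibleModule)

/-! ### Characters with leading coefficient `1` -/

/-- `α ↦ α ∘ t - π α`, the value at `t` of the inner cocycle of `α`. -/
def innerAt : D.LinFun 1 →ₗ[R] D.LinFun 1 where
  toFun α := ⟨(E.innerDer α).1 D.t, (E.innerDer α).2.1 D.t⟩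
  map_add' α β := Subtype.ext (by
    change E.compAct D.t (α.1 + β.1) - D.π • (α.1 + β.1) =
      (E.compAct D.t α.1 - D.π • α.1) + (E.compAct D.t β.1 - D.π • β.1)
    rw [map_add, smul_add, add_sub_add_comm])
  map_smul' r α := Subtype.ext (by
    change E.compAct D.t (r • α.1) - D.π • (r • α.1) = r • (E.compAct D.t α.1 - D.π • α.1)
    rw [map_smul, smul_sub, smul_comm D.π])

/-- `Ψ ↦ E_Ψ^*`, in terms of the value at `t` of the cocycle. -/
def pushAt (n : ℕ) : E.HomN n →ₗ[R] D.LinFun 1 where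
  toFun Ψ := ⟨(E.push n Ψ).1 D.t, (E.push n Ψ).2.1 D.t⟩
  map_add' _ _ := rfl
  map_smul' _ _ := rfl

variable {E}

lemma finite_quotient_range_innerAt (ht : ∃ i, ¬ D.π ∣ coef (E.actFun D.t) i) :
    Module.Finite R (D.LinFun 1 ⧸ LinearMap.range E.innerAt) := by
  classical
  have hmem := E.actFun_mem D.t
  obtain ⟨M, hM⟩ := (hasSer_coef hmem).null 1
  obtain ⟨i, hi⟩ := ht
  have hbd : ∀ j, ¬ D.π ∣ coef (E.actFun D.t) j → j ≤ M := fun j hj => by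
    by_contra hlt
    exact hj (pow_one D.π ▸ hM j (by omega))
  have hu := Nat.findGreatest_spec (P := fun j => ¬ D.π ∣ coef (E.actFun D.t) j) (hbd i hi) hi
  have hlt : ∀ j, Nat.findGreatest (fun j => ¬ D.π ∣ coef (E.actFun D.t) j) M < j →
      D.π ∣ coef (E.actFun D.t) j := fun j hj => by
    by_contra hc
    exact hc (not_not.1 (Nat.findGreatest_is_greatest hj (hbd j hc)))
  obtain ⟨h, hh⟩ : ∃ h, h = Nat.findGreatest (fun j => ¬ D.π ∣ coef (E.actFun D.t) j) M := ⟨_, rfl⟩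
  rw [← hh] at hu hlt
  have hq : ∀ i, qPow D i ∈ D.LinFun 1 := fun i => one_smul R (qPow D i) ▸ smul_qPow_mem 1 i
  refine Module.Finite.of_surjective ((LinearMap.range E.innerAt).mkQ ∘ₗ
    Fintype.linearCombination R (fun i : Fin h => (⟨qPow D i, hq i⟩ : D.LinFun 1))) fun y => ?_
  obtain ⟨f, rfl⟩ := Submodule.mkQ_surjective _ y
  obtain ⟨r, α, e⟩ := exists_division hmem hu hlt f
  refine ⟨fun i => r i, ?_⟩
  rw [LinearMap.comp_apply, ← sub_eq_zero, ← map_sub, Submodule.mkQ_apply,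
    Submodule.Quotient.mk_eq_zero]
  refine ⟨-α, Subtype.ext ?_⟩
  rw [map_neg, Fintype.linearCombination_apply]
  change -(compFun α.1 (E.actFun D.t) - D.π • α.1) = _
  rw [Submodule.coe_sub, Submodule.coe_sum, e,
    ← Fin.sum_univ_eq_sum_range (fun i => r i • qPow D i), ← sub_sub, eq_comm, sub_eq_neg_self,
    sub_eq_zero]
  rfl

variable (E)

/-- There is a character of order `n + 1` whose restriction to `N^{n+1}` has leading term
`Ψ_{n+1}`. -/
def HasMonic (n : ℕ) : Prop := ∃ Θ ∈ E.X (n + 1), coord (iPull Θ) (Fin.last n) = 1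

variable {E}

/-- As `Ext(E, Ĝa)` is finitely generated, the classes of the `E_{Ψ_i}^*` satisfy relations with
leading coefficient `1`. -/
lemma exists_hasMonic (ht : ∃ i, ¬ D.π ∣ coef (E.actFun D.t) i) :
    ∃ N, ∀ n, N ≤ n → E.HasMonic n := by
  haveI := finite_quotient_range_innerAt ht
  have hmono : Monotone fun n =>
      LinearMap.range ((LinearMap.range E.innerAt).mkQ ∘ₗ E.pushAt n) := by
    rintro n n' h _ ⟨Ψ, rfl⟩
    exact ⟨E.uStar h Ψ, congrArg (LinearMap.range E.innerAt).mkQ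
      (Subtype.ext (congrArg (fun η : E.Der => η.1 D.t) (E.push_uStar h Ψ)))⟩
  obtain ⟨N, hN⟩ := (monotone_stabilizes_iff_noetherian (R := R)
    (M := D.LinFun 1 ⧸ LinearMap.range E.innerAt)).2 inferInstance ⟨_, hmono⟩
  refine ⟨N, fun n hn => ?_⟩
  obtain ⟨ϑ, hϑ⟩ := E.exists_isTheta1
  have hrange : LinearMap.range ((LinearMap.range E.innerAt).mkQ ∘ₗ E.pushAt n) =
      LinearMap.range ((LinearMap.range E.innerAt).mkQ ∘ₗ E.pushAt (n + 1)) :=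
    (hN n hn).symm.trans (hN (n + 1) (by omega))
  have hPsi := Psi_mem hϑ n.lt_succ_self
  have h1 : ((LinearMap.range E.innerAt).mkQ ∘ₗ E.pushAt (n + 1)) ⟨_, hPsi⟩ ∈
      LinearMap.range ((LinearMap.range E.innerAt).mkQ ∘ₗ E.pushAt n) := hrange ▸ ⟨_, rfl⟩
  obtain ⟨Ψ, hΨ⟩ := h1
  have e : E.pushAt n Ψ = E.pushAt (n + 1) (E.uStar n.le_succ Ψ) :=
    Subtype.ext (congrArg (fun η : E.Der => η.1 D.t) (E.push_uStar n.le_succ Ψ)).symm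
  rw [LinearMap.comp_apply, LinearMap.comp_apply, e, eq_comm, ← sub_eq_zero, ← map_sub, ← map_sub,
    Submodule.mkQ_apply, Submodule.Quotient.mk_eq_zero] at hΨ
  obtain ⟨α, hα⟩ := hΨ
  obtain ⟨Θ, hΘ, e', -⟩ := E.exists_mem_X_of_push
    (Ψ := (⟨_, hPsi⟩ : E.HomN (n + 1)) - E.uStar n.le_succ Ψ)
    (push_eq_innerDer (α := α) ht (congrArg Subtype.val hα).symm)
  refine ⟨Θ, hΘ, ?_⟩
  rw [e']
  change coord (Psi ϑ (n + 1) (n + 1) - uPull n.le_succ Ψ.1) (Fin.last n) = 1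
  rw [E.coord_sub hPsi (E.uPull_mem _ Ψ.2), coord_Psi hϑ n.lt_succ_self, E.coord_uPull _ Ψ.2,
    if_pos (Fin.val_last n), dif_neg (by simp), sub_zero]

/-- Let `w` be the last index at which the restriction of some character of order `n + 1` has a
unit coordinate.  If `w` were not the leading index, `φ^*` would move that unit coordinate to
`w + 1`, and subtracting a multiple of a monic character of order `n + 2` would bring the result
back to order `n + 1`. -/
lemma HasMonic.of_succ (ht : ∃ i, ¬ D.π ∣ coef (E.actFun D.t) i) {n : ℕ} (h : E.HasMonic (n + 1))
    (hX : E.X (n + 1) ≠ ⊥) : E.HasMonic n := by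
  classical
  obtain ⟨Θ₀, hΘ₀, s₀, hs₀⟩ := exists_not_dvd_coord ht hX
  obtain ⟨w, hw, hmax⟩ := Finset.exists_max_image (Finset.univ.filter fun s : Fin (n + 1) =>
    ∃ Θ ∈ E.X (n + 1), ¬ D.π ∣ coord (iPull Θ) s) id
    ⟨s₀, Finset.mem_filter.2 ⟨Finset.mem_univ _, Θ₀, hΘ₀, hs₀⟩⟩
  have hmax' : ∀ s, w < s → ∀ Θ ∈ E.X (n + 1), D.π ∣ coord (iPull Θ) s := by
    intro s hs Θ hΘ
    by_contra hc
    exact absurd (hmax s (Finset.mem_filter.2 ⟨Finset.mem_univ _, Θ, hΘ, hc⟩)) (not_le.2 hs)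
  obtain ⟨Θ, hΘ, hΘw⟩ := (Finset.mem_filter.1 hw).2
  rcases Fin.eq_castSucc_or_eq_last w with ⟨w', rfl⟩ | rfl
  · exfalso
    obtain ⟨Θ₁, hΘ₁, h1⟩ := h
    have hF := E.frobPull_mem_X hΘ
    have hS := Submodule.smul_mem _ (D.φ (coord (iPull Θ) (Fin.last n))) hΘ₁
    have hcoord : ∀ s : Fin (n + 1), coord (iPull (frobPull Θ -
        D.φ (coord (iPull Θ) (Fin.last n)) • Θ₁)) s.succ = D.φ (coord (iPull Θ) s) -
        D.φ (coord (iPull Θ) (Fin.last n)) * coord (iPull Θ₁) s.succ := by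
      intro s
      rw [map_sub, E.coord_sub (E.iPull_mem hF) (E.iPull_mem hS), map_smul,
        E.coord_smul (E.iPull_mem hΘ₁), E.coord_iPull_frobPull_succ hΘ]
    obtain ⟨Θ₂, hΘ₂, e⟩ := exists_uPull_of_coord_iPull_last ht (sub_mem hF hS) (by
      rw [← Fin.succ_last, hcoord, Fin.succ_last, h1, mul_one, sub_self])
    have h2 := hcoord w'.castSucc
    rw [e, iPull_uPull (n + 1).le_succ, E.coord_uPull _ (E.iPull_mem hΘ₂),
      dif_pos (by simp)] at h2
    have h3 := hmax' ⟨(w'.castSucc.succ : Fin (n + 2)), by simp⟩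
      (by simp [Fin.lt_def]) Θ₂ hΘ₂
    rw [h2, dvd_sub_left, D.dvd_φ_iff] at h3
    · exact hΘw h3
    · exact (D.dvd_φ_iff.2 (hmax' _ (Fin.castSucc_lt_last w') Θ hΘ)).mul_right _
  · obtain ⟨c, hc⟩ := (D.isUnit_iff_not_dvd.2 hΘw).exists_left_inv
    exact ⟨c • Θ, Submodule.smul_mem _ _ hΘ, by rw [map_smul, E.coord_smul (E.iPull_mem hΘ), hc]⟩

lemma uPull_injective {k k' : ℕ} (h : k ≤ k') : Function.Injective (uPull (D := D) h) := by
  intro f g e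
  funext B x
  have h1 := congrFun (congrFun e B) (fun s => ext x s)
  have h2 : (fun s : Fin k => ext x (Fin.castLE h s : Fin k')) = x := funext fun s => ext_apply x s
  change f B (fun s : Fin k => ext x (Fin.castLE h s : Fin k')) = g B _ at h1
  rwa [h2] at h1

lemma X_ne_bot {m n : ℕ} (h : m ≤ n) (hm : E.X m ≠ ⊥) : E.X n ≠ ⊥ := by
  obtain ⟨Θ, hΘ, h0⟩ := Submodule.exists_mem_ne_zero_of_ne_bot hm
  refine (Submodule.ne_bot_iff _).2 ⟨_, E.uPull_mem_X h hΘ, fun h1 => h0 ?_⟩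
  exact uPull_injective _ (h1.trans (map_zero _).symm)

lemma hasMonic (ht : ∃ i, ¬ D.π ∣ coef (E.actFun D.t) i) {m n : ℕ} (hm : E.X m ≠ ⊥)
    (h : m ≤ n + 1) : E.HasMonic n := by
  obtain ⟨N, hN⟩ := exists_hasMonic ht
  have key : ∀ k n, m ≤ n + 1 → E.HasMonic (n + k) → E.HasMonic n := by
    intro k
    induction k with
    | zero => intro n _ h; exact h
    | succ k ih =>
      intro n hn h
      exact ih n hn (HasMonic.of_succ ht h (X_ne_bot (by omega) hm))
  exact key N n h (hN _ (by omega))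

variable (E)

/-! ### The denominators of `H(E)` -/

lemma frobPull_uPull {k k' : ℕ} (h : k ≤ k') (Ψ : D.Fun k) :
    frobPull (uPull h Ψ) = uPull (Nat.succ_le_succ h) (frobPull Ψ) := by
  funext B x
  exact congrArg (Ψ (D.twist B)) (frob_castLE (B := B.carrier) h x).symm

/-- `𝔣^*i^*Θ = i^*φ^*Θ` for a character `Θ` whose derivative along `E` vanishes. -/
lemma frobPull_iPull {n : ℕ} {Θ : D.Fun (n + 1)} (hΘ : Θ ∈ E.X n) (h0 : tan Θ 0 = 0) :
    frobPull (iPull Θ) = iPull (frobPull Θ) := by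
  refine E.HomN_ext (E.frobPull_mem_HomN (E.iPull_mem hΘ)) (E.iPull_mem (E.frobPull_mem_X hΘ))
    fun s => ?_
  rw [tan_iPull, tan_frobPull_succ hΘ.1]
  refine Fin.cases ?_ (fun s => ?_) s
  · rw [tan_frobPull_zero (E.iPull_mem hΘ).1, h0, map_zero, mul_zero]
  · rw [tan_frobPull_succ (E.iPull_mem hΘ).1, tan_iPull]

lemma iPull_frobPull_mem_den {n : ℕ} {Θ : D.Fun (n + 1)} (hΘ : Θ ∈ E.X n) :
    iPull (frobPull Θ) ∈ E.den (n + 1) := Submodule.subset_span ⟨Θ, hΘ, rfl⟩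

variable {E}

lemma exists_of_mem_den {n : ℕ} {Ψ : D.Fun n} (h : Ψ ∈ E.den n) :
    ∃ Θ ∈ E.X n, iPull Θ = Ψ ∧ tan Θ 0 = 0 := by
  cases n with
  | zero =>
    obtain rfl : Ψ = 0 := h
    exact ⟨0, zero_mem _, map_zero _, tan_zero _⟩
  | succ n =>
    induction h using Submodule.span_induction with
    | mem Ψ h =>
      obtain ⟨Θ, hΘ, rfl⟩ := h
      exact ⟨_, E.frobPull_mem_X hΘ, rfl, tan_frobPull_zero hΘ.1⟩
    | zero => exact ⟨0, zero_mem _, map_zero _, tan_zero _⟩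
    | add x y _ _ hx hy =>
      obtain ⟨Θ, hΘ, rfl, h1⟩ := hx
      obtain ⟨Θ', hΘ', rfl, h2⟩ := hy
      exact ⟨_, add_mem hΘ hΘ', map_add _ _ _, by rw [tan_add hΘ.1 hΘ'.1, h1, h2, add_zero]⟩
    | smul r x _ hx =>
      obtain ⟨Θ, hΘ, rfl, h1⟩ := hx
      exact ⟨_, Submodule.smul_mem _ r hΘ, map_smul _ _ _, by rw [tan_smul hΘ.1, h1, mul_zero]⟩

lemma frobPull_mem_den {n : ℕ} {Ψ : D.Fun n} (h : Ψ ∈ E.den n) :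
    frobPull Ψ ∈ E.den (n + 1) := by
  obtain ⟨Θ, hΘ, rfl, h0⟩ := exists_of_mem_den h
  rw [E.frobPull_iPull hΘ h0]
  exact E.iPull_frobPull_mem_den hΘ

/-- A monic `Θ` in `X_{n+1}(E)` and the characters of lower order span `X_{n+1}(E)`. -/
lemma exists_eq_smul_add_uPull (ht : ∃ i, ¬ D.π ∣ coef (E.actFun D.t) i) {n : ℕ}
    {Θ Θ₁ : D.Fun (n + 2)} (hΘ₁ : Θ₁ ∈ E.X (n + 1)) (h1 : coord (iPull Θ₁) (Fin.last n) = 1)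
    (hΘ : Θ ∈ E.X (n + 1)) : ∃ Θ' ∈ E.X n,
      Θ = coord (iPull Θ) (Fin.last n) • Θ₁ + uPull (Nat.succ_le_succ n.le_succ) Θ' := by
  have hS := Submodule.smul_mem _ (coord (iPull Θ) (Fin.last n)) hΘ₁
  obtain ⟨Θ', hΘ', e⟩ := exists_uPull_of_coord_iPull_last ht (sub_mem hΘ hS) (by
    rw [map_sub, E.coord_sub (E.iPull_mem hΘ) (E.iPull_mem hS), map_smul,
      E.coord_smul (E.iPull_mem hΘ₁), h1, mul_one, sub_self])
  exact ⟨Θ', hΘ', by rw [← e, add_sub_cancel]⟩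

lemma coord_iPull_frobPull_last {n : ℕ} {Θ₁ : D.Fun (n + 2)} (hΘ₁ : Θ₁ ∈ E.X (n + 1))
    (h1 : coord (iPull Θ₁) (Fin.last n) = 1) :
    coord (iPull (frobPull Θ₁)) (Fin.last (n + 1)) = 1 := by
  rw [← Fin.succ_last, E.coord_iPull_frobPull_succ hΘ₁, h1, map_one]

/-- Modulo the denominators, a character of `N^{n+2}` comes from `N^{n+1}`. -/
lemma exists_eq_den_add_uPull {n : ℕ} (h : E.HasMonic n) {Ψ : D.Fun (n + 2)}
    (hΨ : Ψ ∈ E.HomN (n + 2)) : ∃ Ψ₀ ∈ E.den (n + 2), ∃ Ψ' ∈ E.HomN (n + 1),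
      Ψ = Ψ₀ + uPull (n + 1).le_succ Ψ' := by
  obtain ⟨Θ₁, hΘ₁, h1⟩ := h
  have h2 := E.iPull_mem (E.frobPull_mem_X hΘ₁)
  have hS := Submodule.smul_mem _ (coord Ψ (Fin.last (n + 1))) h2
  obtain ⟨Ψ', hΨ', e⟩ := E.exists_uPull_of_coord_last (sub_mem hΨ hS) (by
    rw [E.coord_sub hΨ hS, E.coord_smul h2, coord_iPull_frobPull_last hΘ₁ h1, mul_one, sub_self])
  exact ⟨_, Submodule.smul_mem _ _ (E.iPull_frobPull_mem_den hΘ₁), Ψ', hΨ', by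
    rw [← e, add_sub_cancel]⟩

/-- A denominator without leading term comes from a denominator of lower order. -/
lemma mem_den_of_uPull_mem (ht : ∃ i, ¬ D.π ∣ coef (E.actFun D.t) i) {n : ℕ} (h : E.HasMonic n)
    {Ψ : D.Fun (n + 1)} (hΨ : Ψ ∈ E.HomN (n + 1)) (hd : uPull (n + 1).le_succ Ψ ∈ E.den (n + 2)) :
    Ψ ∈ E.den (n + 1) := by
  obtain ⟨Θ₁, hΘ₁, h1⟩ := h
  have hle : E.den (n + 2) ≤ Submodule.span R {iPull (frobPull Θ₁)} ⊔
      (E.den (n + 1)).map (uPull (n + 1).le_succ) := by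
    refine Submodule.span_le.2 ?_
    rintro _ ⟨Θ, hΘ, rfl⟩
    obtain ⟨Θ', hΘ', e⟩ := exists_eq_smul_add_uPull ht hΘ₁ h1 hΘ
    rw [e, map_add, map_add, map_smulₛₗ, map_smul, frobPull_uPull, iPull_uPull (n + 1).le_succ]
    exact Submodule.add_mem_sup
      (Submodule.smul_mem _ _ (Submodule.mem_span_singleton_self _))
      (Submodule.mem_map_of_mem (E.iPull_frobPull_mem_den hΘ'))
  obtain ⟨y, hy, _, ⟨z, hz, rfl⟩, e⟩ := Submodule.mem_sup.1 (hle hd)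
  obtain ⟨c, rfl⟩ := Submodule.mem_span_singleton.1 hy
  have hz' : z ∈ E.HomN (n + 1) := by
    obtain ⟨Θ, hΘ, rfl, -⟩ := exists_of_mem_den hz
    exact E.iPull_mem hΘ
  have h2 := E.iPull_mem (E.frobPull_mem_X hΘ₁)
  have e1 := congrArg (fun f => coord f (Fin.last (n + 1))) e
  beta_reduce at e1
  rw [E.coord_add (Submodule.smul_mem _ c h2) (E.uPull_mem _ hz'), E.coord_smul h2,
    coord_iPull_frobPull_last hΘ₁ h1, E.coord_uPull _ hz', E.coord_uPull _ hΨ, dif_neg (by simp),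
    dif_neg (by simp), mul_one, add_zero] at e1
  rw [e1, zero_smul, zero_add] at e
  rwa [← uPull_injective _ e]

lemma den_eq_bot {m n : ℕ} (hm : ∀ i < m, E.X i = ⊥) (h : n ≤ m) : E.den n = ⊥ := by
  cases n with
  | zero => rfl
  | succ n =>
    refine Submodule.span_eq_bot.2 ?_
    rintro _ ⟨Θ, hΘ, rfl⟩
    rw [hm n h, Submodule.mem_bot] at hΘ
    rw [hΘ, map_zero, map_zero]

/-- The order `m` at which `E` splits is positive. -/
lemma IsSplittingOrder.exists_eq_succ (ht : ∃ i, ¬ D.π ∣ coef (E.actFun D.t) i) {m : ℕ}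
    (hm : E.IsSplittingOrder m) : ∃ k, m = k + 1 :=
  Nat.exists_eq_succ_of_ne_zero fun h => hm.1 (h ▸ X_zero ht)

lemma eq_zero_of_uPull_mem_den (ht : ∃ i, ¬ D.π ∣ coef (E.actFun D.t) i) {m : ℕ}
    (hm : E.IsSplittingOrder m) {Ψ : D.Fun m} (hΨ : Ψ ∈ E.HomN m) {n : ℕ} (h : m ≤ n)
    (hd : uPull h Ψ ∈ E.den n) : Ψ = 0 := by
  induction n, h using Nat.le_induction with
  | base =>
    rw [den_eq_bot hm.2 le_rfl] at hd
    exact hd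
  | succ n hmn ih =>
    obtain ⟨k, rfl⟩ := hm.exists_eq_succ ht
    obtain ⟨l, rfl⟩ : ∃ l, n = l + 1 := Nat.exists_eq_succ_of_ne_zero (by omega)
    exact ih (mem_den_of_uPull_mem ht (hasMonic ht hm.1 hmn) (E.uPull_mem hmn hΨ) hd)

/-! ### `H(E)` is free of rank `m` -/

variable (E)

instance : DirectedSystem E.Hlevel (fun i j h => E.uH i j h) where
  map_self n x := by
    obtain ⟨Ψ, rfl⟩ := Submodule.mkQ_surjective _ x
    rfl
  map_map n n' n'' h h' x := by
    obtain ⟨Ψ, rfl⟩ := Submodule.mkQ_surjective _ x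
    rfl

lemma toH_uStar {n n' : ℕ} (h : n ≤ n') (Ψ : E.HomN n) :
    E.toH n' (E.uStar h Ψ) = E.toH n Ψ :=
  Module.DirectLimit.of_f (G := E.Hlevel) (f := E.uH) (hij := h) (x := Submodule.Quotient.mk Ψ)

lemma exists_toH_eq (h : E.H) : ∃ n, ∃ Ψ : E.HomN n, E.toH n Ψ = h := by
  obtain ⟨n, x, rfl⟩ := Module.DirectLimit.exists_of h
  obtain ⟨Ψ, rfl⟩ := Submodule.mkQ_surjective _ x
  exact ⟨n, Ψ, rfl⟩

variable {E}

lemma toH_eq_zero_of_mem_den {n : ℕ} {Ψ : E.HomN n} (h : Ψ.1 ∈ E.den n) : E.toH n Ψ = 0 := by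
  have h1 : (Submodule.mkQ ((E.den n).comap (E.HomN n).subtype)) Ψ = 0 :=
    (Submodule.Quotient.mk_eq_zero _).2 h
  rw [toH, LinearMap.comp_apply, h1, map_zero]

lemma exists_uPull_mem_den_of_toH_eq_zero {n : ℕ} {Ψ : E.HomN n} (h : E.toH n Ψ = 0) :
    ∃ n', ∃ hn : n ≤ n', uPull hn Ψ.1 ∈ E.den n' := by
  obtain ⟨n', hn, e⟩ := Module.DirectLimit.of.zero_exact h
  exact ⟨n', hn, (Submodule.Quotient.mk_eq_zero ((E.den n').comap (E.HomN n').subtype)).1 e⟩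

lemma toH_eq_of_sub_mem_den {n : ℕ} {Ψ Ψ' : E.HomN n} (h : (Ψ - Ψ').1 ∈ E.den n) :
    E.toH n Ψ = E.toH n Ψ' := by
  rw [← sub_add_cancel Ψ Ψ', map_add, toH_eq_zero_of_mem_den h, zero_add]

lemma toH_sub_eq_zero {n : ℕ} {Ψ Ψ' : E.HomN n} (h : E.toH n Ψ = E.toH n Ψ') :
    E.toH n (Ψ - Ψ') = 0 := by
  rw [sub_eq_add_neg, map_add, h, ← map_add, add_neg_cancel, map_zero]

lemma toH_injective (ht : ∃ i, ¬ D.π ∣ coef (E.actFun D.t) i) {m : ℕ}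
    (hm : E.IsSplittingOrder m) : Function.Injective (E.toH m) := by
  refine (injective_iff_map_eq_zero _).2 fun Ψ h => ?_
  obtain ⟨n, hn, hd⟩ := exists_uPull_mem_den_of_toH_eq_zero h
  exact Subtype.ext (eq_zero_of_uPull_mem_den ht hm Ψ.2 hn hd)

lemma toH_surjective (ht : ∃ i, ¬ D.π ∣ coef (E.actFun D.t) i) {m : ℕ}
    (hm : E.IsSplittingOrder m) : Function.Surjective (E.toH m) := by
  have key : ∀ n, m ≤ n → ∀ Ψ : E.HomN n, ∃ Ψ' : E.HomN m, E.toH m Ψ' = E.toH n Ψ := by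
    intro n hn
    induction n, hn using Nat.le_induction with
    | base => exact fun Ψ => ⟨Ψ, rfl⟩
    | succ n hmn ih =>
      intro Ψ
      obtain ⟨k, rfl⟩ := hm.exists_eq_succ ht
      obtain ⟨l, rfl⟩ : ∃ l, n = l + 1 := Nat.exists_eq_succ_of_ne_zero (by omega)
      obtain ⟨Ψ₀, hΨ₀, Ψ₁, hΨ₁, e⟩ := exists_eq_den_add_uPull (hasMonic ht hm.1 hmn) Ψ.2
      obtain ⟨Ψ', h'⟩ := ih ⟨Ψ₁, hΨ₁⟩
      refine ⟨Ψ', ?_⟩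
      rw [h', ← E.toH_uStar (l + 1).le_succ, eq_comm]
      refine toH_eq_of_sub_mem_den ?_
      change Ψ.1 - uPull _ Ψ₁ ∈ _
      rwa [e, add_sub_cancel_right]
  intro h
  obtain ⟨n, Ψ, rfl⟩ := E.exists_toH_eq h
  rw [← E.toH_uStar (le_max_left n m)]
  exact key _ (le_max_right _ _) _

variable (E)

/-- `Hom_A(N^n, Ĝa)` is free on `Ψ_1, …, Ψ_n`. -/
def coordEquiv (n : ℕ) : E.HomN n ≃ₗ[R] (Fin n → R) :=
  LinearEquiv.ofBijective
    { toFun := fun Ψ => coord Ψ.1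
      map_add' := fun Ψ Ψ' => funext (E.coord_add Ψ.2 Ψ'.2)
      map_smul' := fun r Ψ => funext (E.coord_smul Ψ.2 r) }
    ⟨fun Ψ Ψ' h => Subtype.ext (E.HomN_ext_coord Ψ.2 Ψ'.2 (congrFun h)), fun c => by
      obtain ⟨ϑ, hϑ⟩ := E.exists_isTheta1
      refine ⟨⟨_, sum_Psi_mem hϑ (n := n) (ext c)⟩, funext fun s => ?_⟩
      exact (coord_sum_Psi hϑ _ s).trans (ext_apply c s)⟩

variable {E}

/-- The basis `Ψ_1, …, Ψ_m` of `H(E)`. -/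
def HEquiv (ht : ∃ i, ¬ D.π ∣ coef (E.actFun D.t) i) {m : ℕ} (hm : E.IsSplittingOrder m) :
    (Fin m → R) ≃ₗ[R] E.H :=
  (E.coordEquiv m).symm.trans
    (LinearEquiv.ofBijective (E.toH m) ⟨toH_injective ht hm, toH_surjective ht hm⟩)

/-! ### Maps out of `H(E)` -/

/-- The universal property of `H(E)`, for semilinear maps. -/
lemma exists_lift_H {M : Type*} [AddCommMonoid M] [Module R M] {σ : R →+* R}
    (g : (n : ℕ) → E.HomN n →ₛₗ[σ] M)
    (hu : ∀ (n n' : ℕ) (h : n ≤ n') (Ψ : E.HomN n), g n' (E.uStar h Ψ) = g n Ψ)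
    (hd : ∀ (n : ℕ) (Ψ : E.HomN n), Ψ.1 ∈ E.den n → g n Ψ = 0) :
    ∃ G : E.H →ₛₗ[σ] M, ∀ (n : ℕ) (Ψ : E.HomN n), G (E.toH n Ψ) = g n Ψ := by
  have key : ∀ {n n' : ℕ} (Ψ : E.HomN n) (Ψ' : E.HomN n'), E.toH n Ψ = E.toH n' Ψ' →
      g n Ψ = g n' Ψ' := by
    intro n n' Ψ Ψ' h
    rw [← E.toH_uStar (le_max_left n n'), ← E.toH_uStar (le_max_right n n')] at h
    obtain ⟨k, hk, hk'⟩ := exists_uPull_mem_den_of_toH_eq_zero (toH_sub_eq_zero h)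
    have h1 := hd k (E.uStar hk (E.uStar (le_max_left n n') Ψ - E.uStar (le_max_right n n') Ψ')) hk'
    rw [hu] at h1
    rw [← hu _ _ (le_max_left n n') Ψ, ← hu _ _ (le_max_right n n') Ψ',
      ← sub_add_cancel (E.uStar (le_max_left n n') Ψ) (E.uStar (le_max_right n n') Ψ'), map_add, h1,
      zero_add]
  choose N Ψ hΨ using E.exists_toH_eq
  refine ⟨{ toFun := fun h => g (N h) (Ψ h)
            map_add' := fun h h' => ?_
            map_smul' := fun r h => ?_ },
    fun n Ψ' => key _ _ (hΨ _)⟩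
  · have h1 : E.toH _ (E.uStar (le_max_left (N h) (N h')) (Ψ h) +
        E.uStar (le_max_right (N h) (N h')) (Ψ h')) = h + h' := by
      rw [map_add, toH_uStar, toH_uStar, hΨ, hΨ]
    rw [key _ _ ((hΨ (h + h')).trans h1.symm), map_add, hu, hu]
  · have h1 : E.toH _ (r • Ψ h) = r • h := by rw [map_smul, hΨ]
    rw [key _ _ ((hΨ (r • h)).trans h1.symm), map_smulₛₗ]

/-- A semilinear endomorphism `f` of the source of `Φ` descends to the image of `Φ` as soon as
`f x` depends only on `Φ x`. -/
lemma exists_semilinear_range {M M' : Type*} [AddCommMonoid M] [Module R M] [AddCommMonoid M']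
    [Module R M'] {σ : R →+* R} (Φ : M →ₗ[R] M') (f : M →ₛₗ[σ] M)
    (h : ∀ x y, Φ x = Φ y → f x = f y) :
    ∃ F : LinearMap.range Φ →ₛₗ[σ] LinearMap.range Φ,
      ∀ x, F (Φ.rangeRestrict x) = Φ.rangeRestrict (f x) := by
  have key : ∀ x y, Φ.rangeRestrict x = Φ.rangeRestrict y →
      Φ.rangeRestrict (f x) = Φ.rangeRestrict (f y) :=
    fun x y hxy => congrArg Φ.rangeRestrict (h x y (congrArg Subtype.val hxy))
  choose s hs using Φ.surjective_rangeRestrict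
  refine ⟨{ toFun := fun y => Φ.rangeRestrict (f (s y)), map_add' := fun y z => ?_,
            map_smul' := fun r y => ?_ }, fun x => key _ _ (hs _)⟩
  · rw [← map_add, ← map_add]
    exact key _ _ (by rw [hs, map_add, hs, hs])
  · rw [← map_smul, ← map_smulₛₗ]
    exact key _ _ (by rw [hs, map_smul, hs])

variable (E)

/-- `𝔣^* : Hom_A(N^n, Ĝa) → Hom_A(N^{n+1}, Ĝa)`. -/
def frobN (n : ℕ) : E.HomN n →ₛₗ[(D.φ : R →+* R)] E.HomN (n + 1) where
  toFun Ψ := ⟨frobPull Ψ.1, E.frobPull_mem_HomN Ψ.2⟩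
  map_add' Ψ Ψ' := Subtype.ext (map_add frobPull Ψ.1 Ψ'.1)
  map_smul' r Ψ := Subtype.ext (map_smulₛₗ frobPull r Ψ.1)

lemma exists_fstar : ∃ f : E.H →ₛₗ[(D.φ : R →+* R)] E.H, ∀ (n : ℕ) (Ψ : E.HomN n),
    f (E.toH n Ψ) = E.toH (n + 1) (E.frobN n Ψ) :=
  exists_lift_H (M := E.H) (σ := (D.φ : R →+* R)) (fun n => (E.toH (n + 1)).comp (E.frobN n))
    (fun n n' h Ψ => by
      have e : E.frobN n' (E.uStar h Ψ) = E.uStar (Nat.succ_le_succ h) (E.frobN n Ψ) :=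
        Subtype.ext (frobPull_uPull h Ψ.1)
      rw [LinearMap.comp_apply, e, toH_uStar]
      rfl)
    fun _ _ h => toH_eq_zero_of_mem_den (frobPull_mem_den h)

/-- The operator `𝔣^*` on `H(E)`. -/
def fstar : E.H →ₛₗ[(D.φ : R →+* R)] E.H := E.exists_fstar.choose

lemma fstar_toH (n : ℕ) (Ψ : E.HomN n) : E.fstar (E.toH n Ψ) = E.toH (n + 1) (E.frobN n Ψ) :=
  E.exists_fstar.choose_spec n Ψ

variable {E}

lemma boundary_eq_zero_iff {n : ℕ} {Ψ : E.HomN n} :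
    E.boundary n Ψ = 0 ↔ ∃ Θ : E.X n, E.iStar n Θ = Ψ := by
  refine (Submodule.Quotient.mk_eq_zero _).trans ⟨?_, ?_⟩
  · rintro ⟨α, hα, h⟩
    obtain ⟨Θ, hΘ, e, -⟩ := E.exists_mem_X_of_push (Ψ := Ψ) (α := ⟨α, hα⟩)
      (Subtype.ext (funext h))
    exact ⟨⟨Θ, hΘ⟩, Subtype.ext e⟩
  · rintro ⟨Θ, rfl⟩
    exact ⟨-vPull Θ.1, neg_mem (vPull_mem Θ.2.1),
      fun a => congrArg (fun η : E.Der => η.1 a) (E.push_iStar Θ)⟩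

lemma rigBoundary_eq_zero_iff {n : ℕ} {Ψ : E.HomN n} :
    E.rigBoundary n Ψ = 0 ↔ ∃ Θ : E.X n, E.iStar n Θ = Ψ ∧ tan Θ.1 0 = 0 := by
  refine (Submodule.Quotient.mk_eq_zero _).trans ⟨?_, ?_⟩
  · rintro ⟨α, hα, h, h'⟩
    obtain ⟨Θ, hΘ, e, e'⟩ := E.exists_mem_X_of_push (Ψ := Ψ) (α := ⟨α, hα⟩)
      (Subtype.ext (funext h))
    refine ⟨⟨Θ, hΘ⟩, Subtype.ext e, ?_⟩
    have h1 : -(0 : R) = coef α 0 := (isTangent_iff hα _).1 h'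
    have h2 := coef_smul hα (-1) 0
    rw [neg_one_smul] at h2
    rw [← coef_vPull_zero, e', h2, ← h1, neg_zero, mul_zero]
  · rintro ⟨Θ, rfl, h0⟩
    refine ⟨-vPull Θ.1, neg_mem (vPull_mem Θ.2.1),
      fun a => congrArg (fun η : E.Der => η.1 a) (E.push_iStar Θ), ?_⟩
    refine (isTangent_iff (neg_mem (vPull_mem Θ.2.1)) _).2 ?_
    have h2 := coef_smul (vPull_mem Θ.2.1) (-1) 0
    rw [neg_one_smul, coef_vPull_zero, h0, mul_zero] at h2
    exact neg_zero.trans h2.symm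

variable (E)

lemma IToExt_toI (n : ℕ) (Ψ : E.HomN n) : E.IToExt (E.toI n Ψ) = E.boundary n Ψ :=
  Module.DirectLimit.lift_of _ _ _

lemma exists_toI_eq (y : E.I) : ∃ n, ∃ Ψ : E.HomN n, E.toI n Ψ = y := by
  obtain ⟨n, ⟨_, Ψ, rfl⟩, rfl⟩ := Module.DirectLimit.exists_of y
  exact ⟨n, Ψ, rfl⟩

lemma IToExt_injective : Function.Injective E.IToExt := by
  refine (injective_iff_map_eq_zero _).2 fun y h => ?_
  obtain ⟨n, Ψ, rfl⟩ := E.exists_toI_eq y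
  rw [IToExt_toI] at h
  have h1 : (E.boundary n).rangeRestrict Ψ = 0 := Subtype.ext h
  rw [toI, LinearMap.comp_apply, h1, map_zero]

lemma boundary_uStar {n n' : ℕ} (h : n ≤ n') (Ψ : E.HomN n) :
    E.boundary n' (E.uStar h Ψ) = E.boundary n Ψ := congrArg E.Inner.mkQ (E.push_uStar h Ψ)

lemma exists_HToI : ∃ ρ : E.H →ₗ[R] E.I, ∀ (n : ℕ) (Ψ : E.HomN n),
    ρ (E.toH n Ψ) = E.toI n Ψ := by
  refine exists_lift_H E.toI (fun n n' h Ψ => E.IToExt_injective ?_)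
    fun n Ψ h => E.IToExt_injective ?_
  · rw [IToExt_toI, IToExt_toI, boundary_uStar]
  · obtain ⟨Θ, hΘ, e, -⟩ := exists_of_mem_den h
    rw [IToExt_toI, map_zero, boundary_eq_zero_iff]
    exact ⟨⟨Θ, hΘ⟩, Subtype.ext e⟩

/-- The map `H(E) → I(E)` induced by `∂`. -/
def HToI : E.H →ₗ[R] E.I := E.exists_HToI.choose

lemma HToI_toH (n : ℕ) (Ψ : E.HomN n) : E.HToI (E.toH n Ψ) = E.toI n Ψ :=
  E.exists_HToI.choose_spec n Ψ

lemma exists_HToHdR : ∃ Φ : E.H →ₗ[R] E.HdR, ∀ (n : ℕ) (Ψ : E.HomN n),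
    Φ (E.toH n Ψ) = E.rigBoundary n Ψ := by
  refine exists_lift_H E.rigBoundary (fun n n' h Ψ => ?_) fun n Ψ h => ?_
  · exact congrArg (fun η => E.RigInner.mkQ (LinearMap.inl R E.Der R η)) (E.push_uStar h Ψ)
  · obtain ⟨Θ, hΘ, e, h0⟩ := exists_of_mem_den h
    exact rigBoundary_eq_zero_iff.2 ⟨⟨Θ, hΘ⟩, Subtype.ext e, h0⟩

/-- The map `Φ : H(E) → H_dR(E)` induced by `Ψ ↦ (E_Ψ^*, s_Ψ)`. -/
def HToHdR : E.H →ₗ[R] E.HdR := E.exists_HToHdR.choose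

lemma HToHdR_toH (n : ℕ) (Ψ : E.HomN n) : E.HToHdR (E.toH n Ψ) = E.rigBoundary n Ψ :=
  E.exists_HToHdR.choose_spec n Ψ

/-! ### The exact rows -/

/-- `Υ : X_n(E) → Lie(E)^*`, minus the derivative along `E`. -/
def XToLie (n : ℕ) : E.X n →ₗ[R] E.LieDual :=
  LinearMap.mul R R ∘ₗ
    { toFun := fun Θ => -tan Θ.1 0
      map_add' := fun Θ Θ' => by
        rw [Submodule.coe_add, tan_add Θ.2.1 Θ'.2.1, neg_add]
      map_smul' := fun r Θ => by
        rw [Submodule.coe_smul, tan_smul Θ.2.1, RingHom.id_apply, smul_eq_mul, mul_neg] }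

lemma lieToHdR_XToLie {n : ℕ} (Θ : E.X n) :
    E.lieToHdR (E.XToLie n Θ) = E.rigBoundary n (E.iStar n Θ) := by
  have h1 : E.XToLie n Θ 1 = -tan Θ.1 0 := mul_one _
  refine eq_comm.1 ((Submodule.Quotient.eq _).2 ?_)
  have hα := Subtype.property (-⟨vPull Θ.1, vPull_mem Θ.2.1⟩ : D.LinFun 1)
  refine ⟨_, hα, fun a => ?_, (isTangent_iff hα _).2 ?_⟩
  · refine (sub_zero ((E.push n (E.iStar n Θ)).1 a)).trans ?_
    exact congrArg (fun η : E.Der => η.1 a) (E.push_iStar Θ)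
  · change -(0 - E.XToLie n Θ 1) = coef (-vPull Θ.1) 0
    have h2 := coef_smul (vPull_mem Θ.2.1) (-1) 0
    rw [neg_one_smul, coef_vPull_zero] at h2
    rw [h1, h2]
    ring

variable {E}

lemma lieToHdR_injective (ht : ∃ i, ¬ D.π ∣ coef (E.actFun D.t) i) :
    Function.Injective E.lieToHdR := by
  refine (injective_iff_map_eq_zero _).2 fun l h => ?_
  obtain ⟨α, hα, h1, h2⟩ := (Submodule.Quotient.mk_eq_zero _).1 h
  have h0 : α = 0 := eq_zero_of_compFun_actFun ht hα (sub_eq_zero.1 (h1 D.t).symm)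
  have h3 : -l 1 = coef α 0 := (isTangent_iff hα _).1 h2
  rw [h0, coef_zero, neg_eq_zero] at h3
  exact LinearMap.ext_ring h3

variable (E)

lemma exact_lieToHdR_hdRToExt : Function.Exact E.lieToHdR E.hdRToExt := by
  intro y
  constructor
  · intro h
    obtain ⟨⟨η, s⟩, rfl⟩ := Submodule.mkQ_surjective _ y
    obtain ⟨α, hα, h1⟩ := (Submodule.Quotient.mk_eq_zero _).1 h
    refine ⟨LinearMap.mul R R (s + coef α 0), eq_comm.1 ((Submodule.Quotient.eq _).2 ?_)⟩
    refine ⟨α, hα, fun a => (sub_zero (η.1 a)).trans (h1 a), (isTangent_iff hα _).2 ?_⟩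
    change -(s - (s + coef α 0) * 1) = _
    ring
  · rintro ⟨l, rfl⟩
    exact map_zero E.Inner.mkQ

lemma hdRToExt_surjective : Function.Surjective E.hdRToExt := by
  intro y
  obtain ⟨η, rfl⟩ := Submodule.mkQ_surjective _ y
  exact ⟨E.RigInner.mkQ (η, 0), rfl⟩

lemma hdRToExt_HToHdR (h : E.H) : E.hdRToExt (E.HToHdR h) = E.IToExt (E.HToI h) := by
  obtain ⟨n, Ψ, rfl⟩ := E.exists_toH_eq h
  rw [HToHdR_toH, HToI_toH, IToExt_toI]
  rfl

lemma HToI_surjective : Function.Surjective E.HToI := by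
  intro y
  obtain ⟨n, Ψ, rfl⟩ := E.exists_toI_eq y
  exact ⟨_, E.HToI_toH n Ψ⟩

variable {E}

lemma XtoH_injective (ht : ∃ i, ¬ D.π ∣ coef (E.actFun D.t) i) {m : ℕ}
    (hm : E.IsSplittingOrder m) : Function.Injective (E.XtoH m) :=
  (toH_injective ht hm).comp fun Θ Θ' h =>
    Subtype.ext (X_ext ht Θ.2 Θ'.2 (congrArg Subtype.val h))

lemma exact_XtoH_HToI (ht : ∃ i, ¬ D.π ∣ coef (E.actFun D.t) i) {m : ℕ}
    (hm : E.IsSplittingOrder m) : Function.Exact (E.XtoH m) E.HToI := by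
  intro h
  obtain ⟨Ψ, rfl⟩ := toH_surjective ht hm h
  rw [HToI_toH, ← map_eq_zero_iff _ E.IToExt_injective, IToExt_toI, boundary_eq_zero_iff]
  exact exists_congr fun Θ => (toH_injective ht hm).eq_iff.symm

/-- On the kernel of `Φ`, which consists of the classes of `i^*Θ` for the `Θ` with vanishing
derivative along `E`, the operator `𝔣^*` is zero. -/
lemma fstar_eq_of_HToHdR_eq (ht : ∃ i, ¬ D.π ∣ coef (E.actFun D.t) i) {m : ℕ}
    (hm : E.IsSplittingOrder m) {h h' : E.H} (e : E.HToHdR h = E.HToHdR h') :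
    E.fstar h = E.fstar h' := by
  obtain ⟨Ψ, rfl⟩ := toH_surjective ht hm h
  obtain ⟨Ψ', rfl⟩ := toH_surjective ht hm h'
  rw [HToHdR_toH, HToHdR_toH, ← sub_eq_zero, ← map_sub, rigBoundary_eq_zero_iff] at e
  obtain ⟨Θ, e, h1⟩ := e
  rw [fstar_toH, fstar_toH]
  refine toH_eq_of_sub_mem_den ?_
  rw [← map_sub, ← e]
  change frobPull (iPull Θ.1) ∈ _
  rw [E.frobPull_iPull Θ.2 h1]
  exact E.iPull_frobPull_mem_den Θ.2

variable (E)

/-! ### The constant `γ` -/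

lemma Psi_sub_sum_eq (ϑ : D.Fun 1) (k : ℕ) (lam : ℕ → R) :
    Psi ϑ (k + 1) (k + 1) - ∑ i ∈ Finset.Ico 1 (k + 1), lam i • Psi ϑ (k + 1) i =
      ∑ j ∈ Finset.range (k + 1), (if j = k then 1 else -lam (j + 1)) • Psi ϑ (k + 1) (j + 1) := by
  rw [Finset.sum_range_succ, if_pos rfl, one_smul, Finset.sum_Ico_eq_sum_range,
    Nat.add_sub_cancel, sub_eq_neg_add, ← Finset.sum_neg_distrib]
  congr 1
  refine Finset.sum_congr rfl fun j hj => ?_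
  rw [if_neg (Finset.mem_range.1 hj).ne, neg_smul, add_comm 1 j]

variable {E}

lemma exists_isThetaM (ht : ∃ i, ¬ D.π ∣ coef (E.actFun D.t) i) {m : ℕ}
    (hm : E.IsSplittingOrder m) {ϑ : D.Fun 1} (hϑ : E.IsTheta1 ϑ) : ∃ Θ, E.IsThetaM ϑ m Θ := by
  obtain ⟨k, rfl⟩ := hm.exists_eq_succ ht
  obtain ⟨Θ, hΘ, h1⟩ := hasMonic ht hm.1 le_rfl
  obtain ⟨c, hc⟩ := exists_eq_sum_Psi hϑ (E.iPull_mem hΘ)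
  rw [hc, coord_sum_Psi hϑ, Fin.val_last] at h1
  refine ⟨Θ, hΘ, fun i => -c (i - 1), ?_⟩
  rw [hc, Psi_sub_sum_eq]
  refine Finset.sum_congr rfl fun j _ => ?_
  split_ifs with hj
  · rw [hj, h1]
  · rw [neg_neg, Nat.add_sub_cancel]

lemma IsThetaM.coord_last {ϑ : D.Fun 1} (hϑ : E.IsTheta1 ϑ) {k : ℕ} {Θ : D.Fun (k + 2)}
    (h : E.IsThetaM ϑ (k + 1) Θ) : coord (iPull Θ) (Fin.last k) = 1 := by
  obtain ⟨-, lam, e⟩ := h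
  rw [e, Psi_sub_sum_eq, coord_sum_Psi hϑ, Fin.val_last, if_pos rfl]

/-- The characters of order `m` are the multiples of `Θ_m`. -/
lemma IsThetaM.eq_smul (ht : ∃ i, ¬ D.π ∣ coef (E.actFun D.t) i) {k : ℕ}
    (hm : E.IsSplittingOrder (k + 1)) {ϑ : D.Fun 1} (hϑ : E.IsTheta1 ϑ) {Θ₁ Θ : D.Fun (k + 2)}
    (h : E.IsThetaM ϑ (k + 1) Θ₁) (hΘ : Θ ∈ E.X (k + 1)) :
    Θ = coord (iPull Θ) (Fin.last k) • Θ₁ := by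
  obtain ⟨Θ', hΘ', e⟩ := exists_eq_smul_add_uPull ht h.1 (h.coord_last hϑ) hΘ
  rw [hm.2 k k.lt_succ_self, Submodule.mem_bot] at hΘ'
  rwa [hΘ', map_zero, add_zero] at e

lemma IsThetaM.unique (ht : ∃ i, ¬ D.π ∣ coef (E.actFun D.t) i) {m : ℕ}
    (hm : E.IsSplittingOrder m) {ϑ : D.Fun 1} (hϑ : E.IsTheta1 ϑ) {Θ Θ' : D.Fun (m + 1)}
    (h : E.IsThetaM ϑ m Θ) (h' : E.IsThetaM ϑ m Θ') : Θ' = Θ := by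
  obtain ⟨k, rfl⟩ := hm.exists_eq_succ ht
  have h1 := h.eq_smul ht hm hϑ h'.1
  rwa [h'.coord_last hϑ, one_smul] at h1

lemma isTangent_vPull {n : ℕ} {Θ : D.Fun (n + 1)} (h : Θ ∈ E.X n) {d : R} :
    D.IsTangent (vPull Θ) d ↔ d = tan Θ 0 := by
  rw [isTangent_iff (vPull_mem h.1), coef_vPull_zero]

lemma IsThetaM.isGamma_iff (ht : ∃ i, ¬ D.π ∣ coef (E.actFun D.t) i) {m : ℕ}
    (hm : E.IsSplittingOrder m) {ϑ : D.Fun 1} (hϑ : E.IsTheta1 ϑ) {Θ : D.Fun (m + 1)}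
    (h : E.IsThetaM ϑ m Θ) {γ : R} : E.IsGamma m γ ↔ γ = D.π * tan Θ 0 := by
  constructor
  · rintro ⟨ϑ', Θ', d, hϑ', h', hd, rfl⟩
    obtain rfl := IsTheta1.unique E hϑ hϑ'
    rw [(isTangent_vPull h'.1).1 hd, h.unique ht hm hϑ h']
  · exact fun hγ => ⟨ϑ, Θ, tan Θ 0, hϑ, h, (isTangent_vPull h.1).2 rfl, hγ⟩

/-- The kernel of `Φ` consists of the multiples of `i^*Θ_m` with vanishing derivative along
`E`. -/
lemma rigBoundary_injective_iff (ht : ∃ i, ¬ D.π ∣ coef (E.actFun D.t) i) {m : ℕ}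
    (hm : E.IsSplittingOrder m) {ϑ : D.Fun 1} (hϑ : E.IsTheta1 ϑ) {Θ : D.Fun (m + 1)}
    (h : E.IsThetaM ϑ m Θ) : Function.Injective (E.rigBoundary m) ↔ D.π * tan Θ 0 ≠ 0 := by
  obtain ⟨k, rfl⟩ := hm.exists_eq_succ ht
  rw [injective_iff_map_eq_zero, mul_ne_zero_iff_left D.π_ne_zero]
  constructor
  · intro hinj h0
    have h1 := congrArg Subtype.val (hinj _ (rigBoundary_eq_zero_iff.2 ⟨⟨Θ, h.1⟩, rfl, h0⟩))
    have h2 := h.coord_last hϑ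
    rw [X_eq_zero_of_iPull ht h.1 h1, map_zero, coord_eq (c := 0)] at h2
    · exact zero_ne_one h2
    · rw [tan_zero, zero_mul]
  · intro h0 Ψ hΨ
    obtain ⟨Θ', rfl, h1⟩ := rigBoundary_eq_zero_iff.1 hΨ
    have e := h.eq_smul ht hm hϑ Θ'.2
    rw [e, tan_smul h.1.1] at h1
    rw [(mul_eq_zero.1 h1).resolve_right h0, zero_smul] at e
    have e' : Θ' = 0 := Subtype.ext e
    rw [e', map_zero]

lemma HToHdR_injective_iff (ht : ∃ i, ¬ D.π ∣ coef (E.actFun D.t) i) {m : ℕ}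
    (hm : E.IsSplittingOrder m) {ϑ : D.Fun 1} (hϑ : E.IsTheta1 ϑ) {Θ : D.Fun (m + 1)}
    (h : E.IsThetaM ϑ m Θ) : Function.Injective E.HToHdR ↔ D.π * tan Θ 0 ≠ 0 := by
  have e : ⇑(E.rigBoundary m) = E.HToHdR ∘ E.toH m := funext fun Ψ => (E.HToHdR_toH m Ψ).symm
  rw [← rigBoundary_injective_iff ht hm hϑ h, e]
  exact ⟨fun h => h.comp (toH_injective ht hm),
    fun h => Function.Injective.of_comp_right h (toH_surjective ht hm)⟩

lemma exists_isGamma (ht : ∃ i, ¬ D.π ∣ coef (E.actFun D.t) i) {m : ℕ}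
    (hm : E.IsSplittingOrder m) : ∃ γ : R, E.IsGamma m γ ∧ (∀ γ' : R, E.IsGamma m γ' → γ' = γ) ∧
      (Function.Injective E.HToHdR ↔ γ ≠ 0) := by
  obtain ⟨ϑ, hϑ⟩ := E.exists_isTheta1
  obtain ⟨Θ, hΘ⟩ := exists_isThetaM ht hm hϑ
  exact ⟨_, (hΘ.isGamma_iff ht hm hϑ).2 rfl, fun _ => (hΘ.isGamma_iff ht hm hϑ).1,
    HToHdR_injective_iff ht hm hϑ hΘ⟩

end AdmissibleModule

end FrobBase

end

theorem theorem1p2 {Fq A : Type v} {R : Type u} [Field Fq] [Finite Fq] [CommRing A] [Algebra Fq A]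
    [CommRing R] [IsDomain R] [IsDiscreteValuationRing R] [Algebra A R]
    (C : PuncturedCurve Fq A) (D : FrobBase Fq A R) (E : D.AdmissibleModule) (r : ℕ)
    (hE : E.IsDrinfeld C r) (m : ℕ) (hm : E.IsSplittingOrder m) :
    Module.Free R E.H ∧ Module.Finite R E.H ∧ Module.finrank R E.H = m ∧
    ∃ (fstar : E.H →ₛₗ[(D.φ : R →+* R)] E.H) (ρ : E.H →ₗ[R] E.I) (Φ : E.H →ₗ[R] E.HdR)
      (Υ : E.X m →ₗ[R] E.LieDual),
      (∀ (n : ℕ) (Ψ : E.HomN n), ∃ h : FrobBase.frobPull Ψ.1 ∈ E.HomN (n + 1),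
        fstar (E.toH n Ψ) = E.toH (n + 1) ⟨FrobBase.frobPull Ψ.1, h⟩) ∧
      (∀ (n : ℕ) (Ψ : E.HomN n), ρ (E.toH n Ψ) = E.toI n Ψ) ∧
      (∀ (n : ℕ) (Ψ : E.HomN n), Φ (E.toH n Ψ) = E.rigBoundary n Ψ) ∧
      (Function.Injective (E.XtoH m) ∧ Function.Exact (E.XtoH m) ρ ∧ Function.Surjective ρ) ∧
      (Function.Injective E.lieToHdR ∧ Function.Exact E.lieToHdR E.hdRToExt ∧
        Function.Surjective E.hdRToExt) ∧
      (∀ Θ : E.X m, E.lieToHdR (Υ Θ) = Φ (E.XtoH m Θ)) ∧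
      (∀ h : E.H, E.hdRToExt (Φ h) = E.IToExt (ρ h)) ∧
      Function.Injective E.IToExt ∧
      (∃ F : LinearMap.range Φ →ₛₗ[(D.φ : R →+* R)] LinearMap.range Φ,
        ∀ h : E.H, F (Φ.rangeRestrict h) = Φ.rangeRestrict (fstar h)) ∧
      ∃ γ : R, E.IsGamma m γ ∧ (∀ γ' : R, E.IsGamma m γ' → γ' = γ) ∧
        (Function.Injective Φ ↔ γ ≠ 0) := by
  have ht := hE.exists_not_dvd_coef
  have hfin : Module.finrank R E.H = m := by
    rw [← (FrobBase.AdmissibleModule.HEquiv ht hm).finrank_eq, Module.finrank_fin_fun]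
  exact ⟨Module.Free.of_equiv (FrobBase.AdmissibleModule.HEquiv ht hm),
    Module.Finite.equiv (FrobBase.AdmissibleModule.HEquiv ht hm), hfin,
    E.fstar, E.HToI, E.HToHdR, E.XToLie m,
    fun n Ψ => ⟨E.frobPull_mem_HomN Ψ.2, E.fstar_toH n Ψ⟩, E.HToI_toH, E.HToHdR_toH,
    ⟨FrobBase.AdmissibleModule.XtoH_injective ht hm,
      FrobBase.AdmissibleModule.exact_XtoH_HToI ht hm, E.HToI_surjective⟩,
    ⟨FrobBase.AdmissibleModule.lieToHdR_injective ht, E.exact_lieToHdR_hdRToExt,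
      E.hdRToExt_surjective⟩,
    fun Θ => (E.lieToHdR_XToLie Θ).trans (E.HToHdR_toH _ _).symm, E.hdRToExt_HToHdR,
    E.IToExt_injective,
    FrobBase.AdmissibleModule.exists_semilinear_range E.HToHdR E.fstar
      fun _ _ => FrobBase.AdmissibleModule.fstar_eq_of_HToHdR_eq ht hm,
    FrobBase.AdmissibleModule.exists_isGamma ht hm⟩
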